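/- Let $n\ge 0$. Notation. **Manifolds with corners.** A map between subsets of Euclidean spaces is smooth if locally it extends to a smooth map on an open set of the ambient space. A subset $X$ of a Euclidean space is an $n$-dimensional manifold with corners if it is locally diffeomorphic to relatively open subsets of $[0,\infty)^n$. Its strata (open faces) are the connected components of the sets of points with exactly $k$ vanishing coordinates in a chart $(0\le k\le n)$, ordered by $F\le G$ if $F\subseteq\overline G$. **The associahedron.** Let $\Delta^n=\{x\in[0,1]^{n+1}:\sum_i x_i=1\}$. Call $S\subset\{1,\dots,n+1\}$ with $2\le \#S\le n$ *consecutive* if $i,j\in S$ and $i<k<j$ imply $k\in S$; it determines the face $\{x_i=0 \ \forall i\in S\}$ of $\Delta^n$. Stasheff's associahedron $A_n$ is the truncation of $\Delta^n$ at its consecutive faces, $$A_n=A_n(\varepsilon)=\Big\{x\in\Delta^n:\ \sum_{i\in S}x_i\ge\varepsilon_S\ \text{ for all consecutive } S\Big\},$$ where the $\varepsilon_S>0$ are any sufficiently small numbers: $2\varepsilon_S<1$ for all consecutive $S$, and $2\varepsilon_S<\varepsilon_T$ for all consecutive $S\subsetneq T$. **Configuration spaces.** For $x=(x_i)$ with pairwise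 distinct $x_i\in\mathbb R$ put $\pi_{ij}(x)=\frac{x_i-x_j}{|x_i-x_j|}\in S^0$ $(i\neq j)$ and $s_{ijk}(x)=\frac{|x_i-x_j|}{|x_i-x_k|}\in[0,\infty]$ $(i,j,k$ distinct$)$. Here $[0,\infty]$ has the smooth structure with charts $t$ and $1/t$; equivalently it is identified with $[0,1]$ by $t\mapsto t/(1+t)$. Write $\widetilde C^o_{n+2}[\mathbb R]$ for the closure, in the product of the spaces $S^0$ (one for each pair $i\ne j$) and $[0,\infty]$ (one for each triple of distinct $i,j,k$), of the set of all $\big((\pi_{ij}(x)),(s_{ijk}(x))\big)$ with $x_0<x_1<\dots<x_{n+1}$ in $\mathbb R$ (up to translation and positive scaling, so that one may take $\sum_i x_i=0$ and $\max_i|x_i|=1$). Let $I=[0,1]$, and let $C_{n+2}[I]$ be the closure of the set of all $\big(x,(\pi_{ij}(x)),(s_{ijk}(x))\big)$, $x$ a tuple of $n+2$ distinct points of $I$, in the product of $I^{n+2}$ with the spaces above. Let $C^o_n[I,\partial]$ be the closure in $C_{n+2}[I]$ of the set of those points with $0=x_0<x_1<\dots<x_n<x_{n+1}=1$. **Trees.**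 Let $\Psi^o_{n+2}$ be the poset of (isomorphism classes of) planar rooted trees with $n+2$ leaves in which every non-leaf vertex, including the root, has at least two edges going up; $T\le T'$ if $T'$ is obtained from $T$ by contracting non-leaf edges. **Theorem.** $A_n$, $\widetilde C^o_{n+2}[\mathbb R]$ and $C^o_n[I,\partial]$ are $n$-dimensional manifolds with corners and are all diffeomorphic as manifolds with corners. Moreover, their barycentric subdivisions are diffeomorphic to the realization $|\Psi^o_{n+2}|$ of (the order complex of) the poset $\Psi^o_{n+2}$. Explicitly: there are an isomorphism $e$ from $\Psi^o_{n+2}$ to the poset of strata of $A_n$ and diffeomorphisms $\varphi:A_n\to\widetilde C^o_{n+2}[\mathbb R]$ and $\psi:A_n\to C^o_n[I,\partial]$ such that, for the map $\beta:|\Psi^o_{n+2}|\to A_n$ that sends a vertex $T$ to the barycenter (mean of the vertices) of the closed face $\overline{e(T)}$ and is affine on simplices, each of the maps $\beta$, $\varphi\circ\beta$, $\psi\circ\beta$ is a homeomorphism onto its target, restricts to a diffeomorphism from every closed simplex onto its image, and, for an isomorphism of $\Psi^o_{n+2}$ with the poset of strata of the target, maps the open simplex of every chain with greatest element $T$ into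 the stratum corresponding to $T$. -/

import Mathlib

open Set Topology
open scoped ContDiff

/-! ## Smooth maps between subsets of Euclidean spaces, and manifolds with corners

A manifold is a submanifold of a Euclidean space, so smoothness of a map defined on a subset means
that the map extends, locally, to a smooth map on an open subset of the ambient vector space. -/

section Smooth

variable {E : Type*} [NormedAddCommGroup E] [NormedSpace ℝ E]
variable {F : Type*} [NormedAddCommGroup F] [NormedSpace ℝ F]

/-- `f` is smooth on the subset `X`: near every point of `X` it agrees on `X` with a smooth map
that is defined on an open subset of the ambient space. -/
def IsSmoothOnSet (f : E → F) (X : Set E) : Prop :=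
  ∀ x ∈ X, ∃ U : Set E, IsOpen U ∧ x ∈ U ∧
    ∃ g : E → F, ContDiffOn ℝ ∞ g U ∧ EqOn f g (X ∩ U)

/-- `f` restricts to a diffeomorphism from the subset `X` onto the subset `Y`. -/
def IsDiffeoOn (f : E → F) (X : Set E) (Y : Set F) : Prop :=
  MapsTo f X Y ∧ IsSmoothOnSet f X ∧
    ∃ g : F → E, MapsTo g Y X ∧ IsSmoothOnSet g Y ∧ InvOn g f X Y

/-- The model corner `[0, ∞)^d`. -/
def quadrant (d : ℕ) : Set (Fin d → ℝ) := {y | ∀ i, 0 ≤ y i}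

/-- `φ` is a corner chart of `X` with domain `X ∩ U`: a diffeomorphism from `X ∩ U` onto a
relatively open subset of `[0, ∞)^d`. -/
def IsCornerChart (d : ℕ) (X U : Set E) (φ : E → Fin d → ℝ) : Prop :=
  IsOpen U ∧ ∃ V : Set (Fin d → ℝ), IsOpen V ∧ IsDiffeoOn φ (X ∩ U) (quadrant d ∩ V)

/-- `X` is a `d`-dimensional (sub)manifold with corners. -/
def IsManifoldWithCorners (d : ℕ) (X : Set E) : Prop :=
  ∀ x ∈ X, ∃ (U : Set E) (φ : E → Fin d → ℝ), x ∈ U ∧ IsCornerChart d X U φ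

/-- The points of `X` of depth `k`: those with exactly `k` vanishing coordinates in a chart. -/
def depthStratum (d : ℕ) (X : Set E) (k : ℕ) : Set E :=
  {x | x ∈ X ∧ ∃ (U : Set E) (φ : E → Fin d → ℝ), x ∈ U ∧ IsCornerChart d X U φ ∧
    {i | φ x i = 0}.ncard = k}

/-- The strata (open faces) of a manifold with corners: the connected components of the sets of
points of a given depth. -/
def OpenFace (d : ℕ) (X : Set E) : Type _ :=
  {S : Set E // ∃ k, ∃ x ∈ depthStratum d X k, S = connectedComponentIn (depthStratum d X k) x}

/-- One stratum is below another if it is contained in the closure of the other. -/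
instance (d : ℕ) (X : Set E) : LE (OpenFace d X) := ⟨fun S T => S.1 ⊆ closure T.1⟩

end Smooth

/-! ## The realization of a finite poset and barycentric subdivisions -/

section Realization

/-- The geometric realization of the order complex of a (finite) poset `P`, in barycentric
coordinates: formal convex combinations of the elements of a finite chain. -/
def orderRealization (P : Type*) [LE P] : Set (P → ℝ) :=
  {f | (∀ p, 0 ≤ f p) ∧ f.support.Finite ∧ IsChain (· ≤ ·) f.support ∧ ∑ᶠ p, f p = 1}

open scoped Classical in
/-- The inclusion `ℝ^c → ℝ^P` for a finite subset `c` of `P`, by zero outside `c`.  It maps the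
standard simplex on `c` onto the simplex of the order complex that is spanned by `c`. -/
noncomputable def extendByZero {P : Type*} (c : Finset P) (t : c → ℝ) : P → ℝ :=
  fun p => if hp : p ∈ c then t ⟨p, hp⟩ else 0

variable {E : Type*} [NormedAddCommGroup E] [NormedSpace ℝ E]

/-- Let `X` be a manifold with corners whose poset of strata is identified with `P` by `e`.  The
map `h` exhibits the realization of `P` as a barycentric subdivision of `X`: it is a homeomorphism
from the realization of `P` onto `X`, it restricts to a diffeomorphism from every closed simplex
onto its image, and the simplices are those of the flags of faces of `X`, that is, the open simplex
of a chain with greatest element `p` lies in the stratum `e p` (in particular, the vertex `p`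
is sent to an interior point of the face `e p`). -/
structure IsBarycentricSubdivision {P : Type*} [LE P] {d : ℕ} {X : Set E}
    (e : P ≃o OpenFace d X) (h : (P → ℝ) → E) : Prop where
  mapsTo : MapsTo h (orderRealization P) X
  continuousOn : ContinuousOn h (orderRealization P)
  exists_inverse : ∃ g : E → P → ℝ, MapsTo g X (orderRealization P) ∧ ContinuousOn g X ∧
    InvOn g h (orderRealization P) X
  diffeo_simplex : ∀ c : Finset P, IsChain (· ≤ ·) (c : Set P) →
    IsDiffeoOn (fun t : c → ℝ => h (extendByZero c t)) (stdSimplex ℝ c)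
      ((fun t : c → ℝ => h (extendByZero c t)) '' stdSimplex ℝ c)
  mem_face : ∀ f ∈ orderRealization P, ∀ p, p ∈ f.support → (∀ q ∈ f.support, q ≤ p) →
    h f ∈ (e p).1

/-- The barycenter of a polytope: the mean of its vertices. -/
noncomputable def barycenter (K : Set E) : E :=
  ((K.extremePoints ℝ).ncard : ℝ)⁻¹ • ∑ᶠ v ∈ K.extremePoints ℝ, v

/-- For a polytope `X` whose poset of strata is identified with `P` by `e`: the map from the
realization of `P` that sends the vertex `p` to the barycenter of the closed face `p` and is affine
on every simplex. -/
noncomputable def barycentricMap {P : Type*} [LE P] {d : ℕ} {X : Set E}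
    (e : P ≃o OpenFace d X) (f : P → ℝ) : E :=
  ∑ᶠ p, f p • barycenter (closure (e p).1)

end Realization

/-! ## The poset of planar trees -/

/-- Planar rooted trees: a leaf, or a vertex with an ordered list of trees over it. -/
inductive PlanarTree : Type
  | leaf : PlanarTree
  | node : List PlanarTree → PlanarTree

namespace PlanarTree

/-- The number of leaves. -/
def numLeaves : PlanarTree → ℕ
  | leaf => 1
  | node ts => (ts.map numLeaves).sum

/-- The number of non-leaf vertices. -/
def numNodes : PlanarTree → ℕ
  | leaf => 0
  | node ts => (ts.map numNodes).sum + 1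

/-- Every non-leaf vertex has at least two edges going up: the root has valence greater than one,
and no other vertex is bivalent. -/
inductive IsReduced : PlanarTree → Prop
  | leaf : IsReduced leaf
  | node (ts : List PlanarTree) : 2 ≤ ts.length → (∀ t ∈ ts, IsReduced t) → IsReduced (node ts)

/-- `ContractsTo T T'`: the tree `T'` arises from `T` by contracting one non-leaf edge. -/
inductive ContractsTo : PlanarTree → PlanarTree → Prop
  | root (l cs r : List PlanarTree) : ContractsTo (node (l ++ node cs :: r)) (node (l ++ cs ++ r))
  | above (l r : List PlanarTree) (t t' : PlanarTree) :
      ContractsTo t t' → ContractsTo (node (l ++ t :: r)) (node (l ++ t' :: r))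

theorem ContractsTo.numNodes_lt {t t' : PlanarTree} (h : ContractsTo t t') :
    t'.numNodes < t.numNodes := by
  induction h with
  | root l cs r => simp [numNodes]
  | above l r t t' _ ih => simp [numNodes]; omega

theorem numNodes_le_of_reflTransGen {t t' : PlanarTree}
    (h : Relation.ReflTransGen ContractsTo t t') : t'.numNodes ≤ t.numNodes := by
  induction h with
  | refl => exact le_rfl
  | tail _ h ih => exact h.numNodes_lt.le.trans ih

theorem eq_of_reflTransGen {t t' : PlanarTree} (h : Relation.ReflTransGen ContractsTo t t')
    (h' : Relation.ReflTransGen ContractsTo t' t) : t = t' := by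
  rcases Relation.ReflTransGen.cases_head h with h0 | ⟨s, hs, hst⟩
  · exact h0
  · have h1 := hs.numNodes_lt
    have h2 := numNodes_le_of_reflTransGen hst
    have h3 := numNodes_le_of_reflTransGen h'
    omega

end PlanarTree

/-- The trees with `m` leaves, labelled in the planar order, without bivalent internal vertices and
with root of valence greater than one (for `2 ≤ m`). -/
def PsiO (m : ℕ) : Type := {T : PlanarTree // T.IsReduced ∧ T.numLeaves = m}

/-- `T ≤ T'` if `T'` is a contraction of `T` along some set of non-leaf edges. -/
instance (m : ℕ) : PartialOrder (PsiO m) where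
  le T T' := Relation.ReflTransGen PlanarTree.ContractsTo T.1 T'.1
  le_refl _ := Relation.ReflTransGen.refl
  le_trans _ _ _ h h' := h.trans h'
  le_antisymm _ _ h h' := Subtype.ext (PlanarTree.eq_of_reflTransGen h h')

/-! ## Compactified configuration spaces -/

section Configurations

/-- Ordered pairs of distinct indices. -/
abbrev Conf2 (n : ℕ) : Type := {p : Fin n × Fin n // p.1 ≠ p.2}

/-- Ordered triples of distinct indices. -/
abbrev Conf3 (n : ℕ) : Type :=
  {p : Fin n × Fin n × Fin n // p.1 ≠ p.2.1 ∧ p.1 ≠ p.2.2 ∧ p.2.1 ≠ p.2.2}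

variable {V : Type*} [NormedAddCommGroup V] [NormedSpace ℝ V]

/-- `C_n(M)`: configurations of `n` distinct points of `M`. -/
def confSpace (n : ℕ) (M : Set V) : Set (Fin n → V) :=
  {x | (∀ i, x i ∈ M) ∧ Function.Injective x}

/-- `π_ij`: the unit vector in the direction of `x_i - x_j`. -/
noncomputable def unitDirection {n : ℕ} (x : Fin n → V) (p : Conf2 n) : V :=
  ‖x p.1.1 - x p.1.2‖⁻¹ • (x p.1.1 - x p.1.2)

/-- `s_ijk`: the ratio `|x_i - x_j| / |x_i - x_k|`. -/
noncomputable def distanceRatio {n : ℕ} (x : Fin n → V) (p : Conf3 n) : ℝ :=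
  ‖x p.1.1 - x p.1.2.1‖ / ‖x p.1.1 - x p.1.2.2‖

/-- The coordinate `t ↦ t / (1 + t)`, which identifies the closed interval `[0, ∞]` (a manifold
with boundary with the charts `t` on `[0, ∞)` and `1 / t` on `(0, ∞]`) with `[0, 1]`, sending `∞`
to `1`.  Through it the factors `[0, ∞]` below are written as `[0, 1]`. -/
noncomputable def extCoord (t : ℝ) : ℝ := t / (1 + t)

/-- `A_n[M]`, the product of `M^n`, of unit spheres and of closed intervals `[0, ∞]`, as a subset
of a vector space. -/
def ambientA (n : ℕ) (M : Set V) : Set ((Fin n → V) × (Conf2 n → V) × (Conf3 n → ℝ)) :=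
  {a | (∀ i, a.1 i ∈ M) ∧ (∀ p, ‖a.2.1 p‖ = 1) ∧ ∀ p, a.2.2 p ∈ Icc (0 : ℝ) 1}

/-- `Ã_n[V]`, the same product without the factor `M^n`. -/
def ambientTildeA (n : ℕ) (V : Type*) [NormedAddCommGroup V] :
    Set ((Conf2 n → V) × (Conf3 n → ℝ)) :=
  {a | (∀ p, ‖a.1 p‖ = 1) ∧ ∀ p, a.2 p ∈ Icc (0 : ℝ) 1}

/-- The map `ι_n = (π_ij) × (s_ijk)`. -/
noncomputable def iotaMap (n : ℕ) (x : Fin n → V) : (Conf2 n → V) × (Conf3 n → ℝ) :=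
  (unitDirection x, fun p => extCoord (distanceRatio x p))

/-- The map `α_n`, the product of the inclusion with `(π_ij)` and `(s_ijk)`. -/
noncomputable def alphaMap (n : ℕ) (x : Fin n → V) :
    (Fin n → V) × (Conf2 n → V) × (Conf3 n → ℝ) :=
  (x, iotaMap n x)

/-- The closure of `S` in the subspace `A`. -/
def closureIn {Z : Type*} [TopologicalSpace Z] (A S : Set Z) : Set Z := closure S ∩ A

/-- `C_n[M]`, the closure of the image of `α_n` in `A_n[M]`. -/
def confCompact (n : ℕ) (M : Set V) : Set ((Fin n → V) × (Conf2 n → V) × (Conf3 n → ℝ)) :=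
  closureIn (ambientA n M) (alphaMap n '' confSpace n M)

/-- `C̃_n(V)`, configurations modulo translation and positive scaling, through the representatives
with `∑ x_i = 0` and `max |x_i| = 1` (the norm of `Fin n → V` is the maximum norm). -/
def confTilde (n : ℕ) (V : Type*) [NormedAddCommGroup V] : Set (Fin n → V) :=
  {x | Function.Injective x ∧ ∑ i, x i = 0 ∧ ‖x‖ = 1}

/-- `C̃ᵒ_n[ℝ]`, the closure in `Ã_n[ℝ]` of the component `x_1 < ⋯ < x_n` of `C̃_n(ℝ)`. -/
def confTildeCompactOrdered (n : ℕ) : Set ((Conf2 n → ℝ) × (Conf3 n → ℝ)) :=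
  closureIn (ambientTildeA n ℝ) (iotaMap n '' {x | x ∈ confTilde n ℝ ∧ StrictMono x})

/-- `Cᵒ_n[I, ∂]`, for the unit interval `I = [0, 1]` with the boundary points `0` and `1`: the
closure in `C_{n+2}[I]` of the configurations `(0, x_1, …, x_n, 1)` with
`0 < x_1 < ⋯ < x_n < 1`. -/
def confIntervalCompactOrdered (n : ℕ) :
    Set ((Fin (n + 2) → ℝ) × (Conf2 (n + 2) → ℝ) × (Conf3 (n + 2) → ℝ)) :=
  closureIn (confCompact (n + 2) (Icc (0 : ℝ) 1))
    (alphaMap (n + 2) '' {x | x ∈ confSpace (n + 2) (Icc (0 : ℝ) 1) ∧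
      x 0 = 0 ∧ x (Fin.last (n + 1)) = 1 ∧ StrictMono x})

end Configurations

/-! ## The associahedron as a truncation of the simplex -/

/-- `S` is a consecutive set of labels of facets of `Δ^n` that determines a face of codimension at
least two: `S` has at least two elements, is not everything, and has no gaps. -/
def IsConsecutive {n : ℕ} (S : Finset (Fin (n + 1))) : Prop :=
  2 ≤ S.card ∧ S ≠ Finset.univ ∧ ∀ i ∈ S, ∀ j ∈ S, ∀ k, i < k → k < j → k ∈ S

/-- The depths `ε S` at which the consecutive faces of `Δ^n` are truncated are small enough.  A
face is determined by the set `S` of labels of the facets that contain it, so the faces of smaller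
dimension, which are truncated first, are those with larger `S`; every depth is small with respect
to the simplex and to the depths of the truncations of the smaller faces contained in the face. -/
def IsTruncationDepth {n : ℕ} (ε : Finset (Fin (n + 1)) → ℝ) : Prop :=
  (∀ S, IsConsecutive S → 0 < ε S ∧ 2 * ε S < 1) ∧
    ∀ S T, IsConsecutive S → IsConsecutive T → S ⊂ T → 2 * ε S < ε T

/-- Stasheff's associahedron `A_n`: the simplex `Δ^n`, truncated at its consecutive faces.  The
face with labels `S` is `{x | ∀ i ∈ S, x i = 0}`, and `∑ i ∈ S, x i` is the distance to it (half
the distance in the `ℓ¹` metric), so its truncation is `∑ i ∈ S, x i ≥ ε S`. -/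
def associahedron (n : ℕ) (ε : Finset (Fin (n + 1)) → ℝ) : Set (Fin (n + 1) → ℝ) :=
  {x | x ∈ stdSimplex ℝ (Fin (n + 1)) ∧ ∀ S, IsConsecutive S → ε S ≤ ∑ i ∈ S, x i}

/-! ## Smooth maps on subsets -/

-- All three spaces are compared with a fourth. Up to translation and positive scaling, a
-- configuration of `n + 2` increasing points is a vector `t` of `n + 1` positive gaps, and this is
-- the same as the family of ratios `t_i / ∑_{j ∈ I} t_j`, one probability distribution on each
-- interval `I` of labels. Let R be the closure `ratioClosure` of the set of these families.
--
-- Configuration spaces. The coordinate of a triple of points is a quotient of sums of ratios in the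
-- hull of the triple, with denominator at least one; conversely, a ratio is a difference of two
-- relative positions. Both formulas are smooth on the closures, so R is diffeomorphic to both
-- configuration spaces (`isDiffeoOn_confOfRatios`, `isDiffeoOn_intervalOfRatios`).
--
-- Associahedron. It is a Minkowski sum `∑ y_I Δ_I` of the faces of the simplex spanned by the
-- intervals, where `y_I` is a second difference of the truncation depths
-- (`sum_powerset_minkowskiCoeff`). The smallness of the depths makes `y_I` positive as soon as `I`
-- has two elements. Hence `r ↦ ∑ y_I r_I` maps R to the associahedron. This map is a diffeomorphism
-- (`isDiffeoOn_minkowskiMap`). It is injective because any two families in R are comparable along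
-- some order of the labels (`injOn_minkowskiMap`). Its differential is injective because pairing it
-- with the logarithmic derivative of `t` gives a positive combination of variances
-- (`chart_deriv_injective`). It is onto because the image of the positive vectors is open and
-- closed in the interior.
--
-- The differential at the boundary is taken in monomial charts. A permutation `σ`, read as
-- priorities of the labels, builds a binary search tree in which the ancestors of `i` are the `k`
-- with `i ∈ treeIv σ k`. Put `t_i` equal to the product of `z_k` over the ancestors of `i`. In
-- every ratio the common factors cancel and one monomial in the denominator becomes 1, so the
-- ratios are smooth for all `z ≥ 0`; finitely many such charts cover R (`exists_ratioChart`).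
--
-- Faces. In these charts the facets through a point are intervals of one search tree. So the
-- associahedron is a simple polytope with affine corner charts, its strata are the sets of points
-- with a prescribed set of tight facets, and the sets that occur are the nested ones
-- (`isNested_tightSet`, `IsNested.faceSet_nonempty`). The ranges of leaves above the vertices of a
-- planar tree identify trees with nested sets, contraction being reverse inclusion
-- (`le_iff_treeFaces_subset`, `exists_treeFaces_eq`).
--
-- Subdivision. Barycenters lie in the open faces, and each closed face is the cone from such a
-- point over its boundary, which makes the affine map from the order complex bijective
-- (`injOn_linearCombination`, `surjOn_linearCombination`). Diffeomorphisms carry strata and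
-- subdivisions to the other two spaces.

theorem exists_continuousOn_inverse {A B : Type*} [TopologicalSpace A] [TopologicalSpace B]
    [T2Space B] [Nonempty A] {f : A → B} {K : Set A} {L : Set B} (hK : IsCompact K)
    (hf : ContinuousOn f K) (hinj : InjOn f K) (hL : f '' K = L) :
    ∃ g : B → A, MapsTo g L K ∧ ContinuousOn g L ∧ InvOn g f K L := by
  subst hL
  have hinv : InvOn (Function.invFunOn f K) f K (f '' K) :=
    ⟨hinj.leftInvOn_invFunOn, (surjOn_image _ _).rightInvOn_invFunOn⟩
  have hg : MapsTo (Function.invFunOn f K) (f '' K) K := (surjOn_image _ _).mapsTo_invFunOn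
  refine ⟨Function.invFunOn f K, hg, continuousOn_iff_isClosed.2 fun C hC => ?_, hinv⟩
  -- The preimage of a closed `C` under the inverse is, inside `L`, the image of the compact set `K
  -- ∩ C`, hence closed.
  refine ⟨f '' (K ∩ C), ((hK.inter_right hC).image_of_continuousOn
    (hf.mono inter_subset_left)).isClosed, ?_⟩
  ext x
  constructor
  · rintro ⟨hx, hxA⟩
    exact ⟨⟨_, ⟨hg hxA, hx⟩, hinv.2 hxA⟩, hxA⟩
  · rintro ⟨⟨r, ⟨hr, hrC⟩, rfl⟩, hxA⟩
    refine ⟨?_, hxA⟩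
    rw [mem_preimage, hinv.1 hr]
    exact hrC

section SmoothBasics

variable {E F G : Type*} [NormedAddCommGroup E] [NormedSpace ℝ E]
  [NormedAddCommGroup F] [NormedSpace ℝ F] [NormedAddCommGroup G] [NormedSpace ℝ G]

theorem IsSmoothOnSet.continuousOn {f : E → F} {X : Set E} (h : IsSmoothOnSet f X) :
    ContinuousOn f X := by
  intro x hx
  obtain ⟨U, hU, hxU, g, hg, hfg⟩ := h x hx
  have h1 : ContinuousWithinAt g (X ∩ U) x :=
    ((hg.continuousOn x hxU).mono inter_subset_right)
  have h2 : ContinuousWithinAt f (X ∩ U) x := h1.congr hfg (hfg ⟨hx, hxU⟩)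
  exact (continuousWithinAt_inter (hU.mem_nhds hxU)).1 h2

theorem IsSmoothOnSet.mono {f : E → F} {X X' : Set E} (h : IsSmoothOnSet f X) (hX : X' ⊆ X) :
    IsSmoothOnSet f X' := fun x hx => by
  obtain ⟨U, hU, hxU, g, hg, hfg⟩ := h x (hX hx)
  exact ⟨U, hU, hxU, g, hg, hfg.mono (inter_subset_inter_left _ hX)⟩

theorem IsSmoothOnSet.comp {g : F → G} {f : E → F} {X : Set E} {Y : Set F}
    (hg : IsSmoothOnSet g Y) (hf : IsSmoothOnSet f X) (hXY : MapsTo f X Y) :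
    IsSmoothOnSet (g ∘ f) X := by
  intro x hx
  obtain ⟨U, hU, hxU, f', hf', hff'⟩ := hf x hx
  obtain ⟨V, hV, hxV, g', hg', hgg'⟩ := hg (f x) (hXY hx)
  refine ⟨U ∩ f' ⁻¹' V, hf'.continuousOn.isOpen_inter_preimage hU hV, ⟨hxU, ?_⟩, g' ∘ f', ?_, ?_⟩
  · rw [mem_preimage, ← hff' ⟨hx, hxU⟩]; exact hxV
  · exact hg'.comp (hf'.mono inter_subset_left) fun y hy => hy.2
  · rintro y ⟨hyX, hyU, hyV⟩
    have h1 := hff' ⟨hyX, hyU⟩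
    simp only [Function.comp]
    rw [← h1]
    exact hgg' ⟨hXY hyX, by rw [h1]; exact hyV⟩

theorem ContDiffOn.isSmoothOnSet {f : E → F} {X U : Set E} (hf : ContDiffOn ℝ ∞ f U)
    (hU : IsOpen U) (hX : X ⊆ U) : IsSmoothOnSet f X :=
  fun _ hx => ⟨U, hU, hX hx, f, hf, fun _ _ => rfl⟩

theorem ContDiff.isSmoothOnSet {f : E → F} (hf : ContDiff ℝ ∞ f) (X : Set E) :
    IsSmoothOnSet f X := hf.contDiffOn.isSmoothOnSet isOpen_univ (subset_univ X)

/-- A map that agrees near each point of `X` with a map that is analytic there is smooth. -/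
theorem isSmoothOnSet_of_contDiffAt {f : E → F} {X : Set E}
    (h : ∀ x ∈ X, ∃ g : E → F, ContDiffAt ℝ ω g x ∧ f =ᶠ[𝓝[X] x] g) : IsSmoothOnSet f X := by
  intro x hx
  obtain ⟨g, hg, hfg⟩ := h x hx
  have h1 : ∀ᶠ y in 𝓝 x, ContDiffAt ℝ ω g y := hg.eventually (by simp)
  obtain ⟨U, hU, hUo, hxU⟩ :=
    eventually_nhds_iff.1 (h1.and (eventually_nhdsWithin_iff.1 hfg))
  refine ⟨U, hUo, hxU, g, fun y hy => ?_, fun y hy => (hU y hy.2).2 hy.1⟩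
  exact ((hU y hy).1.of_le le_top).contDiffWithinAt

theorem isSmoothOnSet_of_forall_contDiffAt {f : E → F} {X : Set E}
    (h : ∀ x ∈ X, ContDiffAt ℝ ω f x) : IsSmoothOnSet f X :=
  isSmoothOnSet_of_contDiffAt fun x hx => ⟨f, h x hx, Filter.EventuallyEq.rfl⟩

theorem IsDiffeoOn.exists_symm {f : E → F} {X : Set E} {Y : Set F} (h : IsDiffeoOn f X Y) :
    ∃ g, IsDiffeoOn g Y X ∧ InvOn g f X Y := by
  obtain ⟨h1, h2, g, h3, h4, h5⟩ := h
  exact ⟨g, ⟨h3, h4, f, h1, h2, h5.symm⟩, h5⟩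

theorem IsDiffeoOn.comp {g : F → G} {f : E → F} {X : Set E} {Y : Set F} {Z : Set G}
    (hg : IsDiffeoOn g Y Z) (hf : IsDiffeoOn f X Y) : IsDiffeoOn (g ∘ f) X Z := by
  obtain ⟨f1, f2, f', f3, f4, f5⟩ := hf
  obtain ⟨g1, g2, g', g3, g4, g5⟩ := hg
  exact ⟨g1.comp f1, g2.comp f2 f1, f' ∘ g', f3.comp g3, f4.comp g4 g3,
    f5.comp g5 f1 g3⟩

theorem IsDiffeoOn.image_eq {f : E → F} {X : Set E} {Y : Set F} (h : IsDiffeoOn f X Y) :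
    f '' X = Y := by
  obtain ⟨h1, h2, g, h3, h4, h5⟩ := h
  exact Subset.antisymm h1.image_subset fun y hy => ⟨g y, h3 hy, h5.2 hy⟩

theorem IsDiffeoOn.restrict {f : E → F} {X X' : Set E} {Y : Set F} (h : IsDiffeoOn f X Y)
    (hX : X' ⊆ X) : IsDiffeoOn f X' (f '' X') := by
  obtain ⟨h1, h2, g, h3, h4, h5⟩ := h
  refine ⟨mapsTo_image _ _, h2.mono hX, g, ?_, h4.mono (h1.mono_left hX).image_subset, ?_⟩
  · rintro _ ⟨x, hx, rfl⟩
    rw [h5.1 (hX hx)]; exact hx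
  · refine ⟨h5.1.mono hX, h5.2.mono (h1.mono_left hX).image_subset⟩

/-- Explicit mutually inverse maps between two parametrized sets extend to their closures. -/
theorem isDiffeoOn_closure {T : Type*} {S : Set T} {a : T → E} {b : T → F} {f : E → F} {g : F → E}
    (hf : ∀ x ∈ closure (a '' S), ContDiffAt ℝ ω f x)
    (hg : ∀ y ∈ closure (b '' S), ContDiffAt ℝ ω g y)
    (hfa : ∀ t ∈ S, f (a t) = b t) (hgb : ∀ t ∈ S, g (b t) = a t) :
    IsDiffeoOn f (closure (a '' S)) (closure (b '' S)) := by
  have hfc : ContinuousOn f (closure (a '' S)) :=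
    fun x hx => (hf x hx).continuousAt.continuousWithinAt
  have hgc : ContinuousOn g (closure (b '' S)) :=
    fun x hx => (hg x hx).continuousAt.continuousWithinAt
  have hfm : MapsTo f (closure (a '' S)) (closure (b '' S)) := by
    intro x hx
    have := ((hfc x hx).mono subset_closure).mem_closure_image hx
    rw [image_image] at this
    rwa [image_congr hfa] at this
  have hgm : MapsTo g (closure (b '' S)) (closure (a '' S)) := by
    intro x hx
    have := ((hgc x hx).mono subset_closure).mem_closure_image hx
    rw [image_image] at this
    rwa [image_congr hgb] at this
  refine ⟨hfm, isSmoothOnSet_of_forall_contDiffAt hf, g, hgm,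
    isSmoothOnSet_of_forall_contDiffAt hg, ?_, ?_⟩
  -- Both composites are the identity on a dense subset, hence on the closure by continuity.
  · have h1 : EqOn (g ∘ f) id (a '' S) := by
      rintro _ ⟨t, ht, rfl⟩
      simp [hfa t ht, hgb t ht]
    exact h1.of_subset_closure (hgc.comp hfc hfm) continuousOn_id subset_closure subset_rfl
  · have h1 : EqOn (f ∘ g) id (b '' S) := by
      rintro _ ⟨t, ht, rfl⟩
      simp [hfa t ht, hgb t ht]
    exact h1.of_subset_closure (hfc.comp hgc hgm) continuousOn_id subset_closure subset_rfl

end SmoothBasics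

/-! ## Invariance of the depth, and transport of strata along diffeomorphisms -/

section Depth

/-- Tangent directions to the face through `z` can be followed both ways: vanishing coordinates stay
zero and positive ones stay positive for small `s` of either sign. -/
theorem eventually_add_smul_mem_quadrant {d : ℕ} {z v : Fin d → ℝ} (hz : z ∈ quadrant d)
    (hv : ∀ i, z i = 0 → v i = 0) : ∀ᶠ s : ℝ in 𝓝 0, z + s • v ∈ quadrant d := by
  simp only [quadrant, mem_ofPred_eq]
  rw [Filter.eventually_all]
  intro i
  rcases (hz i).eq_or_lt with h | h
  · refine Filter.Eventually.of_forall fun s => ?_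
    simp [← h, hv i h.symm]
  · have hc : ContinuousAt (fun s : ℝ => (z + s • v) i) 0 := by
      simp only [Pi.add_apply, Pi.smul_apply, smul_eq_mul]; fun_prop
    have : (0 : ℝ) < (z + (0 : ℝ) • v) i := by simpa using h
    exact (hc.eventually (lt_mem_nhds this)).mono fun s hs => hs.le

/-- The derivative of `g` sends the tangent space of the face through `z` into that of the face
through `g z`, and does so injectively because `h` is a left inverse on the quadrant. Comparing
dimensions bounds the number of zeros. -/
theorem card_zeros_le_of_leftInverse {d : ℕ} {z : Fin d → ℝ} {g h : (Fin d → ℝ) → Fin d → ℝ}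
    (hz : z ∈ quadrant d) (hg : DifferentiableAt ℝ g z) (hh : DifferentiableAt ℝ h (g z))
    (hq : ∀ᶠ y in 𝓝[quadrant d] z, g y ∈ quadrant d ∧ h (g y) = y) :
    {i | g z i = 0}.ncard ≤ {i | z i = 0}.ncard := by
  classical
  have key : ∀ v : Fin d → ℝ, (∀ i, z i = 0 → v i = 0) →
      (∀ j, g z j = 0 → fderiv ℝ g z v j = 0) ∧ fderiv ℝ h (g z) (fderiv ℝ g z v) = v := by
    intro v hv
    have hline : HasDerivAt (fun s : ℝ => z + s • v) v 0 := by
      simpa using ((hasDerivAt_id (0 : ℝ)).smul_const v).const_add z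
    have h0 : z + (0 : ℝ) • v = z := by simp
    have hgl : HasDerivAt (fun s : ℝ => g (z + s • v)) (fderiv ℝ g z v) 0 := by
      have := (h0.symm ▸ hg.hasFDerivAt : HasFDerivAt g (fderiv ℝ g z) (z + (0 : ℝ) • v))
      exact this.comp_hasDerivAt 0 hline
    have hhl : HasDerivAt (fun s : ℝ => h (g (z + s • v)))
        (fderiv ℝ h (g z) (fderiv ℝ g z v)) 0 := by
      have : HasFDerivAt h (fderiv ℝ h (g z)) (g (z + (0 : ℝ) • v)) := by
        rw [h0]; exact hh.hasFDerivAt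
      exact this.comp_hasDerivAt 0 hgl
    have hev : ∀ᶠ s : ℝ in 𝓝 0, g (z + s • v) ∈ quadrant d ∧ h (g (z + s • v)) = z + s • v := by
      have ht : Filter.Tendsto (fun s : ℝ => z + s • v) (𝓝 0) (𝓝[quadrant d] z) := by
        refine tendsto_nhdsWithin_iff.2 ⟨?_, eventually_add_smul_mem_quadrant hz hv⟩
        have := hline.continuousAt.tendsto
        rwa [h0] at this
      exact ht.eventually hq
    refine ⟨fun j hj => ?_, ?_⟩
    · have hd := (hasDerivAt_pi.1 hgl) j
      -- Along a two-sided line in the quadrant, a coordinate of `g` that vanishes at `z` stays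
      -- nonnegative, so it has a minimum there and its derivative is zero.
      have hmin : IsLocalMin (fun s : ℝ => g (z + s • v) j) 0 := by
        filter_upwards [hev] with s hs
        simp only [h0, hj]
        exact hs.1 j
      exact hmin.hasDerivAt_eq_zero hd
    · have : HasDerivAt (fun s : ℝ => h (g (z + s • v))) v 0 :=
        hline.congr_of_eventuallyEq (hev.mono fun s hs => hs.2)
      exact hhl.unique this
  -- The derivative between the tangent spaces of the two faces, in the nonzero coordinates.
  let L : ({i // z i ≠ 0} → ℝ) →ₗ[ℝ] ({j // g z j ≠ 0} → ℝ) :=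
    (LinearMap.funLeft ℝ ℝ (Subtype.val : {j // g z j ≠ 0} → Fin d)) ∘ₗ
      (fderiv ℝ g z : (Fin d → ℝ) →ₗ[ℝ] (Fin d → ℝ)) ∘ₗ
      Function.ExtendByZero.linearMap ℝ (Subtype.val : {i // z i ≠ 0} → Fin d)
  have hL : Function.Injective L := by
    rw [← LinearMap.ker_eq_bot, LinearMap.ker_eq_bot']
    intro w hw
    set v : Fin d → ℝ := Function.extend Subtype.val w 0 with hvdef
    have hv : ∀ i, z i = 0 → v i = 0 := by
      intro i hi
      rw [hvdef, Function.extend_apply']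
      · rfl
      · rintro ⟨a, rfl⟩; exact a.2 hi
    obtain ⟨h1, h2⟩ := key v hv
    have h3 : fderiv ℝ g z v = 0 := by
      ext j
      by_cases hj : g z j = 0
      · simpa using h1 j hj
      · exact congrFun hw ⟨j, hj⟩
    rw [h3, map_zero] at h2
    ext i
    have := congrFun h2.symm i.1
    rwa [hvdef, Subtype.val_injective.extend_apply] at this
  have hcard := LinearMap.finrank_le_finrank_of_injective hL
  rw [Module.finrank_fintype_fun_eq_card, Module.finrank_fintype_fun_eq_card] at hcard
  have e1 : ∀ w : Fin d → ℝ, {i | w i = 0}.ncard + Fintype.card {i // w i ≠ 0} = d := by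
    intro w
    have h1 : {i | w i = 0}.ncard = Fintype.card {i // w i = 0} := by
      rw [← Nat.card_coe_set_eq, Nat.card_eq_fintype_card]
      rfl
    rw [h1, Fintype.card_subtype_compl, Fintype.card_fin]
    have := Fintype.card_subtype_le (fun i => w i = 0)
    rw [Fintype.card_fin] at this
    omega
  have := e1 z
  have := e1 (g z)
  omega

variable {E F : Type*} [NormedAddCommGroup E] [NormedSpace ℝ E]
  [NormedAddCommGroup F] [NormedSpace ℝ F]

/-- Charts are smooth only through local extensions. The transition map and its inverse are
therefore replaced by the composites `b ∘ a` and `b' ∘ a'` of ambient extensions, which are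
differentiable at the point and agree with them on the quadrant nearby. -/
theorem IsCornerChart.card_zeros_le {d : ℕ} {X U U' : Set E} {φ φ' : E → Fin d → ℝ}
    (h : IsCornerChart d X U φ) (h' : IsCornerChart d X U' φ') {x : E} (hx : x ∈ X)
    (hxU : x ∈ U) (hxU' : x ∈ U') : {i | φ' x i = 0}.ncard ≤ {i | φ x i = 0}.ncard := by
  obtain ⟨hU, V, hV, hm, hs, ψ, hψm, hψs, hinv⟩ := h
  obtain ⟨hU', V', hV', hm', hs', ψ', hψm', hψs', hinv'⟩ := h'
  have hz := hm ⟨hx, hxU⟩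
  obtain ⟨A, hA, hzA, a, ha, hφa⟩ := hψs _ hz
  obtain ⟨B, hB, hxB, b, hb, hφb⟩ := hs' x ⟨hx, hxU'⟩
  obtain ⟨A', hA', hzA', a', ha', hφa'⟩ := hψs' _ (hm' ⟨hx, hxU'⟩)
  obtain ⟨B', hB', hxB', b', hb', hφb'⟩ := hs x ⟨hx, hxU⟩
  have ea : a (φ x) = x := by rw [← hφa ⟨hz, hzA⟩]; exact hinv.1 ⟨hx, hxU⟩
  have ea' : a' (φ' x) = x := by
    rw [← hφa' ⟨hm' ⟨hx, hxU'⟩, hzA'⟩]; exact hinv'.1 ⟨hx, hxU'⟩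
  have eb : b x = φ' x := (hφb ⟨⟨hx, hxU'⟩, hxB⟩).symm
  have da : DifferentiableAt ℝ a (φ x) :=
    (ha.contDiffAt (hA.mem_nhds hzA)).differentiableAt (by simp)
  have db : DifferentiableAt ℝ b x := (hb.contDiffAt (hB.mem_nhds hxB)).differentiableAt (by simp)
  have da' : DifferentiableAt ℝ a' (φ' x) :=
    (ha'.contDiffAt (hA'.mem_nhds hzA')).differentiableAt (by simp)
  have db' : DifferentiableAt ℝ b' x :=
    (hb'.contDiffAt (hB'.mem_nhds hxB')).differentiableAt (by simp)
  have hb1 : DifferentiableAt ℝ b (a (φ x)) := by rw [ea]; exact db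
  have hgz : (b ∘ a) (φ x) = φ' x := by simp [ea, eb]
  have hh : DifferentiableAt ℝ (b' ∘ a') ((b ∘ a) (φ x)) := by
    rw [hgz]
    refine DifferentiableAt.comp _ ?_ da'
    rw [ea']; exact db'
  have := card_zeros_le_of_leftInverse (g := b ∘ a) (h := b' ∘ a') hz.1 (hb1.comp _ da) hh ?_
  · simpa only [hgz] using this
  have hac : Filter.Tendsto a (𝓝 (φ x)) (𝓝 x) := by
    have := da.continuousAt.tendsto
    rwa [ea] at this
  have hbc : Filter.Tendsto (b ∘ a) (𝓝 (φ x)) (𝓝 (φ' x)) := by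
    have := db.continuousAt.tendsto
    rw [eb] at this
    exact this.comp hac
  rw [eventually_nhdsWithin_iff]
  filter_upwards [hA.mem_nhds hzA, hV.mem_nhds hz.2, hac (hU'.mem_nhds hxU'), hac (hB.mem_nhds hxB),
    hac (hB'.mem_nhds hxB'), hbc (hA'.mem_nhds hzA')] with y hyA hyV hyU' hyB hyB' hyA' hyq
  have e1 : ψ y = a y := hφa ⟨⟨hyq, hyV⟩, hyA⟩
  have m1 : ψ y ∈ X ∩ U := hψm ⟨hyq, hyV⟩
  rw [e1] at m1
  have e2 : φ' (a y) = b (a y) := hφb ⟨⟨m1.1, hyU'⟩, hyB⟩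
  have m2 : φ' (a y) ∈ quadrant d ∩ V' := hm' ⟨m1.1, hyU'⟩
  have e3 : ψ' (φ' (a y)) = a' (φ' (a y)) := hφa' ⟨m2, by rw [e2]; exact hyA'⟩
  have e4 : ψ' (φ' (a y)) = a y := hinv'.1 ⟨m1.1, hyU'⟩
  have e5 : φ (a y) = b' (a y) := hφb' ⟨m1, hyB'⟩
  have e6 : φ (ψ y) = y := hinv.2 ⟨hyq, hyV⟩
  refine ⟨?_, ?_⟩
  · simp only [Function.comp]; rw [← e2]; exact m2.1
  · simp only [Function.comp]; rw [← e2, ← e3, e4, ← e5, ← e1, e6]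

theorem IsCornerChart.card_zeros_eq {d : ℕ} {X U U' : Set E} {φ φ' : E → Fin d → ℝ}
    (h : IsCornerChart d X U φ) (h' : IsCornerChart d X U' φ') {x : E} (hx : x ∈ X)
    (hxU : x ∈ U) (hxU' : x ∈ U') : {i | φ' x i = 0}.ncard = {i | φ x i = 0}.ncard :=
  (h.card_zeros_le h' hx hxU hxU').antisymm (h'.card_zeros_le h hx hxU' hxU)

theorem IsCornerChart.transport {d : ℕ} {X U : Set E} {Y : Set F} {φ : E → Fin d → ℝ}
    (h : IsCornerChart d X U φ) {g : F → E} (hg : IsDiffeoOn g Y X) :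
    ∃ U', Y ∩ U' = Y ∩ g ⁻¹' U ∧ IsCornerChart d Y U' (φ ∘ g) := by
  obtain ⟨hU, V, hV, hφ⟩ := h
  -- The preimage of `U` is only relatively open in `Y`; `U'` is an open set of the ambient space
  -- with the same trace.
  obtain ⟨U', hU', hUU'⟩ := (continuousOn_iff'.1 hg.2.1.continuousOn) U hU
  have hUU : Y ∩ U' = Y ∩ g ⁻¹' U := by rw [inter_comm, ← hUU', inter_comm]
  refine ⟨U', hUU, hU', V, hV, hφ.comp ?_⟩
  rw [hUU]
  have h1 := hg.restrict (X' := Y ∩ g ⁻¹' U) inter_subset_left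
  have h2 : g '' (Y ∩ g ⁻¹' U) = X ∩ U := by
    rw [image_inter_preimage, hg.image_eq]
  rwa [h2] at h1

theorem IsManifoldWithCorners.transport {d : ℕ} {X : Set E} {Y : Set F} {f : E → F}
    (h : IsManifoldWithCorners d X) (hf : IsDiffeoOn f X Y) : IsManifoldWithCorners d Y := by
  obtain ⟨g, hg, hinv⟩ := hf.exists_symm
  intro y hy
  obtain ⟨U, φ, hU, hφ⟩ := h (g y) (hg.1 hy)
  obtain ⟨U', hU', hc⟩ := hφ.transport hg
  exact ⟨U', φ ∘ g, ((hU'.symm ▸ ⟨hy, hU⟩ : y ∈ Y ∩ U')).2, hc⟩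

theorem IsDiffeoOn.mapsTo_depthStratum {d : ℕ} {X : Set E} {Y : Set F} {f : E → F}
    (hf : IsDiffeoOn f X Y) (k : ℕ) :
    MapsTo f (depthStratum d X k) (depthStratum d Y k) := by
  obtain ⟨g, hg, hinv⟩ := hf.exists_symm
  rintro x ⟨hx, U, φ, hU, hφ, hk⟩
  obtain ⟨U', hU', hc⟩ := hφ.transport hg
  have hgf : g (f x) = x := hinv.1 hx
  have : f x ∈ Y ∩ U' := by
    rw [hU']; exact ⟨hf.1 hx, by rw [mem_preimage, hgf]; exact hU⟩
  refine ⟨hf.1 hx, U', φ ∘ g, this.2, hc, ?_⟩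
  simpa [hgf] using hk

theorem image_connectedComponentIn_subset {E F : Type*} [TopologicalSpace E]
    [TopologicalSpace F] {f : E → F} {A : Set E} {B : Set F}
    (hf : ContinuousOn f A) (hAB : MapsTo f A B) {x : E} (hx : x ∈ A) :
    f '' connectedComponentIn A x ⊆ connectedComponentIn B (f x) := by
  refine IsPreconnected.subset_connectedComponentIn ?_ ?_ ?_
  · exact isPreconnected_connectedComponentIn.image f (hf.mono (connectedComponentIn_subset A x))
  · exact mem_image_of_mem _ (mem_connectedComponentIn hx)
  · exact (hAB.mono_left (connectedComponentIn_subset A x)).image_subset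

theorem depthStratum_subset {d : ℕ} {X : Set E} {k : ℕ} : depthStratum d X k ⊆ X := fun _ hx => hx.1

theorem OpenFace.subset {d : ℕ} {X : Set E} (S : OpenFace d X) : S.1 ⊆ X := by
  obtain ⟨S, k, x, hx, rfl⟩ := S
  exact (connectedComponentIn_subset _ _).trans depthStratum_subset

/-- The image of a stratum under a diffeomorphism. -/
def IsDiffeoOn.mapFace {d : ℕ} {X : Set E} {Y : Set F} {f : E → F} (hf : IsDiffeoOn f X Y)
    (S : OpenFace d X) : OpenFace d Y := ⟨f '' S.1, by
  obtain ⟨g, hg, hinv⟩ := hf.exists_symm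
  obtain ⟨S, k, x, hx, rfl⟩ := S
  refine ⟨k, f x, hf.mapsTo_depthStratum k hx, Subset.antisymm ?_ ?_⟩
  · exact image_connectedComponentIn_subset (hf.2.1.continuousOn.mono depthStratum_subset)
      (hf.mapsTo_depthStratum k) hx
  · have h1 := image_connectedComponentIn_subset (hg.2.1.continuousOn.mono depthStratum_subset)
      (hg.mapsTo_depthStratum k) (hf.mapsTo_depthStratum (d := d) k hx)
    rw [hinv.1 hx.1] at h1
    intro y hy
    refine ⟨g y, h1 (mem_image_of_mem _ hy), hinv.2 ?_⟩
    exact (connectedComponentIn_subset _ _ hy).1⟩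

theorem IsDiffeoOn.closure_mono {X : Set E} {Y : Set F} {f : E → F} (hf : IsDiffeoOn f X Y)
    {S T : Set E} (hS : S ⊆ X) (hT : T ⊆ X) (h : S ⊆ closure T) : f '' S ⊆ closure (f '' T) := by
  rintro _ ⟨x, hx, rfl⟩
  exact ((hf.2.1.continuousOn x (hS hx)).mono hT).mem_closure_image (h hx)

/-- A diffeomorphism induces an isomorphism of the posets of strata. -/
theorem IsDiffeoOn.exists_faceIso {X : Set E} {Y : Set F} {f : E → F} (d : ℕ)
    (hf : IsDiffeoOn f X Y) :
    ∃ e : OpenFace d X ≃o OpenFace d Y, ∀ S, (e S).1 = f '' S.1 := by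
  obtain ⟨g, hg, hinv⟩ := hf.exists_symm
  have e1 : ∀ S : OpenFace d X, g '' (f '' S.1) = S.1 := by
    intro S
    rw [image_image]
    exact (image_congr fun x hx => hinv.1 (S.subset hx)).trans (image_id _)
  have e2 : ∀ S : OpenFace d Y, f '' (g '' S.1) = S.1 := by
    intro S
    rw [image_image]
    exact (image_congr fun x hx => hinv.2 (S.subset hx)).trans (image_id _)
  refine ⟨{ toFun := hf.mapFace
            invFun := hg.mapFace
            left_inv := fun S => Subtype.ext (e1 S)
            right_inv := fun S => Subtype.ext (e2 S)
            map_rel_iff' := ?_ }, fun S => rfl⟩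
  intro S T
  constructor
  · intro h
    have h1 := hg.closure_mono (hf.mapFace S).subset (hf.mapFace T).subset h
    change g '' (f '' S.1) ⊆ closure (g '' (f '' T.1)) at h1
    rwa [e1, e1] at h1
  · exact fun h => hf.closure_mono S.subset T.subset h

theorem extendByZero_coe {P : Type*} (c : Finset P) (t : c → ℝ) (p : c) :
    extendByZero c t p = t p := by simp [extendByZero]

theorem support_extendByZero_subset {P : Type*} (c : Finset P) (t : c → ℝ) :
    Function.support (extendByZero c t) ⊆ (c : Set P) := by
  intro p hp
  by_contra hpc
  exact hp (by simp only [extendByZero]; exact dif_neg hpc)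

theorem extendByZero_mem_orderRealization {P : Type*} [LE P] {c : Finset P}
    (hc : IsChain (· ≤ ·) (c : Set P)) {t : c → ℝ} (ht : t ∈ stdSimplex ℝ c) :
    extendByZero c t ∈ orderRealization P := by
  have hsupp := support_extendByZero_subset c t
  refine ⟨fun p => ?_, c.finite_toSet.subset hsupp, hc.mono hsupp, ?_⟩
  · simp only [extendByZero]
    split_ifs
    · exact ht.1 _
    · exact le_rfl
  · rw [finsum_eq_sum_of_support_subset _ hsupp, ← ht.2, ← Finset.sum_coe_sort]
    exact Finset.sum_congr rfl fun i _ => extendByZero_coe c t i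

/-- Barycentric subdivisions can be transported along diffeomorphisms. -/
theorem IsBarycentricSubdivision.transport {P : Type*} [LE P] {d : ℕ} {X : Set E} {Y : Set F}
    {e : P ≃o OpenFace d X} {h : (P → ℝ) → E} (H : IsBarycentricSubdivision e h) {f : E → F}
    (hf : IsDiffeoOn f X Y) {e' : OpenFace d X ≃o OpenFace d Y} (he' : ∀ S, (e' S).1 = f '' S.1) :
    IsBarycentricSubdivision (e.trans e') (f ∘ h) where
  mapsTo := hf.1.comp H.mapsTo
  continuousOn := hf.2.1.continuousOn.comp H.continuousOn H.mapsTo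
  exists_inverse := by
    obtain ⟨k, hk1, hk2, hk3⟩ := H.exists_inverse
    obtain ⟨g, hg, hinv⟩ := hf.exists_symm
    exact ⟨k ∘ g, hk1.comp hg.1, hk2.comp hg.2.1.continuousOn hg.1, hk3.comp hinv H.mapsTo hg.1⟩
  diffeo_simplex := by
    intro c hc
    have h1 := H.diffeo_simplex c hc
    have h2 : (fun t : c → ℝ => h (extendByZero c t)) '' stdSimplex ℝ c ⊆ X := by
      rintro _ ⟨t, ht, rfl⟩
      exact H.mapsTo (extendByZero_mem_orderRealization hc ht)
    have h3 := (hf.restrict h2).comp h1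
    rw [image_image] at h3
    exact h3
  mem_face := by
    intro g hg p hp hq
    rw [OrderIso.trans_apply, he']
    exact mem_image_of_mem _ (H.mem_face g hg p hp hq)

end Depth

/-! ## Intervals of labels, and the associahedron as a Minkowski sum of simplices -/

section Intervals

variable {n : ℕ}

/-- A nonempty set of labels without gaps. -/
def IsIv (S : Finset (Fin (n + 1))) : Prop :=
  S.Nonempty ∧ ∀ i ∈ S, ∀ j ∈ S, ∀ k, i < k → k < j → k ∈ S

instance : DecidablePred (IsIv (n := n)) := fun S => by unfold IsIv; infer_instance

/-- A label of a facet of the associahedron: a proper interval. -/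
def IsFacet (S : Finset (Fin (n + 1))) : Prop := IsIv S ∧ S ≠ Finset.univ

theorem IsIv.mem_of_le {S : Finset (Fin (n + 1))} (h : IsIv S) {i j k : Fin (n + 1)} (hi : i ∈ S)
    (hj : j ∈ S) (hik : i ≤ k) (hkj : k ≤ j) : k ∈ S := by
  rcases hik.eq_or_lt with rfl | h1
  · exact hi
  rcases hkj.eq_or_lt with rfl | h2
  · exact hj
  exact h.2 i hi j hj k h1 h2

theorem isIv_singleton (i : Fin (n + 1)) : IsIv {i} :=
  ⟨⟨i, by simp⟩, fun a ha b hb k h1 h2 => by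
    rw [Finset.mem_singleton] at ha hb
    subst ha; subst hb; exact absurd (h1.trans h2) (lt_irrefl _)⟩

theorem isIv_univ : IsIv (Finset.univ : Finset (Fin (n + 1))) :=
  ⟨Finset.univ_nonempty, fun _ _ _ _ _ _ _ => Finset.mem_univ _⟩

theorem IsIv.union {S T : Finset (Fin (n + 1))} (hS : IsIv S) (hT : IsIv T)
    (h : (S ∩ T).Nonempty) : IsIv (S ∪ T) := by
  obtain ⟨c, hc⟩ := h
  rw [Finset.mem_inter] at hc
  refine ⟨⟨c, Finset.mem_union_left _ hc.1⟩, fun i hi j hj k hik hkj => ?_⟩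
  rw [Finset.mem_union] at hi hj ⊢
  rcases le_total k c with h | h
  · rcases hi with hi | hi
    · exact Or.inl (hS.mem_of_le hi hc.1 hik.le h)
    · exact Or.inr (hT.mem_of_le hi hc.2 hik.le h)
  · rcases hj with hj | hj
    · exact Or.inl (hS.mem_of_le hc.1 hj h hkj.le)
    · exact Or.inr (hT.mem_of_le hc.2 hj h hkj.le)

theorem IsIv.inter {S T : Finset (Fin (n + 1))} (hS : IsIv S) (hT : IsIv T)
    (h : (S ∩ T).Nonempty) : IsIv (S ∩ T) := by
  refine ⟨h, fun i hi j hj k hik hkj => ?_⟩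
  rw [Finset.mem_inter] at hi hj ⊢
  exact ⟨hS.2 i hi.1 j hj.1 k hik hkj, hT.2 i hi.2 j hj.2 k hik hkj⟩

theorem isConsecutive_iff {S : Finset (Fin (n + 1))} :
    IsConsecutive S ↔ IsFacet S ∧ 2 ≤ S.card := by
  constructor
  · rintro ⟨h1, h2, h3⟩
    exact ⟨⟨⟨Finset.card_pos.1 (by omega), h3⟩, h2⟩, h1⟩
  · rintro ⟨⟨⟨h1, h2⟩, h3⟩, h4⟩
    exact ⟨h4, h3, h2⟩

/-- Hence every interval properly contained in `S` misses an end of `S`, which is what the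
inclusion–exclusion below counts. -/
theorem IsIv.eq_of_min_max_mem {S T : Finset (Fin (n + 1))} (hT : IsIv T) (hTS : T ⊆ S)
    (h : S.Nonempty) (h1 : S.min' h ∈ T) (h2 : S.max' h ∈ T) : T = S :=
  hTS.antisymm fun _ hk => hT.mem_of_le h1 h2 (S.min'_le _ hk) (S.le_max' _ hk)

theorem IsIv.erase_min {S : Finset (Fin (n + 1))} (hS : IsIv S) :
    IsIv (S.erase (S.min' hS.1)) ∨ S.erase (S.min' hS.1) = ∅ := by
  rcases Finset.eq_empty_or_nonempty (S.erase (S.min' hS.1)) with h | h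
  · exact Or.inr h
  refine Or.inl ⟨h, fun i hi j hj k hik hkj => ?_⟩
  rw [Finset.mem_erase] at hi hj ⊢
  exact ⟨((S.min'_le _ hi.2).trans_lt hik).ne', hS.2 i hi.2 j hj.2 k hik hkj⟩

theorem IsIv.erase_max {S : Finset (Fin (n + 1))} (hS : IsIv S) :
    IsIv (S.erase (S.max' hS.1)) ∨ S.erase (S.max' hS.1) = ∅ := by
  rcases Finset.eq_empty_or_nonempty (S.erase (S.max' hS.1)) with h | h
  · exact Or.inr h
  refine Or.inl ⟨h, fun i hi j hj k hik hkj => ?_⟩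
  rw [Finset.mem_erase] at hi hj ⊢
  exact ⟨(hkj.trans_le (S.le_max' _ hj.2)).ne, hS.2 i hi.2 j hj.2 k hik hkj⟩

theorem IsIv.erase_min_max {S : Finset (Fin (n + 1))} (hS : IsIv S) :
    IsIv ((S.erase (S.min' hS.1)).erase (S.max' hS.1)) ∨
      (S.erase (S.min' hS.1)).erase (S.max' hS.1) = ∅ := by
  rw [Finset.erase_right_comm]
  have : (S.erase (S.max' hS.1)).erase (S.min' hS.1) =
      S.erase (S.max' hS.1) ∩ S.erase (S.min' hS.1) := by
    ext i; simp only [Finset.mem_erase, Finset.mem_inter]; tauto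
  rw [this]
  rcases Finset.eq_empty_or_nonempty (S.erase (S.max' hS.1) ∩ S.erase (S.min' hS.1)) with h | h
  · exact Or.inr h
  rcases hS.erase_max with h1 | h1
  · rcases hS.erase_min with h2 | h2
    · exact Or.inl (h1.inter h2 h)
    · rw [h2] at h; simp at h
  · rw [h1] at h; simp at h

/-- The truncation depth of any interval: `1` for the whole simplex and `0` for the facets of the
simplex. -/
noncomputable def faceDepth (ε : Finset (Fin (n + 1)) → ℝ) (S : Finset (Fin (n + 1))) : ℝ :=
  if S = Finset.univ then 1 else if 2 ≤ S.card then ε S else 0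

variable {ε : Finset (Fin (n + 1)) → ℝ}

theorem faceDepth_univ : faceDepth ε Finset.univ = 1 := by simp [faceDepth]

theorem faceDepth_empty : faceDepth ε ∅ = 0 := by
  have : (∅ : Finset (Fin (n + 1))) ≠ Finset.univ := Finset.univ_nonempty.ne_empty.symm
  simp [faceDepth, this]

theorem faceDepth_nonneg (hε : IsTruncationDepth ε) {S : Finset (Fin (n + 1))}
    (hS : IsIv S ∨ S = ∅) : 0 ≤ faceDepth ε S := by
  rcases hS with hS | rfl
  · unfold faceDepth
    split_ifs with h1 h2
    · exact zero_le_one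
    · exact (hε.1 S (isConsecutive_iff.2 ⟨⟨hS, h1⟩, h2⟩)).1.le
    · exact le_rfl
  · rw [faceDepth_empty]

/-- The two smallness conditions in one form: `2 * ε S < 1` is the case where `T` is everything, and
a set `S` with at most one element has depth zero. -/
theorem two_mul_faceDepth_lt (hε : IsTruncationDepth ε) {S T : Finset (Fin (n + 1))}
    (hS : IsIv S ∨ S = ∅) (hT : IsIv T) (hcard : 2 ≤ T.card) (hST : S ⊂ T) :
    2 * faceDepth ε S < faceDepth ε T := by
  have hSu : S ≠ Finset.univ := fun h => hST.2 (h ▸ Finset.subset_univ T)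
  have hT0 : 0 < faceDepth ε T := by
    unfold faceDepth
    split_ifs with h1
    · exact zero_lt_one
    · exact (hε.1 T (isConsecutive_iff.2 ⟨⟨hT, h1⟩, hcard⟩)).1
  by_cases h2 : 2 ≤ S.card
  · have hS' : IsIv S := hS.resolve_right fun h => by rw [h] at h2; simp at h2
    have hSc := isConsecutive_iff.2 ⟨⟨hS', hSu⟩, h2⟩
    have e1 : faceDepth ε S = ε S := by simp [faceDepth, hSu, h2]
    rw [e1]
    by_cases h3 : T = Finset.univ
    · rw [h3, faceDepth_univ]; exact (hε.1 S hSc).2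
    · have e2 : faceDepth ε T = ε T := by simp [faceDepth, h3, hcard]
      rw [e2]
      exact hε.2 S T hSc (isConsecutive_iff.2 ⟨⟨hT, h3⟩, hcard⟩) hST
  · have e1 : faceDepth ε S = 0 := by simp [faceDepth, hSu, h2]
    rw [e1]; simpa using hT0

/-- The coefficients of the associahedron as a Minkowski sum of simplices. -/
noncomputable def minkowskiCoeff (ε : Finset (Fin (n + 1)) → ℝ) (S : Finset (Fin (n + 1))) : ℝ :=
  if h : IsIv S then
    faceDepth ε S - faceDepth ε (S.erase (S.min' h.1)) - faceDepth ε (S.erase (S.max' h.1)) +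
      faceDepth ε ((S.erase (S.min' h.1)).erase (S.max' h.1))
  else 0

theorem minkowskiCoeff_of_not_isIv {S : Finset (Fin (n + 1))} (h : ¬ IsIv S) :
    minkowskiCoeff ε S = 0 := by simp [minkowskiCoeff, h]

/-- Each of the two subtracted depths is less than half of the depth of `S`, and the added one is
nonnegative. This is where the factor 2 in the smallness conditions is used. -/
theorem minkowskiCoeff_pos (hε : IsTruncationDepth ε) {S : Finset (Fin (n + 1))} (hS : IsIv S)
    (hcard : 2 ≤ S.card) : 0 < minkowskiCoeff ε S := by
  have h1 := two_mul_faceDepth_lt hε hS.erase_min hS hcard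
    (Finset.erase_ssubset (S.min'_mem hS.1))
  have h2 := two_mul_faceDepth_lt hε hS.erase_max hS hcard
    (Finset.erase_ssubset (S.max'_mem hS.1))
  have h3 := faceDepth_nonneg hε hS.erase_min_max
  rw [minkowskiCoeff, dif_pos hS]
  linarith

theorem minkowskiCoeff_nonneg (hε : IsTruncationDepth ε) (S : Finset (Fin (n + 1))) :
    0 ≤ minkowskiCoeff ε S := by
  by_cases hS : IsIv S
  · by_cases hcard : 2 ≤ S.card
    · exact (minkowskiCoeff_pos hε hS hcard).le
    · have h1 : S.card = 1 := by have := Finset.card_pos.2 hS.1; omega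
      obtain ⟨a, rfl⟩ := Finset.card_eq_one.1 h1
      rw [minkowskiCoeff, dif_pos hS]
      simp only [Finset.min'_singleton, Finset.max'_singleton, Finset.erase_singleton,
        Finset.erase_empty, faceDepth_empty]
      have := faceDepth_nonneg hε (Or.inl hS)
      linarith
  · rw [minkowskiCoeff_of_not_isIv hS]

/-- Möbius inversion on intervals: those inside `S`, other than `S`, miss the minimum or the
maximum, so the sum over them is given by inclusion–exclusion from three smaller intervals, and the
coefficient of `S` is the difference that remains. -/
theorem sum_powerset_minkowskiCoeff {S : Finset (Fin (n + 1))} (hS : IsIv S ∨ S = ∅) :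
    ∑ J ∈ S.powerset, minkowskiCoeff ε J = faceDepth ε S := by
  induction hc : S.card using Nat.strong_induction_on generalizing S with
  | _ c ih =>
  rcases hS with hS | rfl
  swap
  · have : ¬ IsIv (∅ : Finset (Fin (n + 1))) := fun h => by simpa using h.1
    simp [minkowskiCoeff_of_not_isIv this, faceDepth_empty]
  set a := S.min' hS.1 with ha
  set b := S.max' hS.1 with hb
  have haS : a ∈ S := S.min'_mem hS.1
  have hbS : b ∈ S := S.max'_mem hS.1
  have i1 := ih _ (hc ▸ Finset.card_erase_lt_of_mem haS) hS.erase_min rfl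
  have i2 := ih _ (hc ▸ Finset.card_erase_lt_of_mem hbS) hS.erase_max rfl
  have i3 := ih _ (hc ▸ (Finset.card_le_card (Finset.erase_subset b _)).trans_lt
    (Finset.card_erase_lt_of_mem haS)) hS.erase_min_max rfl
  have hsub : insert S ((S.erase a).powerset ∪ (S.erase b).powerset) ⊆ S.powerset := by
    intro J hJ
    rw [Finset.mem_insert, Finset.mem_union, Finset.mem_powerset, Finset.mem_powerset] at hJ
    rw [Finset.mem_powerset]
    rcases hJ with rfl | hJ | hJ
    · exact subset_rfl
    · exact hJ.trans (Finset.erase_subset _ _)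
    · exact hJ.trans (Finset.erase_subset _ _)
  have hz : ∀ J ∈ S.powerset, J ∉ insert S ((S.erase a).powerset ∪ (S.erase b).powerset) →
      minkowskiCoeff ε J = 0 := by
    intro J hJ hJ'
    refine minkowskiCoeff_of_not_isIv fun hJi => hJ' ?_
    rw [Finset.mem_powerset] at hJ
    rw [Finset.mem_insert, Finset.mem_union, Finset.mem_powerset, Finset.mem_powerset,
      Finset.subset_erase, Finset.subset_erase]
    by_cases h1 : a ∈ J
    · by_cases h2 : b ∈ J
      · exact Or.inl (hJi.eq_of_min_max_mem hJ hS.1 h1 h2)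
      · exact Or.inr (Or.inr ⟨hJ, h2⟩)
    · exact Or.inr (Or.inl ⟨hJ, h1⟩)
  have hnot : S ∉ (S.erase a).powerset ∪ (S.erase b).powerset := by
    simp [Finset.mem_union, Finset.mem_powerset, Finset.subset_erase, haS, hbS]
  have hui := Finset.sum_union_inter (s₁ := (S.erase a).powerset) (s₂ := (S.erase b).powerset)
    (f := minkowskiCoeff ε)
  have hint : (S.erase a).powerset ∩ (S.erase b).powerset = ((S.erase a).erase b).powerset := by
    ext J
    simp only [Finset.mem_inter, Finset.mem_powerset, Finset.subset_erase]
    tauto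
  rw [hint] at hui
  rw [← Finset.sum_subset hsub hz, Finset.sum_insert hnot]
  have hy : minkowskiCoeff ε S = faceDepth ε S - faceDepth ε (S.erase a) - faceDepth ε (S.erase b) +
      faceDepth ε ((S.erase a).erase b) := by rw [minkowskiCoeff, dif_pos hS]
  rw [i1, i2, i3] at hui
  rw [hy]
  linarith

/-- A family of probability distributions on the intervals of labels. -/
def IsDistFamily (r : Finset (Fin (n + 1)) → Fin (n + 1) → ℝ) : Prop :=
  ∀ I, IsIv I → (∀ i, 0 ≤ r I i) ∧ (∀ i, i ∉ I → r I i = 0) ∧ ∑ i, r I i = 1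

/-- The Minkowski combination of a family of points of the faces of the simplex. -/
noncomputable def minkowskiMap (ε : Finset (Fin (n + 1)) → ℝ)
    (r : Finset (Fin (n + 1)) → Fin (n + 1) → ℝ) : Fin (n + 1) → ℝ :=
  fun i => ∑ I, minkowskiCoeff ε I * r I i

theorem sum_minkowskiMap (r : Finset (Fin (n + 1)) → Fin (n + 1) → ℝ) (S : Finset (Fin (n + 1))) :
    ∑ i ∈ S, minkowskiMap ε r i = ∑ I, minkowskiCoeff ε I * ∑ i ∈ S, r I i := by
  simp only [minkowskiMap, Finset.mul_sum]
  exact Finset.sum_comm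

theorem IsDistFamily.sum_eq_one {r : Finset (Fin (n + 1)) → Fin (n + 1) → ℝ} (hr : IsDistFamily r)
    {I S : Finset (Fin (n + 1))} (hI : IsIv I) (h : I ⊆ S) : ∑ i ∈ S, r I i = 1 := by
  rw [← (hr I hI).2.2]
  exact Finset.sum_subset (Finset.subset_univ S) fun i _ hi => (hr I hI).2.1 i fun h' => hi (h h')

/-- The distance of a Minkowski combination to the facet `S`. -/
theorem IsDistFamily.slack {r : Finset (Fin (n + 1)) → Fin (n + 1) → ℝ} (hr : IsDistFamily r)
    {S : Finset (Fin (n + 1))} (hS : IsIv S) :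
    ∑ i ∈ S, minkowskiMap ε r i = faceDepth ε S +
      ∑ I ∈ Finset.univ.filter (fun I => ¬ I ⊆ S), minkowskiCoeff ε I * ∑ i ∈ S, r I i := by
  -- Intervals inside `S` have all their mass on `S` and contribute exactly the depth; the other
  -- intervals make up the slack.
  rw [sum_minkowskiMap, ← Finset.sum_filter_add_sum_filter_not Finset.univ (fun I => I ⊆ S)]
  congr 1
  rw [← sum_powerset_minkowskiCoeff (Or.inl hS)]
  have : Finset.univ.filter (fun I => I ⊆ S) = S.powerset := by ext; simp
  rw [this]
  refine Finset.sum_congr rfl fun I hI => ?_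
  by_cases h : IsIv I
  · rw [hr.sum_eq_one h (Finset.mem_powerset.1 hI), mul_one]
  · rw [minkowskiCoeff_of_not_isIv h, zero_mul]

theorem IsDistFamily.sum_minkowskiMap_univ {r : Finset (Fin (n + 1)) → Fin (n + 1) → ℝ}
    (hr : IsDistFamily r) : ∑ i, minkowskiMap ε r i = 1 := by
  rw [hr.slack isIv_univ, faceDepth_univ]
  simp

theorem IsDistFamily.slack_nonneg (hε : IsTruncationDepth ε)
    {r : Finset (Fin (n + 1)) → Fin (n + 1) → ℝ} (hr : IsDistFamily r)
    (S I : Finset (Fin (n + 1))) : 0 ≤ minkowskiCoeff ε I * ∑ i ∈ S, r I i := by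
  by_cases h : IsIv I
  · exact mul_nonneg (minkowskiCoeff_nonneg hε I) (Finset.sum_nonneg fun i _ => (hr I h).1 i)
  · rw [minkowskiCoeff_of_not_isIv h, zero_mul]

/-- The facets of the simplex and the truncations become one list of inequalities, with singletons
as facets of depth zero. -/
theorem mem_associahedron_iff {x : Fin (n + 1) → ℝ} :
    x ∈ associahedron n ε ↔ ∑ i, x i = 1 ∧ ∀ S, IsFacet S → faceDepth ε S ≤ ∑ i ∈ S, x i := by
  constructor
  · rintro ⟨⟨h1, h2⟩, h3⟩
    refine ⟨h2, fun S hS => ?_⟩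
    by_cases hc : 2 ≤ S.card
    · have : faceDepth ε S = ε S := by simp [faceDepth, hS.2, hc]
      rw [this]
      exact h3 S (isConsecutive_iff.2 ⟨hS, hc⟩)
    · have : faceDepth ε S = 0 := by simp [faceDepth, hS.2, hc]
      rw [this]
      exact Finset.sum_nonneg fun i _ => h1 i
  · rintro ⟨h1, h2⟩
    refine ⟨⟨fun i => ?_, h1⟩, fun S hS => ?_⟩
    -- For `n = 0` the singleton is everything and labels no facet; then the coordinate is the total
    -- sum 1.
    · by_cases hi : ({i} : Finset (Fin (n + 1))) = Finset.univ
      · have : ∑ j, x j = x i := by rw [← hi]; simp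
        rw [← this, h1]; exact zero_le_one
      · have := h2 {i} ⟨isIv_singleton i, hi⟩
        simpa [faceDepth, hi] using this
    · have hS' := isConsecutive_iff.1 hS
      have := h2 S hS'.1
      simpa [faceDepth, hS'.1.2, hS'.2] using this

theorem IsDistFamily.minkowskiMap_mem (hε : IsTruncationDepth ε)
    {r : Finset (Fin (n + 1)) → Fin (n + 1) → ℝ} (hr : IsDistFamily r) :
    minkowskiMap ε r ∈ associahedron n ε := by
  rw [mem_associahedron_iff]
  refine ⟨hr.sum_minkowskiMap_univ, fun S hS => ?_⟩
  rw [hr.slack hS.1]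
  have := Finset.sum_nonneg (s := Finset.univ.filter (fun I => ¬ I ⊆ S))
    fun I _ => hr.slack_nonneg hε S I
  linarith

/-- The slack is a sum of nonnegative terms, so it vanishes exactly when every term does, and the
coefficients of intervals with two elements are positive. -/
theorem IsDistFamily.sum_minkowskiMap_eq_iff (hε : IsTruncationDepth ε)
    {r : Finset (Fin (n + 1)) → Fin (n + 1) → ℝ} (hr : IsDistFamily r)
    {S : Finset (Fin (n + 1))} (hS : IsIv S) :
    ∑ i ∈ S, minkowskiMap ε r i = faceDepth ε S ↔
      ∀ I, IsIv I → ¬ I ⊆ S → ∀ i ∈ S, r I i = 0 := by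
  rw [hr.slack hS, add_eq_left, Finset.sum_eq_zero_iff_of_nonneg fun I _ => hr.slack_nonneg hε S I]
  constructor
  · intro h I hI hIS i hi
    by_cases hc : 2 ≤ I.card
    · have h1 := h I (by simpa using hIS)
      have h2 := (mul_eq_zero.1 h1).resolve_left (minkowskiCoeff_pos hε hI hc).ne'
      exact (Finset.sum_eq_zero_iff_of_nonneg fun i _ => (hr I hI).1 i).1 h2 i hi
    -- The coefficient of a one-element interval may be zero, but such an interval not inside `S` is
    -- disjoint from `S`.
    · refine (hr I hI).2.1 i fun hiI => hIS ?_
      have := Finset.card_le_one.1 (by omega : I.card ≤ 1)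
      intro j hj
      rwa [this j hj i hiI]
  · intro h I hI
    by_cases hIi : IsIv I
    · rw [Finset.sum_eq_zero fun i hi => h I hIi (by simpa using hI) i hi, mul_zero]
    · rw [minkowskiCoeff_of_not_isIv hIi, zero_mul]

end Intervals

/-! ## The closure of the families of ratios -/

section Ratios

variable {n : ℕ}

/-- The ratios `t_i / t_I` for `i` in an interval `I`, where `t_I = ∑_{j ∈ I} t_j`. -/
noncomputable def ratioFamily (t : Fin (n + 1) → ℝ) : Finset (Fin (n + 1)) → Fin (n + 1) → ℝ :=
  fun I i => if IsIv I ∧ i ∈ I then t i / ∑ j ∈ I, t j else 0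

/-- The gap vectors of configurations of increasing points. -/
def posVec (n : ℕ) : Set (Fin (n + 1) → ℝ) := {t | ∀ i, 0 < t i}

/-- The closure of the set of families of ratios of positive vectors. -/
def ratioClosure (n : ℕ) : Set (Finset (Fin (n + 1)) → Fin (n + 1) → ℝ) :=
  closure (ratioFamily '' posVec n)

theorem sum_pos_of_posVec {t : Fin (n + 1) → ℝ} (ht : t ∈ posVec n) {I : Finset (Fin (n + 1))}
    (hI : I.Nonempty) : 0 < ∑ j ∈ I, t j := Finset.sum_pos (fun i _ => ht i) hI

theorem sum_ratioFamily (t : Fin (n + 1) → ℝ) {I : Finset (Fin (n + 1))} (hI : IsIv I)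
    (S : Finset (Fin (n + 1))) :
    ∑ i ∈ S, ratioFamily t I i = (∑ i ∈ I ∩ S, t i) / ∑ j ∈ I, t j := by
  simp only [ratioFamily, hI, true_and]
  rw [Finset.sum_ite, Finset.sum_const_zero, add_zero, Finset.sum_div, Finset.filter_mem_eq_inter,
    Finset.inter_comm]

theorem isDistFamily_ratioFamily {t : Fin (n + 1) → ℝ} (ht : t ∈ posVec n) :
    IsDistFamily (ratioFamily t) := by
  intro I hI
  refine ⟨fun i => ?_, fun i hi => by simp [ratioFamily, hi], ?_⟩
  · simp only [ratioFamily]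
    split_ifs
    · exact div_nonneg (ht i).le (sum_pos_of_posVec ht hI.1).le
    · exact le_rfl
  · rw [sum_ratioFamily t hI, Finset.inter_univ, div_self (sum_pos_of_posVec ht hI.1).ne']

theorem isClosed_isDistFamily :
    IsClosed {r : Finset (Fin (n + 1)) → Fin (n + 1) → ℝ | IsDistFamily r} := by
  simp only [IsDistFamily, ofPred_forall, ofPred_and]
  refine isClosed_iInter fun I => isClosed_iInter fun _ => ((isClosed_iInter fun i => ?_).inter
    ((isClosed_iInter fun i => isClosed_iInter fun _ => ?_).inter ?_))
  · exact isClosed_le continuous_const (by fun_prop)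
  · exact isClosed_eq (by fun_prop) continuous_const
  · exact isClosed_eq (by fun_prop) continuous_const

theorem isDistFamily_of_mem {r : Finset (Fin (n + 1)) → Fin (n + 1) → ℝ}
    (hr : r ∈ ratioClosure n) : IsDistFamily r := by
  refine closure_minimal ?_ isClosed_isDistFamily hr
  rintro _ ⟨t, ht, rfl⟩
  exact isDistFamily_ratioFamily ht

theorem eq_zero_of_not_isIv {r : Finset (Fin (n + 1)) → Fin (n + 1) → ℝ}
    (hr : r ∈ ratioClosure n) {I : Finset (Fin (n + 1))} (hI : ¬ IsIv I) (i : Fin (n + 1)) :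
    r I i = 0 := by
  have hc : IsClosed {r : Finset (Fin (n + 1)) → Fin (n + 1) → ℝ | r I i = 0} :=
    isClosed_eq (by fun_prop) continuous_const
  refine closure_minimal (t := {r | r I i = 0}) ?_ hc hr
  rintro _ ⟨t, ht, rfl⟩
  simp [ratioFamily, hI]

theorem IsDistFamily.le_one {r : Finset (Fin (n + 1)) → Fin (n + 1) → ℝ} (hr : IsDistFamily r)
    {I : Finset (Fin (n + 1))} (hI : IsIv I) (i : Fin (n + 1)) : r I i ≤ 1 := by
  rw [← (hr I hI).2.2]
  exact Finset.single_le_sum (fun j _ => (hr I hI).1 j) (Finset.mem_univ i)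

theorem isCompact_ratioClosure : IsCompact (ratioClosure n) := by
  refine IsCompact.of_isClosed_subset (s := Set.pi univ fun _ => Set.pi univ fun _ => Icc (0 : ℝ) 1)
    (isCompact_univ_pi fun _ => isCompact_univ_pi fun _ => isCompact_Icc) isClosed_closure ?_
  intro r hr I _ i _
  by_cases hI : IsIv I
  · exact ⟨(isDistFamily_of_mem hr I hI).1 i, (isDistFamily_of_mem hr).le_one hI i⟩
  · rw [eq_zero_of_not_isIv hr hI]; simp

theorem continuous_minkowskiMap (ε : Finset (Fin (n + 1)) → ℝ) : Continuous (minkowskiMap ε) := by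
  unfold minkowskiMap
  fun_prop

theorem contDiff_minkowskiMap (ε : Finset (Fin (n + 1)) → ℝ) : ContDiff ℝ ω (minkowskiMap ε) := by
  unfold minkowskiMap
  fun_prop

/-- Passing from `t` to `t'` multiplies the weights in `M` by larger factors than those outside, so
the share of `M` in every interval grows. After cross-multiplication this is `t_i t'_j ≤ t'_i t_j`
for `i` inside and `j` outside `M`. -/
theorem sum_ratioFamily_le {t t' : Fin (n + 1) → ℝ} (ht : t ∈ posVec n) (ht' : t' ∈ posVec n)
    {I : Finset (Fin (n + 1))} (hI : IsIv I) {M : Finset (Fin (n + 1))}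
    (hM : ∀ i ∈ M, ∀ j, j ∉ M → t' j / t j ≤ t' i / t i) :
    ∑ i ∈ M, ratioFamily t I i ≤ ∑ i ∈ M, ratioFamily t' I i := by
  rw [sum_ratioFamily t hI, sum_ratioFamily t' hI,
    div_le_div_iff₀ (sum_pos_of_posVec ht hI.1) (sum_pos_of_posVec ht' hI.1),
    ← Finset.sum_inter_add_sum_sdiff I M t, ← Finset.sum_inter_add_sum_sdiff I M t']
  have : (∑ i ∈ I ∩ M, t i) * ∑ j ∈ I \ M, t' j ≤ (∑ i ∈ I ∩ M, t' i) * ∑ j ∈ I \ M, t j := by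
    rw [Finset.sum_mul_sum, Finset.sum_mul_sum]
    refine Finset.sum_le_sum fun i hi => Finset.sum_le_sum fun j hj => ?_
    have := hM i (Finset.mem_inter.1 hi).2 j (Finset.mem_sdiff.1 hj).2
    rw [div_le_div_iff₀ (ht j) (ht i)] at this
    linarith
  nlinarith

/-- Pairs of families that are comparable along the order of the labels given by `σ`. -/
def comparablePairs (σ : Equiv.Perm (Fin (n + 1))) :
    Set ((Finset (Fin (n + 1)) → Fin (n + 1) → ℝ) × (Finset (Fin (n + 1)) → Fin (n + 1) → ℝ)) :=
  {p | ∀ I, IsIv I → ∀ M : Finset (Fin (n + 1)), (∀ i ∈ M, ∀ j, j ∉ M → σ j ≤ σ i) →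
    ∑ i ∈ M, p.1 I i ≤ ∑ i ∈ M, p.2 I i}

theorem isClosed_comparablePairs (σ : Equiv.Perm (Fin (n + 1))) :
    IsClosed (comparablePairs σ) := by
  simp only [comparablePairs, ofPred_forall]
  refine isClosed_iInter fun I => isClosed_iInter fun _ => isClosed_iInter fun M =>
    isClosed_iInter fun _ => isClosed_le (by fun_prop) (by fun_prop)

theorem exists_perm_monotone (f : Fin (n + 1) → ℝ) :
    ∃ σ : Equiv.Perm (Fin (n + 1)), ∀ i j, σ i ≤ σ j → f i ≤ f j := by
  refine ⟨(Tuple.sort f)⁻¹, fun i j h => ?_⟩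
  simpa using Tuple.monotone_sort f h

/-- Limits of ratio families have no well-defined quotient `t'_i / t_i`, but comparability along a
fixed `σ` is a closed condition and there are only finitely many `σ`. -/
theorem exists_mem_comparablePairs {r r' : Finset (Fin (n + 1)) → Fin (n + 1) → ℝ}
    (hr : r ∈ ratioClosure n) (hr' : r' ∈ ratioClosure n) :
    ∃ σ, (r, r') ∈ comparablePairs σ := by
  have hc : IsClosed (⋃ σ : Equiv.Perm (Fin (n + 1)), comparablePairs σ) :=
    isClosed_iUnion_of_finite isClosed_comparablePairs
  have : (r, r') ∈ closure ((ratioFamily '' posVec n) ×ˢ (ratioFamily '' posVec n)) := by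
    rw [closure_prod_eq]; exact ⟨hr, hr'⟩
  refine mem_iUnion.1 (closure_minimal ?_ hc this)
  rintro ⟨_, _⟩ ⟨⟨t, ht, rfl⟩, ⟨t', ht', rfl⟩⟩
  obtain ⟨σ, hσ⟩ := exists_perm_monotone fun i => t' i / t i
  exact mem_iUnion.2 ⟨σ, fun I hI M hM => sum_ratioFamily_le ht ht' hI fun i hi j hj =>
    hσ j i (hM i hi j hj)⟩

/-- For every upper set `M` of the order `σ`, the mass on `M` is at most as large in `r` as in `r'`,
interval by interval. Equal images force equal weighted sums of these masses, hence equality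
wherever the coefficient is positive. -/
theorem injOn_minkowskiMap {ε : Finset (Fin (n + 1)) → ℝ} (hε : IsTruncationDepth ε) :
    InjOn (minkowskiMap ε) (ratioClosure n) := by
  intro r hr r' hr' h
  obtain ⟨σ, hσ⟩ := exists_mem_comparablePairs hr hr'
  have key : ∀ M : Finset (Fin (n + 1)), (∀ i ∈ M, ∀ j, j ∉ M → σ j ≤ σ i) → ∀ I, IsIv I →
      2 ≤ I.card → ∑ i ∈ M, r I i = ∑ i ∈ M, r' I i := by
    intro M hM I hI hc
    have h1 : ∑ I, minkowskiCoeff ε I * ∑ i ∈ M, r I i =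
        ∑ I, minkowskiCoeff ε I * ∑ i ∈ M, r' I i := by
      rw [← sum_minkowskiMap, ← sum_minkowskiMap, h]
    have h2 := (Finset.sum_eq_sum_iff_of_le fun J _ => ?_).1 h1 I (Finset.mem_univ I)
    · exact mul_left_cancel₀ (minkowskiCoeff_pos hε hI hc).ne' h2
    · by_cases hJ : IsIv J
      · exact mul_le_mul_of_nonneg_left (hσ J hJ M hM) (minkowskiCoeff_nonneg hε J)
      · simp [minkowskiCoeff_of_not_isIv hJ]
  funext I k
  by_cases hI : IsIv I
  swap
  · rw [eq_zero_of_not_isIv hr hI, eq_zero_of_not_isIv hr' hI]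
  by_cases hc : 2 ≤ I.card
  -- The two upper sets differ by `k` alone, which isolates one entry.
  · have h1 := key (Finset.univ.filter fun i => σ k ≤ σ i)
      (fun i hi j hj => by
        simp only [Finset.mem_filter, Finset.mem_univ, true_and, not_le] at hi hj
        exact hj.le.trans hi) I hI hc
    have h2 := key (Finset.univ.filter fun i => σ k < σ i)
      (fun i hi j hj => by
        simp only [Finset.mem_filter, Finset.mem_univ, true_and, not_lt] at hi hj
        exact hj.trans hi.le) I hI hc
    have h3 : Finset.univ.filter (fun i => σ k ≤ σ i) =
        insert k (Finset.univ.filter fun i => σ k < σ i) := by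
      ext i
      simp only [Finset.mem_filter, Finset.mem_univ, true_and, Finset.mem_insert, le_iff_eq_or_lt,
        σ.injective.eq_iff, eq_comm]
    have h4 : k ∉ Finset.univ.filter fun i => σ k < σ i := by simp
    rw [h3, Finset.sum_insert h4, Finset.sum_insert h4, h2] at h1
    exact add_right_cancel h1
  · have h1 : I.card = 1 := by have := Finset.card_pos.2 hI.1; omega
    obtain ⟨a, rfl⟩ := Finset.card_eq_one.1 h1
    have e1 := isDistFamily_of_mem hr
    have e2 := isDistFamily_of_mem hr'
    by_cases hk : k = a
    · subst hk
      have f1 := e1.sum_eq_one hI subset_rfl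
      have f2 := e2.sum_eq_one hI subset_rfl
      rw [Finset.sum_singleton] at f1 f2
      rw [f1, f2]
    · rw [(e1 _ hI).2.1 k (by simpa using hk), (e2 _ hI).2.1 k (by simpa using hk)]

end Ratios

/-! ## Monomial charts of the closure of the families of ratios -/

section Charts

variable {n : ℕ} (σ : Equiv.Perm (Fin (n + 1)))

/-- The largest interval on which `k` has the greatest priority with respect to `σ`. -/
def treeIv (k : Fin (n + 1)) : Finset (Fin (n + 1)) :=
  Finset.univ.filter fun i => ∀ j ∈ Finset.uIcc k i, σ j ≤ σ k

/-- The label of greatest priority. -/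
def treeRoot : Fin (n + 1) := σ.symm (Fin.last n)

variable {σ}

theorem mem_treeIv {k i : Fin (n + 1)} :
    i ∈ treeIv σ k ↔ ∀ j ∈ Finset.uIcc k i, σ j ≤ σ k := by simp [treeIv]

theorem self_mem_treeIv (k : Fin (n + 1)) : k ∈ treeIv σ k := by
  simp [mem_treeIv]

theorem le_of_mem_treeIv {k i : Fin (n + 1)} (h : i ∈ treeIv σ k) : σ i ≤ σ k :=
  mem_treeIv.1 h i Finset.right_mem_uIcc

theorem isIv_treeIv (k : Fin (n + 1)) : IsIv (treeIv σ k) := by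
  refine ⟨⟨k, self_mem_treeIv k⟩, fun a ha b hb c hac hcb => mem_treeIv.2 fun j hj => ?_⟩
  rw [Finset.mem_uIcc] at hj
  rcases le_total k c with h | h
  · rw [min_eq_left h, max_eq_right h] at hj
    refine mem_treeIv.1 hb j ?_
    rw [Finset.mem_uIcc]
    exact ⟨(min_le_left _ _).trans hj.1, hj.2.trans (hcb.le.trans (le_max_right _ _))⟩
  · rw [min_eq_right h, max_eq_left h] at hj
    refine mem_treeIv.1 ha j ?_
    rw [Finset.mem_uIcc]
    exact ⟨(min_le_right _ _).trans (hac.le.trans hj.1), hj.2.trans (le_max_left _ _)⟩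

theorem treeIv_injective : Function.Injective (treeIv σ) := fun k l h =>
  σ.injective ((le_of_mem_treeIv (h ▸ self_mem_treeIv k)).antisymm
    (le_of_mem_treeIv (h ▸ self_mem_treeIv l)))

theorem le_treeRoot (i : Fin (n + 1)) : σ i ≤ σ (treeRoot σ) := by
  simp [treeRoot, Fin.le_last]

theorem treeIv_treeRoot : treeIv σ (treeRoot σ) = Finset.univ := by
  ext i; simp [mem_treeIv, le_treeRoot]

theorem treeIv_eq_univ_iff {k : Fin (n + 1)} : treeIv σ k = Finset.univ ↔ k = treeRoot σ := by
  rw [← treeIv_treeRoot (σ := σ), treeIv_injective.eq_iff]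

theorem mem_uIcc_split {a b c j : Fin (n + 1)} (h : j ∈ Finset.uIcc a c) :
    j ∈ Finset.uIcc a b ∨ j ∈ Finset.uIcc b c := by
  simp only [Finset.mem_uIcc, min_le_iff, le_max_iff] at *
  rcases le_total j b with h1 | h1 <;> tauto

theorem mem_treeIv_trans {k m i : Fin (n + 1)} (hm : m ∈ treeIv σ k)
    (hi : ∀ j ∈ Finset.uIcc m i, σ j ≤ σ m) : i ∈ treeIv σ k := by
  refine mem_treeIv.2 fun j hj => ?_
  rcases mem_uIcc_split (b := m) hj with h | h
  · exact mem_treeIv.1 hm j h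
  · exact (hi j h).trans (le_of_mem_treeIv hm)

theorem IsIv.uIcc_subset {I : Finset (Fin (n + 1))} (hI : IsIv I) {a b : Fin (n + 1)} (ha : a ∈ I)
    (hb : b ∈ I) : Finset.uIcc a b ⊆ I := by
  intro j hj
  rw [Finset.mem_uIcc] at hj
  rcases le_total a b with h | h
  · rw [min_eq_left h, max_eq_right h] at hj
    exact hI.mem_of_le ha hb hj.1 hj.2
  · rw [min_eq_right h, max_eq_left h] at hj
    exact hI.mem_of_le hb ha hj.1 hj.2

/-- Only the label of top priority in `I` matters: any path from `k` into `I` can be bounded first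
up to `m`, then inside `I`. -/
theorem subset_treeIv_iff {I : Finset (Fin (n + 1))} (hI : IsIv I) {m : Fin (n + 1)} (hm : m ∈ I)
    (hmax : ∀ i ∈ I, σ i ≤ σ m) {k : Fin (n + 1)} : I ⊆ treeIv σ k ↔ m ∈ treeIv σ k :=
  ⟨fun h => h hm, fun h _ hi => mem_treeIv_trans h fun j hj => hmax j (hI.uIcc_subset hm hi hj)⟩

theorem treeIv_subset_iff {k l : Fin (n + 1)} : treeIv σ k ⊆ treeIv σ l ↔ k ∈ treeIv σ l :=
  subset_treeIv_iff (isIv_treeIv k) (self_mem_treeIv k) fun _ => le_of_mem_treeIv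

theorem IsIv.exists_top {I : Finset (Fin (n + 1))} (hI : IsIv I) (σ : Equiv.Perm (Fin (n + 1))) :
    ∃ m ∈ I, ∀ i ∈ I, σ i ≤ σ m := Finset.exists_max_image I σ hI.1

/-- The parent is the proper ancestor of least priority. The equivalence says that the ancestors of
the parent are the proper ancestors of `k`. -/
theorem exists_parent {k : Fin (n + 1)} (hk : k ≠ treeRoot σ) :
    ∃ p, ∀ j, p ∈ treeIv σ j ↔ k ∈ treeIv σ j ∧ j ≠ k := by
  obtain ⟨p, hp, hmin⟩ := Finset.exists_min_image
    (Finset.univ.filter fun j => k ∈ treeIv σ j ∧ j ≠ k) σ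
    ⟨treeRoot σ, by simp [treeIv_treeRoot, hk.symm]⟩
  simp only [Finset.mem_filter, Finset.mem_univ, true_and] at hp hmin
  have hkp : σ k < σ p :=
    lt_of_le_of_ne (le_of_mem_treeIv hp.1) fun h => hp.2 (σ.injective h).symm
  refine ⟨p, fun j => ⟨fun h => ⟨?_, ?_⟩, fun ⟨h1, h2⟩ => mem_treeIv.2 fun i hi => ?_⟩⟩
  · exact mem_treeIv_trans h fun i hi => mem_treeIv.1 hp.1 i hi
  · rintro rfl
    exact absurd (le_of_mem_treeIv h) (not_le.2 hkp)
  -- The path from `j` to `p` is covered by the one from `j` to `k`, bounded by the priority of `j`,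
  -- and the one from `k` to `p`, bounded by that of `p`, which is minimal.
  · rcases mem_uIcc_split (b := k) hi with h | h
    · exact mem_treeIv.1 h1 i h
    · rw [Finset.uIcc_comm] at h
      exact (mem_treeIv.1 hp.1 i h).trans (hmin j ⟨h1, h2⟩)

variable (σ) in
/-- The parent of a label in the search tree of `σ`. -/
noncomputable def treeParent (k : Fin (n + 1)) : Fin (n + 1) :=
  Classical.epsilon fun p => ∀ j, p ∈ treeIv σ j ↔ k ∈ treeIv σ j ∧ j ≠ k

theorem treeParent_mem_iff {k : Fin (n + 1)} (hk : k ≠ treeRoot σ) (j : Fin (n + 1)) :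
    treeParent σ k ∈ treeIv σ j ↔ k ∈ treeIv σ j ∧ j ≠ k :=
  Classical.epsilon_spec (exists_parent hk) j

theorem mem_treeIv_treeParent {k : Fin (n + 1)} (hk : k ≠ treeRoot σ) :
    k ∈ treeIv σ (treeParent σ k) := ((treeParent_mem_iff hk _).1 (self_mem_treeIv _)).1

theorem treeParent_ne {k : Fin (n + 1)} (hk : k ≠ treeRoot σ) : treeParent σ k ≠ k :=
  ((treeParent_mem_iff hk _).1 (self_mem_treeIv _)).2

theorem lt_treeParent {k : Fin (n + 1)} (hk : k ≠ treeRoot σ) : σ k < σ (treeParent σ k) :=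
  lt_of_le_of_ne (le_of_mem_treeIv (mem_treeIv_treeParent hk))
    fun h => treeParent_ne hk (σ.injective h).symm

variable (σ) in
/-- The monomial that represents the label `i`, up to the common factors for the interval `I`. -/
def treeMonomial (z : Fin (n + 1) → ℝ) (I : Finset (Fin (n + 1))) (i : Fin (n + 1)) : ℝ :=
  ∏ k ∈ Finset.univ.filter (fun k => i ∈ treeIv σ k ∧ ¬ I ⊆ treeIv σ k), z k

variable (σ) in
/-- The monomial chart of the closure of the families of ratios. -/
noncomputable def ratioChart (z : Fin (n + 1) → ℝ) : Finset (Fin (n + 1)) → Fin (n + 1) → ℝ :=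
  fun I i => if IsIv I ∧ i ∈ I then treeMonomial σ z I i / ∑ j ∈ I, treeMonomial σ z I j else 0

theorem treeMonomial_nonneg {z : Fin (n + 1) → ℝ} (hz : z ∈ quadrant (n + 1))
    (I : Finset (Fin (n + 1))) (i : Fin (n + 1)) : 0 ≤ treeMonomial σ z I i :=
  Finset.prod_nonneg fun k _ => hz k

/-- All ancestors of the top label of `I` contain `I`, so no factor is left. Therefore the
denominators in the chart are at least 1 on the whole quadrant, boundary included. -/
theorem treeMonomial_top (z : Fin (n + 1) → ℝ) {I : Finset (Fin (n + 1))} (hI : IsIv I)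
    {m : Fin (n + 1)} (hm : m ∈ I) (hmax : ∀ i ∈ I, σ i ≤ σ m) : treeMonomial σ z I m = 1 := by
  unfold treeMonomial
  rw [Finset.filter_false_of_mem, Finset.prod_empty]
  rintro k _ ⟨h1, h2⟩
  exact h2 ((subset_treeIv_iff hI hm hmax).2 h1)

theorem treeMonomial_treeIv (z : Fin (n + 1) → ℝ) (m : Fin (n + 1)) :
    treeMonomial σ z (treeIv σ m) m = 1 :=
  treeMonomial_top z (isIv_treeIv m) (self_mem_treeIv m) fun _ => le_of_mem_treeIv

/-- The only ancestor of `k` that is not an ancestor of its parent is `k`. So the coordinate `z k`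
can be recovered from the interval of the parent. -/
theorem treeMonomial_parent (z : Fin (n + 1) → ℝ) {k : Fin (n + 1)} (hk : k ≠ treeRoot σ) :
    treeMonomial σ z (treeIv σ (treeParent σ k)) k = z k := by
  unfold treeMonomial
  have : (Finset.univ.filter fun j =>
      k ∈ treeIv σ j ∧ ¬ treeIv σ (treeParent σ k) ⊆ treeIv σ j) = {k} := by
    ext j
    simp only [Finset.mem_filter, Finset.mem_univ, true_and, Finset.mem_singleton,
      treeIv_subset_iff, treeParent_mem_iff hk]
    constructor
    · rintro ⟨h1, h2⟩
      by_contra h3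
      exact h2 ⟨h1, h3⟩
    · rintro rfl
      exact ⟨self_mem_treeIv j, fun h => h.2 rfl⟩
  rw [this, Finset.prod_singleton]

theorem one_le_sum_treeMonomial {z : Fin (n + 1) → ℝ} (hz : z ∈ quadrant (n + 1))
    {I : Finset (Fin (n + 1))} (hI : IsIv I) : 1 ≤ ∑ j ∈ I, treeMonomial σ z I j := by
  obtain ⟨m, hm, hmax⟩ := hI.exists_top σ
  rw [← treeMonomial_top z hI hm hmax]
  exact Finset.single_le_sum (f := treeMonomial σ z I) (fun j _ => treeMonomial_nonneg hz I j) hm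

theorem sum_treeMonomial_pos {z : Fin (n + 1) → ℝ} (hz : z ∈ quadrant (n + 1))
    {I : Finset (Fin (n + 1))} (hI : IsIv I) : 0 < ∑ j ∈ I, treeMonomial σ z I j :=
  zero_lt_one.trans_le (one_le_sum_treeMonomial hz hI)

theorem contDiff_treeMonomial (I : Finset (Fin (n + 1))) (i : Fin (n + 1)) :
    ContDiff ℝ ω fun z => treeMonomial σ z I i := by
  unfold treeMonomial
  exact contDiff_prod fun k _ => contDiff_apply ℝ ℝ k

theorem contDiffAt_ratioChart {z : Fin (n + 1) → ℝ} (hz : z ∈ quadrant (n + 1)) :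
    ContDiffAt ℝ ω (ratioChart σ) z := by
  refine contDiffAt_pi.2 fun I => contDiffAt_pi.2 fun i => ?_
  unfold ratioChart
  split_ifs with h
  · refine (contDiff_treeMonomial I i).contDiffAt.div
      (ContDiff.sum fun j _ => contDiff_treeMonomial I j).contDiffAt
      (sum_treeMonomial_pos hz h.1).ne'
  · exact contDiffAt_const

/-- The interval of the root is everything, so its variable always cancels. It is kept as a dummy
variable, so that there are as many variables as ambient coordinates. -/
theorem treeMonomial_congr {z z' : Fin (n + 1) → ℝ} (h : ∀ k, k ≠ treeRoot σ → z k = z' k)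
    (I : Finset (Fin (n + 1))) (i : Fin (n + 1)) : treeMonomial σ z I i = treeMonomial σ z' I i := by
  refine Finset.prod_congr rfl fun k hk => h k ?_
  rintro rfl
  simp [treeIv_treeRoot] at hk

theorem ratioChart_congr {z z' : Fin (n + 1) → ℝ} (h : ∀ k, k ≠ treeRoot σ → z k = z' k) :
    ratioChart σ z = ratioChart σ z' := by
  unfold ratioChart
  simp only [treeMonomial_congr h]

theorem isDistFamily_ratioChart {z : Fin (n + 1) → ℝ} (hz : z ∈ quadrant (n + 1)) :
    IsDistFamily (ratioChart σ z) := by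
  intro I hI
  have hp := sum_treeMonomial_pos (σ := σ) hz hI
  refine ⟨fun i => ?_, fun i hi => by simp [ratioChart, hi], ?_⟩
  · simp only [ratioChart]
    split_ifs
    · exact div_nonneg (treeMonomial_nonneg hz I i) hp.le
    · exact le_rfl
  · simp only [ratioChart, hI, true_and]
    rw [Finset.sum_ite_mem, Finset.univ_inter, ← Finset.sum_div, div_self hp.ne']

/-- Numerator and denominator differ from the honest products by the common factor over the `k` with
`I ⊆ treeIv σ k`, which is nonzero here. -/
theorem ratioChart_eq_ratioFamily {z : Fin (n + 1) → ℝ} (hz : z ∈ posVec n) :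
    ratioChart σ z =
      ratioFamily fun i => ∏ k ∈ Finset.univ.filter (fun k => i ∈ treeIv σ k), z k := by
  funext I i
  simp only [ratioChart, ratioFamily]
  split_ifs with h
  · have key : ∀ i ∈ I, ∏ k ∈ Finset.univ.filter (fun k => i ∈ treeIv σ k), z k =
        treeMonomial σ z I i * ∏ k ∈ Finset.univ.filter (fun k => I ⊆ treeIv σ k), z k := by
      intro i hi
      rw [treeMonomial, ← Finset.prod_union]
      · refine Finset.prod_congr ?_ fun _ _ => rfl
        ext k
        simp only [Finset.mem_filter, Finset.mem_univ, true_and, Finset.mem_union]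
        by_cases h : I ⊆ treeIv σ k
        · simp [h, h hi]
        · simp [h]
      · rw [Finset.disjoint_filter]
        exact fun k _ h1 h2 => h1.2 h2
    rw [key i h.2, Finset.sum_congr rfl key, ← Finset.sum_mul, mul_div_mul_right]
    exact (Finset.prod_pos fun k _ => hz k).ne'
  · rfl

theorem ratioFamily_smul {c : ℝ} (hc : c ≠ 0) (t : Fin (n + 1) → ℝ) :
    ratioFamily (fun i => c * t i) = ratioFamily t := by
  funext I i
  simp only [ratioFamily]
  split_ifs
  · rw [← Finset.mul_sum, mul_div_mul_left _ _ hc]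
  · rfl

variable (σ) in
/-- The coordinates of the monomial chart. -/
noncomputable def ratioCoord (r : Finset (Fin (n + 1)) → Fin (n + 1) → ℝ) : Fin (n + 1) → ℝ :=
  fun k => if k = treeRoot σ then 1 else
    r (treeIv σ (treeParent σ k)) k / r (treeIv σ (treeParent σ k)) (treeParent σ k)

theorem ratioChart_parent (z : Fin (n + 1) → ℝ) {k : Fin (n + 1)} (hk : k ≠ treeRoot σ) :
    ratioChart σ z (treeIv σ (treeParent σ k)) k =
      z k / ∑ j ∈ treeIv σ (treeParent σ k), treeMonomial σ z (treeIv σ (treeParent σ k)) j := by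
  simp only [ratioChart, isIv_treeIv, mem_treeIv_treeParent hk, true_and, if_true,
    treeMonomial_parent z hk]

theorem ratioChart_self (z : Fin (n + 1) → ℝ) (p : Fin (n + 1)) :
    ratioChart σ z (treeIv σ p) p = 1 / ∑ j ∈ treeIv σ p, treeMonomial σ z (treeIv σ p) j := by
  simp only [ratioChart, isIv_treeIv, self_mem_treeIv, true_and, if_true, treeMonomial_treeIv]

theorem ratioChart_self_pos {z : Fin (n + 1) → ℝ} (hz : z ∈ quadrant (n + 1)) (p : Fin (n + 1)) :
    0 < ratioChart σ z (treeIv σ p) p := by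
  rw [ratioChart_self]
  exact one_div_pos.2 (sum_treeMonomial_pos hz (isIv_treeIv p))

theorem ratioCoord_ratioChart {z : Fin (n + 1) → ℝ} (hz : z ∈ quadrant (n + 1))
    (hroot : z (treeRoot σ) = 1) : ratioCoord σ (ratioChart σ z) = z := by
  funext k
  unfold ratioCoord
  split_ifs with h
  · rw [h, hroot]
  · have hp := (sum_treeMonomial_pos (σ := σ) hz (isIv_treeIv (σ := σ) (treeParent σ k))).ne'
    rw [ratioChart_parent z h, ratioChart_self, div_div_div_cancel_right₀ hp, div_one]

theorem ratioCoord_ratioFamily {t : Fin (n + 1) → ℝ} (ht : t ∈ posVec n) (k : Fin (n + 1)) :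
    ratioCoord σ (ratioFamily t) k = if k = treeRoot σ then 1 else t k / t (treeParent σ k) := by
  unfold ratioCoord
  split_ifs with h
  · rfl
  · have hp := (sum_pos_of_posVec ht (isIv_treeIv (σ := σ) (treeParent σ k)).1).ne'
    simp only [ratioFamily, isIv_treeIv, mem_treeIv_treeParent h, self_mem_treeIv, true_and,
      if_true]
    rw [div_div_div_cancel_right₀ hp]

theorem ratioCoord_pos {t : Fin (n + 1) → ℝ} (ht : t ∈ posVec n) :
    ratioCoord σ (ratioFamily t) ∈ posVec n := by
  intro k
  rw [ratioCoord_ratioFamily ht]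
  split_ifs
  · exact one_pos
  · exact div_pos (ht _) (ht _)

/-- The product of the quotients `t k / t (treeParent σ k)` telescopes along the path from `i` up to
the root; the induction climbs, since priorities increase towards the root. -/
theorem prod_ratioCoord {t : Fin (n + 1) → ℝ} (ht : t ∈ posVec n) (i : Fin (n + 1)) :
    ∏ k ∈ Finset.univ.filter (fun k => i ∈ treeIv σ k), ratioCoord σ (ratioFamily t) k =
      (t (treeRoot σ))⁻¹ * t i := by
  induction hc : n - (σ i : ℕ) using Nat.strong_induction_on generalizing i with
  | _ c ih =>
  by_cases hi : i = treeRoot σ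
  · have : (Finset.univ.filter fun k => i ∈ treeIv σ k) = {i} := by
      ext k
      simp only [Finset.mem_filter, Finset.mem_univ, true_and, Finset.mem_singleton]
      constructor
      · intro h
        refine σ.injective ((le_of_mem_treeIv h).antisymm' ?_)
        rw [hi]; exact le_treeRoot k
      · rintro rfl; exact self_mem_treeIv k
    rw [this, Finset.prod_singleton, ratioCoord_ratioFamily ht, if_pos hi, hi,
      inv_mul_cancel₀ (ht _).ne']
  · have hset : (Finset.univ.filter fun k => i ∈ treeIv σ k) =
        insert i (Finset.univ.filter fun k => treeParent σ i ∈ treeIv σ k) := by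
      ext k
      simp only [Finset.mem_filter, Finset.mem_univ, true_and, Finset.mem_insert,
        treeParent_mem_iff hi]
      constructor
      · intro h; by_cases hk : k = i
        · exact Or.inl hk
        · exact Or.inr ⟨h, hk⟩
      · rintro (rfl | h)
        · exact self_mem_treeIv k
        · exact h.1
    have hnot : i ∉ Finset.univ.filter fun k => treeParent σ i ∈ treeIv σ k := by
      simp [treeParent_mem_iff hi]
    have hlt := lt_treeParent hi
    rw [hset, Finset.prod_insert hnot, ih _ ?_ (treeParent σ i) rfl, ratioCoord_ratioFamily ht,
      if_neg hi]
    · have h1 := (ht (treeParent σ i)).ne'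
      field_simp
    · have := (σ (treeParent σ i)).isLt
      rw [Fin.lt_def] at hlt
      omega

theorem ratioChart_ratioCoord_ratioFamily {t : Fin (n + 1) → ℝ} (ht : t ∈ posVec n) :
    ratioChart σ (ratioCoord σ (ratioFamily t)) = ratioFamily t := by
  rw [ratioChart_eq_ratioFamily (ratioCoord_pos ht)]
  simp only [prod_ratioCoord ht]
  exact ratioFamily_smul (inv_ne_zero (ht _).ne') t

theorem posVec_subset_quadrant : posVec n ⊆ quadrant (n + 1) := fun _ h k => (h k).le

theorem quadrant_subset_closure : quadrant (n + 1) ⊆ closure (posVec n) := by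
  intro z hz
  have h1 : Filter.Tendsto (fun s : ℝ => fun k => z k + s) (𝓝[>] 0) (𝓝 z) := by
    have : Continuous fun s : ℝ => fun k => z k + s := by fun_prop
    have h2 := this.tendsto 0
    simp only [add_zero] at h2
    exact h2.mono_left nhdsWithin_le_nhds
  refine mem_closure_of_tendsto h1 ?_
  filter_upwards [self_mem_nhdsWithin] with s hs k
  have := hz k
  have hs' : (0 : ℝ) < s := hs
  change 0 < z k + s
  linarith

theorem ratioChart_mem {z : Fin (n + 1) → ℝ} (hz : z ∈ quadrant (n + 1)) :
    ratioChart σ z ∈ ratioClosure n := by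
  have h1 := (contDiffAt_ratioChart (σ := σ) hz).continuousAt.continuousWithinAt (s := posVec n)
  refine closure_mono ?_ (h1.mem_closure_image (quadrant_subset_closure hz))
  rintro _ ⟨z, hz, rfl⟩
  rw [ratioChart_eq_ratioFamily hz]
  exact mem_image_of_mem _ fun i => Finset.prod_pos fun k _ => hz k

/-- Every point of the closure lies in the domain of a monomial chart. -/
theorem exists_ratioChart {r : Finset (Fin (n + 1)) → Fin (n + 1) → ℝ} (hr : r ∈ ratioClosure n) :
    ∃ σ, ∃ z ∈ quadrant (n + 1), z (treeRoot σ) = 1 ∧ ratioChart σ z = r := by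
  -- The unit cube suffices. Its images under the finitely many charts are compact, so it is enough
  -- that their union contains the ratio families.
  let K : Equiv.Perm (Fin (n + 1)) → Set (Fin (n + 1) → ℝ) := fun σ =>
    (Set.pi univ fun _ => Icc (0 : ℝ) 1) ∩ {z | z (treeRoot σ) = 1}
  have hK : ∀ σ, IsCompact (K σ) := fun σ =>
    (isCompact_univ_pi fun _ => isCompact_Icc).inter_right
      (isClosed_eq (continuous_apply _) continuous_const)
  have hKq : ∀ σ, K σ ⊆ quadrant (n + 1) := fun σ z hz k => (hz.1 k (mem_univ k)).1
  have hc : IsClosed (⋃ σ : Equiv.Perm (Fin (n + 1)), ratioChart σ '' K σ) := by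
    refine isClosed_iUnion_of_finite fun σ => ((hK σ).image_of_continuousOn ?_).isClosed
    exact fun z hz => (contDiffAt_ratioChart (hKq σ hz)).continuousAt.continuousWithinAt
  have hsub : ratioFamily '' posVec n ⊆ ⋃ σ : Equiv.Perm (Fin (n + 1)), ratioChart σ '' K σ := by
    rintro _ ⟨t, ht, rfl⟩
    -- With priorities given by the size of the gaps, no gap exceeds that of its parent, so the
    -- coordinates are at most 1.
    obtain ⟨σ, hσ⟩ := exists_perm_monotone t
    refine mem_iUnion.2 ⟨σ, ratioCoord σ (ratioFamily t), ⟨fun k _ => ⟨(ratioCoord_pos ht k).le, ?_⟩,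
      by simp [ratioCoord]⟩, ratioChart_ratioCoord_ratioFamily ht⟩
    rw [ratioCoord_ratioFamily ht]
    split_ifs with h
    · exact le_rfl
    · exact div_le_one_of_le₀ (hσ _ _ (lt_treeParent h).le) (ht _).le
  obtain ⟨σ, z, hz, rfl⟩ := mem_iUnion.1 (closure_minimal hsub hc hr)
  exact ⟨σ, z, hKq σ hz, hz.2, rfl⟩

variable (σ) in
/-- The domain of the coordinates of a monomial chart. -/
def ratioDomain : Set (Finset (Fin (n + 1)) → Fin (n + 1) → ℝ) :=
  {r | ∀ p, 0 < r (treeIv σ p) p}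

theorem isOpen_ratioDomain : IsOpen (ratioDomain σ) := by
  simp only [ratioDomain, ofPred_forall]
  exact isOpen_iInter_of_finite fun p => isOpen_lt continuous_const (by fun_prop)

theorem continuousAt_ratioCoord {r : Finset (Fin (n + 1)) → Fin (n + 1) → ℝ}
    (hr : r ∈ ratioDomain σ) : ContinuousAt (ratioCoord σ) r := by
  refine continuousAt_pi.2 fun k => ?_
  unfold ratioCoord
  split_ifs with h
  · exact continuousAt_const
  · exact (continuous_apply_apply _ _).continuousAt.div (continuous_apply_apply _ _).continuousAt
      (hr _).ne'

theorem ratioCoord_mem_quadrant {r : Finset (Fin (n + 1)) → Fin (n + 1) → ℝ}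
    (hr : r ∈ ratioClosure n) : ratioCoord σ r ∈ quadrant (n + 1) := by
  intro k
  unfold ratioCoord
  have h := isDistFamily_of_mem hr _ (isIv_treeIv (σ := σ) (treeParent σ k))
  split_ifs
  · exact zero_le_one
  · exact div_nonneg (h.1 _) (h.1 _)

/-- The identity holds for ratio families. As the domain is open, `r` is a limit of ratio families
inside the domain, where both sides are continuous. -/
theorem ratioChart_ratioCoord {r : Finset (Fin (n + 1)) → Fin (n + 1) → ℝ}
    (hr : r ∈ ratioClosure n) (hd : r ∈ ratioDomain σ) :
    ratioChart σ (ratioCoord σ r) = r := by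
  have hr' : r ∈ closure ((ratioFamily '' posVec n) ∩ ratioDomain σ) := by
    rw [inter_comm]
    exact isOpen_ratioDomain.inter_closure ⟨hd, hr⟩
  have h1 : ContinuousAt (fun r => ratioChart σ (ratioCoord σ r)) r :=
    ContinuousAt.comp (g := ratioChart σ)
      (contDiffAt_ratioChart (ratioCoord_mem_quadrant hr)).continuousAt (continuousAt_ratioCoord hd)
  have hne : (𝓝[(ratioFamily '' posVec n) ∩ ratioDomain σ] r).NeBot :=
    mem_closure_iff_nhdsWithin_neBot.1 hr'
  have h2 : ∀ᶠ r' in 𝓝[(ratioFamily '' posVec n) ∩ ratioDomain σ] r,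
      ratioChart σ (ratioCoord σ r') = id r' := by
    filter_upwards [self_mem_nhdsWithin] with r hr
    obtain ⟨⟨t, ht, rfl⟩, -⟩ := hr
    exact ratioChart_ratioCoord_ratioFamily ht
  exact tendsto_nhds_unique_of_eventuallyEq (h1.tendsto.mono_left nhdsWithin_le_nhds)
    (Filter.tendsto_id.mono_left nhdsWithin_le_nhds) h2

/-- The facets that contain the image of a point of a monomial chart. -/
theorem sum_minkowskiMap_ratioChart_eq_iff {ε : Finset (Fin (n + 1)) → ℝ}
    (hε : IsTruncationDepth ε) {z : Fin (n + 1) → ℝ} (hz : z ∈ quadrant (n + 1))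
    {S : Finset (Fin (n + 1))} (hS : IsFacet S) :
    ∑ i ∈ S, minkowskiMap ε (ratioChart σ z) i = faceDepth ε S ↔
      ∃ k, S = treeIv σ k ∧ z k = 0 := by
  rw [(isDistFamily_ratioChart hz).sum_minkowskiMap_eq_iff hε hS.1]
  constructor
  · intro h
    obtain ⟨m, hm, hmax⟩ := hS.1.exists_top σ
    have h1 : S ⊆ treeIv σ m := (subset_treeIv_iff hS.1 hm hmax).2 (self_mem_treeIv m)
    -- The top label of a tree interval always keeps positive mass there, so tightness of `S` at `m`
    -- is possible only if that interval lies in `S`.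
    have h2 : treeIv σ m ⊆ S := by
      by_contra hcon
      exact (ratioChart_self_pos hz m).ne' (h _ (isIv_treeIv m) hcon m hm)
    have h3 := h1.antisymm h2
    have hmr : m ≠ treeRoot σ := fun h => hS.2 (by rw [h3, h, treeIv_treeRoot])
    refine ⟨m, h3, ?_⟩
    -- The interval of the parent is not inside `S`, and its mass at `m` is a positive multiple of
    -- `z m`.
    have h4 : ¬ treeIv σ (treeParent σ m) ⊆ S := by
      rw [h3, treeIv_subset_iff, treeParent_mem_iff hmr]
      exact fun h => h.2 rfl
    have h5 := h _ (isIv_treeIv _) h4 m hm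
    rw [ratioChart_parent z hmr, div_eq_zero_iff] at h5
    exact h5.resolve_right (sum_treeMonomial_pos hz (isIv_treeIv _)).ne'
  · rintro ⟨k, rfl, hk⟩ I hI hIS i hi
    simp only [ratioChart]
    split_ifs
    -- The factor `z k` survives cancellation, since `I` is not contained in the interval of `k`.
    · have : treeMonomial σ z I i = 0 :=
        Finset.prod_eq_zero (i := k) (by simp [hi, hIS]) hk
      rw [this, zero_div]
    · rfl

end Charts

/-! ## The Minkowski map is a diffeomorphism from the closure of the ratios to the associahedron -/

section ChartDerivative

variable {n : ℕ} (σ : Equiv.Perm (Fin (n + 1)))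

/-- The directional derivative of a tree monomial. -/
def treeMonomialDeriv (z v : Fin (n + 1) → ℝ) (I : Finset (Fin (n + 1))) (i : Fin (n + 1)) : ℝ :=
  ∑ k ∈ Finset.univ.filter (fun k => i ∈ treeIv σ k ∧ ¬ I ⊆ treeIv σ k),
    (∏ j ∈ (Finset.univ.filter (fun k => i ∈ treeIv σ k ∧ ¬ I ⊆ treeIv σ k)).erase k, z j) * v k

/-- The directional derivative of a ratio in a monomial chart. -/
noncomputable def ratioDeriv (z v : Fin (n + 1) → ℝ) (I : Finset (Fin (n + 1)))
    (i : Fin (n + 1)) : ℝ :=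
  if IsIv I ∧ i ∈ I then
    (treeMonomialDeriv σ z v I i * (∑ j ∈ I, treeMonomial σ z I j) -
      treeMonomial σ z I i * ∑ j ∈ I, treeMonomialDeriv σ z v I j) /
        (∑ j ∈ I, treeMonomial σ z I j) ^ 2
  else 0

variable {σ}

theorem hasDerivAt_treeMonomial (z v : Fin (n + 1) → ℝ) (I : Finset (Fin (n + 1)))
    (i : Fin (n + 1)) : HasDerivAt (fun s : ℝ => treeMonomial σ (z + s • v) I i)
      (treeMonomialDeriv σ z v I i) 0 := by
  unfold treeMonomial treeMonomialDeriv
  have h : ∀ k ∈ Finset.univ.filter (fun k => i ∈ treeIv σ k ∧ ¬ I ⊆ treeIv σ k),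
      HasDerivAt (fun s : ℝ => (z + s • v) k) (v k) 0 := by
    intro k _
    simpa using ((hasDerivAt_id (0 : ℝ)).mul_const (v k)).const_add (z k)
  simpa using HasDerivAt.fun_finsetProd h

theorem hasDerivAt_ratioChart {z : Fin (n + 1) → ℝ} (hz : z ∈ quadrant (n + 1))
    (v : Fin (n + 1) → ℝ) (I : Finset (Fin (n + 1))) (i : Fin (n + 1)) :
    HasDerivAt (fun s : ℝ => ratioChart σ (z + s • v) I i) (ratioDeriv σ z v I i) 0 := by
  unfold ratioChart ratioDeriv
  split_ifs with h
  · have h1 := hasDerivAt_treeMonomial (σ := σ) z v I i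
    have h2 : HasDerivAt (fun s : ℝ => ∑ j ∈ I, treeMonomial σ (z + s • v) I j)
        (∑ j ∈ I, treeMonomialDeriv σ z v I j) 0 :=
      HasDerivAt.fun_sum fun j _ => hasDerivAt_treeMonomial (σ := σ) z v I j
    have h3 : (∑ j ∈ I, treeMonomial σ (z + (0 : ℝ) • v) I j) ≠ 0 := by
      simpa using (sum_treeMonomial_pos (σ := σ) hz h.1).ne'
    simpa using h1.fun_div h2 h3
  · exact hasDerivAt_const _ _

/-- The total mass is constantly 1, so its derivative vanishes. -/
theorem sum_ratioDeriv (z v : Fin (n + 1) → ℝ) {I S : Finset (Fin (n + 1))} (hI : IsIv I)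
    (hIS : I ⊆ S) : ∑ i ∈ S, ratioDeriv σ z v I i = 0 := by
  simp only [ratioDeriv, hI, true_and]
  rw [Finset.sum_ite_mem, Finset.inter_eq_right.2 hIS, ← Finset.sum_div, Finset.sum_sub_distrib,
    ← Finset.sum_mul, ← Finset.sum_mul, mul_comm, sub_self, zero_div]

/-- Derivatives along a vanishing coordinate. -/
theorem ratioDeriv_of_eq_zero {z : Fin (n + 1) → ℝ} (v : Fin (n + 1) → ℝ)
    {I : Finset (Fin (n + 1))} {i k : Fin (n + 1)} (hI : IsIv I) (hiI : i ∈ I)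
    (hi : i ∈ treeIv σ k) (hIk : ¬ I ⊆ treeIv σ k) (hk : z k = 0) :
    ratioDeriv σ z v I i =
      (∏ j ∈ (Finset.univ.filter (fun k => i ∈ treeIv σ k ∧ ¬ I ⊆ treeIv σ k)).erase k, z j) /
        (∑ j ∈ I, treeMonomial σ z I j) * v k := by
  have hkF : k ∈ Finset.univ.filter (fun k => i ∈ treeIv σ k ∧ ¬ I ⊆ treeIv σ k) := by
    simp [hi, hIk]
  have h0 : treeMonomial σ z I i = 0 := Finset.prod_eq_zero hkF hk
  have h1 : treeMonomialDeriv σ z v I i =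
      (∏ j ∈ (Finset.univ.filter (fun k => i ∈ treeIv σ k ∧ ¬ I ⊆ treeIv σ k)).erase k, z j) *
        v k := by
    unfold treeMonomialDeriv
    refine Finset.sum_eq_single_of_mem k hkF fun l hl hlk => ?_
    rw [Finset.prod_eq_zero (i := k) (Finset.mem_erase.2 ⟨hlk.symm, hkF⟩) hk, zero_mul]
  simp only [ratioDeriv, hI, hiI, true_and, if_true, h0, h1, zero_mul, sub_zero]
  rcases eq_or_ne (∑ j ∈ I, treeMonomial σ z I j) 0 with h | h
  · simp [h]
  · field_simp

/-- Logarithmic derivatives. -/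
theorem ratioDeriv_eq_mul {z v : Fin (n + 1) → ℝ} (hz : z ∈ quadrant (n + 1))
    (hv : ∀ k, k ≠ treeRoot σ → z k = 0 → v k = 0) {I : Finset (Fin (n + 1))} (hI : IsIv I)
    (i : Fin (n + 1)) :
    ratioDeriv σ z v I i = ratioChart σ z I i *
      ((∑ k ∈ Finset.univ.filter (fun k => i ∈ treeIv σ k), v k / z k) - ∑ j, ratioChart σ z I j *
        ∑ k ∈ Finset.univ.filter (fun k => j ∈ treeIv σ k), v k / z k) := by
  by_cases hi : i ∈ I
  swap
  · simp [ratioDeriv, ratioChart, hi]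
  set w : Fin (n + 1) → ℝ := fun i => ∑ k ∈ Finset.univ.filter (fun k => i ∈ treeIv σ k), v k / z k
    with hw
  set c : ℝ := ∑ k ∈ Finset.univ.filter (fun k => I ⊆ treeIv σ k), v k / z k with hc
  -- Here `w i` is the logarithmic derivative of the full product over the ancestors of `i`, and `c`
  -- is the part from the cancelled factors, the same for all `i ∈ I`.
  have key : ∀ i ∈ I, treeMonomialDeriv σ z v I i = treeMonomial σ z I i * (w i - c) := by
    intro i hi
    have h1 : w i - c = ∑ k ∈ Finset.univ.filter (fun k => i ∈ treeIv σ k ∧ ¬ I ⊆ treeIv σ k),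
        v k / z k := by
      rw [hw, hc, sub_eq_iff_eq_add, ← Finset.sum_union]
      · refine Finset.sum_congr ?_ fun _ _ => rfl
        ext k
        simp only [Finset.mem_filter, Finset.mem_univ, true_and, Finset.mem_union]
        by_cases h : I ⊆ treeIv σ k
        · simp [h, h hi]
        · simp [h]
      · rw [Finset.disjoint_filter]
        exact fun k _ h1 h2 => h1.2 h2
    rw [h1, treeMonomialDeriv, treeMonomial, Finset.mul_sum]
    refine Finset.sum_congr rfl fun k hk => ?_
    rw [← Finset.mul_prod_erase _ _ hk]
    have hkr : k ≠ treeRoot σ := by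
      rintro rfl
      simp [treeIv_treeRoot] at hk
    -- A zero coordinate does not move, and the convention `0 / 0 = 0` makes its term vanish on the
    -- right as well.
    by_cases h0 : z k = 0
    · simp [h0, hv k hkr h0]
    · field_simp
  have hD := (sum_treeMonomial_pos (σ := σ) hz hI).ne'
  have hsum : ∑ j, ratioChart σ z I j * w j =
      (∑ j ∈ I, treeMonomial σ z I j * w j) / ∑ j ∈ I, treeMonomial σ z I j := by
    simp only [ratioChart, hI, true_and, ite_mul, zero_mul]
    rw [Finset.sum_ite_mem, Finset.univ_inter, Finset.sum_div]
    exact Finset.sum_congr rfl fun j _ => by ring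
  have hD' : ∑ j ∈ I, treeMonomialDeriv σ z v I j =
      (∑ j ∈ I, treeMonomial σ z I j * w j) - (∑ j ∈ I, treeMonomial σ z I j) * c := by
    rw [Finset.sum_congr rfl key, Finset.sum_mul, ← Finset.sum_sub_distrib]
    exact Finset.sum_congr rfl fun j _ => by ring
  rw [hsum, ratioDeriv, ratioChart, if_pos ⟨hI, hi⟩, if_pos ⟨hI, hi⟩, hD', key i hi]
  field_simp
  ring

theorem two_le_card_treeIv_treeParent {k : Fin (n + 1)} (hk : k ≠ treeRoot σ) :
    2 ≤ (treeIv σ (treeParent σ k)).card :=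
  Finset.one_lt_card.2 ⟨_, self_mem_treeIv _, k, mem_treeIv_treeParent hk, treeParent_ne hk⟩

theorem sum_anc_treeParent {k : Fin (n + 1)} (hk : k ≠ treeRoot σ) (f : Fin (n + 1) → ℝ) :
    ∑ j ∈ Finset.univ.filter (fun j => k ∈ treeIv σ j), f j =
      f k + ∑ j ∈ Finset.univ.filter (fun j => treeParent σ k ∈ treeIv σ j), f j := by
  have hset : (Finset.univ.filter fun j => k ∈ treeIv σ j) =
      insert k (Finset.univ.filter fun j => treeParent σ k ∈ treeIv σ j) := by
    ext j
    simp only [Finset.mem_filter, Finset.mem_univ, true_and, Finset.mem_insert,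
      treeParent_mem_iff hk]
    constructor
    · intro h
      by_cases hj : j = k
      · exact Or.inl hj
      · exact Or.inr ⟨h, hj⟩
    · rintro (rfl | h)
      · exact self_mem_treeIv j
      · exact h.1
  rw [hset, Finset.sum_insert]
  simp [treeParent_mem_iff hk]

variable {ε : Finset (Fin (n + 1)) → ℝ}

/-- At a point with `z k = 0`, the derivative of the slack of the facet `treeIv σ k` is `v k` times
a sum of nonnegative terms, one of which is positive. -/
theorem eq_zero_of_coord_eq_zero (hε : IsTruncationDepth ε) {z v : Fin (n + 1) → ℝ}
    (hz : z ∈ quadrant (n + 1)) (h : ∀ i, ∑ I, minkowskiCoeff ε I * ratioDeriv σ z v I i = 0)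
    {k : Fin (n + 1)} (hk : k ≠ treeRoot σ) (hzk : z k = 0) : v k = 0 := by
  by_contra hvk
  set P : Finset (Fin (n + 1)) → Fin (n + 1) → ℝ := fun I i => if i ∈ I then
    (∏ j ∈ (Finset.univ.filter (fun k => i ∈ treeIv σ k ∧ ¬ I ⊆ treeIv σ k)).erase k, z j) /
        (∑ j ∈ I, treeMonomial σ z I j) else 0 with hP
  have hP0 : ∀ I, IsIv I → ∀ i, 0 ≤ P I i := by
    intro I hI i
    simp only [hP]
    split_ifs
    · exact div_nonneg (Finset.prod_nonneg fun j _ => hz j) (sum_treeMonomial_pos hz hI).le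
    · exact le_rfl
  have hI0 : ∀ I, 0 ≤ minkowskiCoeff ε I * ∑ i ∈ treeIv σ k, P I i := by
    intro I
    by_cases hI : IsIv I
    · exact mul_nonneg (minkowskiCoeff_nonneg hε I) (Finset.sum_nonneg fun i _ => hP0 I hI i)
    · simp [minkowskiCoeff_of_not_isIv hI]
  have h1 : ∑ I ∈ Finset.univ.filter (fun I => ¬ I ⊆ treeIv σ k),
      minkowskiCoeff ε I * ∑ i ∈ treeIv σ k, P I i = 0 := by
    have h2 : ∑ I, minkowskiCoeff ε I * ∑ i ∈ treeIv σ k, ratioDeriv σ z v I i = 0 := by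
      simp only [Finset.mul_sum]
      rw [Finset.sum_comm]
      exact Finset.sum_eq_zero fun i _ => h i
    have h3 : ∑ I ∈ Finset.univ.filter (fun I => ¬ I ⊆ treeIv σ k),
        minkowskiCoeff ε I * ∑ i ∈ treeIv σ k, ratioDeriv σ z v I i = 0 := by
      rw [← h2]
      refine Finset.sum_subset (Finset.filter_subset _ _) fun I _ hI => ?_
      by_cases hIi : IsIv I
      · rw [sum_ratioDeriv z v hIi (by simpa using hI), mul_zero]
      · simp [minkowskiCoeff_of_not_isIv hIi]
    have h4 : (∑ I ∈ Finset.univ.filter (fun I => ¬ I ⊆ treeIv σ k),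
        minkowskiCoeff ε I * ∑ i ∈ treeIv σ k, P I i) * v k = 0 := by
      rw [← h3, Finset.sum_mul]
      refine Finset.sum_congr rfl fun I hI => ?_
      by_cases hIi : IsIv I
      · rw [mul_assoc, Finset.sum_mul]
        congr 1
        refine Finset.sum_congr rfl fun i hi => ?_
        by_cases hiI : i ∈ I
        · rw [ratioDeriv_of_eq_zero v hIi hiI hi (by simpa using hI) hzk]
          simp [hP, hiI]
        · simp [hP, ratioDeriv, hiI]
      · simp [minkowskiCoeff_of_not_isIv hIi]
    exact (mul_eq_zero.1 h4).resolve_right hvk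
  have hnot : ¬ treeIv σ (treeParent σ k) ⊆ treeIv σ k := by
    rw [treeIv_subset_iff, treeParent_mem_iff hk]
    exact fun h => h.2 rfl
  have h5 := (Finset.sum_eq_zero_iff_of_nonneg fun I _ => hI0 I).1 h1
    (treeIv σ (treeParent σ k)) (by simpa using hnot)
  have h6 := (mul_eq_zero.1 h5).resolve_left
    (minkowskiCoeff_pos hε (isIv_treeIv _) (two_le_card_treeIv_treeParent hk)).ne'
  have h7 := (Finset.sum_eq_zero_iff_of_nonneg fun i _ => hP0 _ (isIv_treeIv _) i).1 h6 k
    (self_mem_treeIv k)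
  -- For the interval of the parent and the label `k`, the product without the factor `z k` is
  -- empty; this gives the positive term.
  have h8 : (Finset.univ.filter fun j =>
      k ∈ treeIv σ j ∧ ¬ treeIv σ (treeParent σ k) ⊆ treeIv σ j).erase k = ∅ := by
    ext j
    simp only [Finset.mem_erase, Finset.mem_filter, Finset.mem_univ, true_and, treeIv_subset_iff,
      treeParent_mem_iff hk, Finset.notMem_empty, iff_false]
    tauto
  simp only [hP, mem_treeIv_treeParent hk, if_true, h8, Finset.prod_empty] at h7
  exact (one_div_pos.2 (sum_treeMonomial_pos hz (isIv_treeIv _))).ne' h7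

/-- Summing coordinates gives the vanishing at the root, and vanishing coordinates are covered by
`eq_zero_of_coord_eq_zero`. Otherwise the derivative of `r_I(i)` is `r_I(i) (w_i - m_I)`, with `m_I`
the mean of `w` for `r_I`. Pairing the image vector with `w` gives `∑ y_I Var_I(w) = 0`, so `w` is
constant on the support of `r_I` for each `I` with positive coefficient. -/
theorem chart_deriv_injective (hε : IsTruncationDepth ε) {z v : Fin (n + 1) → ℝ}
    (hz : z ∈ quadrant (n + 1))
    (h : ∀ i, ∑ I, minkowskiCoeff ε I * ratioDeriv σ z v I i + v (treeRoot σ) = 0) : v = 0 := by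
  have hroot : v (treeRoot σ) = 0 := by
    have h1 : ∑ i, (∑ I, minkowskiCoeff ε I * ratioDeriv σ z v I i + v (treeRoot σ)) = 0 :=
      Finset.sum_eq_zero fun i _ => h i
    rw [Finset.sum_add_distrib, Finset.sum_comm, Finset.sum_const, Finset.sum_eq_zero, zero_add,
      nsmul_eq_mul] at h1
    · refine (mul_eq_zero.1 h1).resolve_left ?_
      simp only [Finset.card_univ, Fintype.card_fin]
      positivity
    · intro I _
      by_cases hI : IsIv I
      · rw [← Finset.mul_sum, sum_ratioDeriv z v hI (Finset.subset_univ I), mul_zero]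
      · simp [minkowskiCoeff_of_not_isIv hI]
  simp only [hroot, add_zero] at h
  have hv0 : ∀ k, k ≠ treeRoot σ → z k = 0 → v k = 0 := fun k hk hzk =>
    eq_zero_of_coord_eq_zero hε hz h hk hzk
  set w : Fin (n + 1) → ℝ := fun i => ∑ k ∈ Finset.univ.filter (fun k => i ∈ treeIv σ k), v k / z k
    with hw
  set m : Finset (Fin (n + 1)) → ℝ := fun I => ∑ j, ratioChart σ z I j * w j with hm
  have hr := isDistFamily_ratioChart (σ := σ) hz
  have hvar : ∑ I, minkowskiCoeff ε I * ∑ i, ratioChart σ z I i * (w i - m I) ^ 2 = 0 := by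
    have h1 : ∑ i, w i * ∑ I, minkowskiCoeff ε I * ratioDeriv σ z v I i = 0 :=
      Finset.sum_eq_zero fun i _ => by rw [h i, mul_zero]
    rw [← h1]
    simp only [Finset.mul_sum]
    rw [Finset.sum_comm (γ := Fin (n + 1))]
    refine Finset.sum_congr rfl fun I _ => ?_
    by_cases hI : IsIv I
    · have h2 : ∑ i, ratioChart σ z I i * (w i - m I) = 0 := by
        simp only [mul_sub, Finset.sum_sub_distrib, ← Finset.sum_mul, (hr I hI).2.2, one_mul]
        simp [hm]
      have h3 : ∑ i, ratioChart σ z I i * (w i - m I) * m I = 0 := by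
        rw [← Finset.sum_mul, h2, zero_mul]
      calc ∑ i, minkowskiCoeff ε I * (ratioChart σ z I i * (w i - m I) ^ 2)
          = ∑ i, (w i * (minkowskiCoeff ε I * ratioDeriv σ z v I i) -
              minkowskiCoeff ε I * (ratioChart σ z I i * (w i - m I) * m I)) := by
            refine Finset.sum_congr rfl fun i _ => ?_
            rw [ratioDeriv_eq_mul hz hv0 hI]
            change _ = w i * (minkowskiCoeff ε I * (ratioChart σ z I i * (w i - m I))) - _
            ring
        _ = _ := by rw [Finset.sum_sub_distrib, ← Finset.mul_sum, h3, mul_zero, sub_zero]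
    · simp [minkowskiCoeff_of_not_isIv hI]
  funext k
  by_cases hk : k = treeRoot σ
  · rw [hk, hroot]; rfl
  by_cases hzk : z k = 0
  · exact hv0 k hk hzk
  have hpos : ∀ I, IsIv I → ∀ i, 0 ≤ ratioChart σ z I i * (w i - m I) ^ 2 := fun I hI i =>
    mul_nonneg ((hr I hI).1 i) (sq_nonneg _)
  have h4 := (Finset.sum_eq_zero_iff_of_nonneg (fun I _ => by
    by_cases hI : IsIv I
    · exact mul_nonneg (minkowskiCoeff_nonneg hε I) (Finset.sum_nonneg fun i _ => hpos I hI i)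
    · simp [minkowskiCoeff_of_not_isIv hI])).1 hvar (treeIv σ (treeParent σ k)) (Finset.mem_univ _)
  have h5 := (mul_eq_zero.1 h4).resolve_left
    (minkowskiCoeff_pos hε (isIv_treeIv _) (two_le_card_treeIv_treeParent hk)).ne'
  have h6 := (Finset.sum_eq_zero_iff_of_nonneg fun i _ => hpos _ (isIv_treeIv _) i).1 h5
  have h7 := h6 (treeParent σ k) (Finset.mem_univ _)
  have h8 := h6 k (Finset.mem_univ _)
  have h9 := (mul_eq_zero.1 h7).resolve_left (ratioChart_self_pos hz _).ne'
  have h10 : ratioChart σ z (treeIv σ (treeParent σ k)) k ≠ 0 := by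
    rw [ratioChart_parent z hk]
    exact div_ne_zero hzk (sum_treeMonomial_pos hz (isIv_treeIv _)).ne'
  have h11 := (mul_eq_zero.1 h8).resolve_left h10
  -- A label and its parent both carry positive mass in the interval of the parent; the difference
  -- of their `w` is `v k / z k`.
  have h12 : w k = w (treeParent σ k) := by
    have e1 := pow_eq_zero_iff (two_ne_zero) |>.1 h9
    have e2 := pow_eq_zero_iff (two_ne_zero) |>.1 h11
    linarith
  have h13 : w k = v k / z k + w (treeParent σ k) := sum_anc_treeParent hk fun j => v j / z j
  have h14 : v k / z k = 0 := by linarith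
  exact (div_eq_zero_iff.1 h14).resolve_right hzk

end ChartDerivative

-- Local inverses, surjectivity and smoothness of the inverse.

section MinkowskiDiffeo

variable {n : ℕ} {σ : Equiv.Perm (Fin (n + 1))} {ε : Finset (Fin (n + 1)) → ℝ}

/-- The Minkowski map in a monomial chart, extended to a map between spaces of equal dimension. -/
noncomputable def chartMap (ε : Finset (Fin (n + 1)) → ℝ) (σ : Equiv.Perm (Fin (n + 1)))
    (z : Fin (n + 1) → ℝ) : Fin (n + 1) → ℝ :=
  fun i => minkowskiMap ε (ratioChart σ z) i + (z (treeRoot σ) - 1)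

theorem contDiffAt_chartMap {z : Fin (n + 1) → ℝ} (hz : z ∈ quadrant (n + 1)) :
    ContDiffAt ℝ ω (chartMap ε σ) z := by
  have h := (contDiff_minkowskiMap ε).contDiffAt.comp z (contDiffAt_ratioChart (σ := σ) hz)
  refine contDiffAt_pi.2 fun i => ?_
  exact (contDiffAt_pi.1 h i).add ((contDiff_apply ℝ ℝ _).contDiffAt.sub contDiffAt_const)

theorem exists_hasFDerivAt_chartMap (hε : IsTruncationDepth ε) {z : Fin (n + 1) → ℝ}
    (hz : z ∈ quadrant (n + 1)) : ∃ f' : (Fin (n + 1) → ℝ) ≃L[ℝ] (Fin (n + 1) → ℝ),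
      HasFDerivAt (chartMap ε σ) (f' : (Fin (n + 1) → ℝ) →L[ℝ] (Fin (n + 1) → ℝ)) z := by
  have hd : HasFDerivAt (chartMap ε σ) (fderiv ℝ (chartMap ε σ) z) z :=
    ((contDiffAt_chartMap hz).differentiableAt (by simp)).hasFDerivAt
  have hinj : Function.Injective
      (fderiv ℝ (chartMap ε σ) z : (Fin (n + 1) → ℝ) →ₗ[ℝ] (Fin (n + 1) → ℝ)) := by
    rw [← LinearMap.ker_eq_bot, LinearMap.ker_eq_bot']
    intro v hv
    refine chart_deriv_injective (σ := σ) hε hz fun i => ?_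
    have h1 : HasDerivAt (fun s : ℝ => chartMap ε σ (z + s • v)) 0 0 := by
      have hline : HasDerivAt (fun s : ℝ => z + s • v) v 0 := by
        simpa using ((hasDerivAt_id (0 : ℝ)).smul_const v).const_add z
      have h0 : HasFDerivAt (chartMap ε σ) (fderiv ℝ (chartMap ε σ) z) (z + (0 : ℝ) • v) := by
        simpa using hd
      have := h0.comp_hasDerivAt 0 hline
      rwa [show fderiv ℝ (chartMap ε σ) z v = 0 from hv] at this
    have h2 : HasDerivAt (fun s : ℝ => chartMap ε σ (z + s • v) i)
        (∑ I, minkowskiCoeff ε I * ratioDeriv σ z v I i + v (treeRoot σ)) 0 := by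
      unfold chartMap minkowskiMap
      refine HasDerivAt.add (HasDerivAt.fun_sum fun I _ =>
        (hasDerivAt_ratioChart hz v I i).const_mul _) ?_
      simpa using (((hasDerivAt_id (0 : ℝ)).mul_const (v (treeRoot σ))).const_add
        (z (treeRoot σ))).sub_const 1
    exact h2.unique (hasDerivAt_pi.1 h1 i)
  refine ⟨(LinearEquiv.ofInjectiveEndo _ hinj).toContinuousLinearEquiv, ?_⟩
  convert hd using 1
  exact ContinuousLinearMap.ext fun v => rfl

theorem sum_chartMap {z : Fin (n + 1) → ℝ} (hz : z ∈ quadrant (n + 1)) :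
    ∑ i, chartMap ε σ z i = 1 + (n + 1) * (z (treeRoot σ) - 1) := by
  unfold chartMap
  rw [Finset.sum_add_distrib, (isDistFamily_ratioChart hz).sum_minkowskiMap_univ]
  simp only [Finset.sum_const, Finset.card_univ, Fintype.card_fin, nsmul_eq_mul, Nat.cast_add,
    Nat.cast_one]

theorem chartMap_of_root {z : Fin (n + 1) → ℝ} (h : z (treeRoot σ) = 1) :
    chartMap ε σ z = minkowskiMap ε (ratioChart σ z) := by
  funext i; simp [chartMap, h]

/-- The interior of the associahedron in its affine span. -/
def associahedronInterior (n : ℕ) (ε : Finset (Fin (n + 1)) → ℝ) : Set (Fin (n + 1) → ℝ) :=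
  {x | ∑ i, x i = 1 ∧ ∀ S, IsFacet S → faceDepth ε S < ∑ i ∈ S, x i}

theorem convex_associahedronInterior : Convex ℝ (associahedronInterior n ε) := by
  rintro x ⟨hx1, hx2⟩ y ⟨hy1, hy2⟩ a b ha hb hab
  have hsum : ∀ S : Finset (Fin (n + 1)), ∑ i ∈ S, (a • x + b • y) i =
      a * ∑ i ∈ S, x i + b * ∑ i ∈ S, y i := by
    intro S
    simp [Finset.sum_add_distrib, Finset.mul_sum]
  refine ⟨by rw [hsum, hx1, hy1, mul_one, mul_one, hab], fun S hS => ?_⟩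
  rw [hsum]
  have h1 := hx2 S hS
  have h2 := hy2 S hS
  rcases ha.eq_or_lt with rfl | ha
  · rw [zero_add] at hab
    subst hab
    simpa using h2
  · have := mul_lt_mul_of_pos_left h1 ha
    have := mul_le_mul_of_nonneg_left h2.le hb
    have e : faceDepth ε S = a * faceDepth ε S + b * faceDepth ε S := by rw [← add_mul, hab, one_mul]
    linarith

theorem convex_associahedron : Convex ℝ (associahedron n ε) := by
  intro x hx y hy a b ha hb hab
  rw [mem_associahedron_iff] at *
  have hsum : ∀ S : Finset (Fin (n + 1)), ∑ i ∈ S, (a • x + b • y) i =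
      a * ∑ i ∈ S, x i + b * ∑ i ∈ S, y i := by
    intro S
    simp [Finset.sum_add_distrib, Finset.mul_sum]
  refine ⟨by rw [hsum, hx.1, hy.1, mul_one, mul_one, hab], fun S hS => ?_⟩
  rw [hsum]
  have := mul_le_mul_of_nonneg_left (hx.2 S hS) ha
  have := mul_le_mul_of_nonneg_left (hy.2 S hS) hb
  have e : faceDepth ε S = a * faceDepth ε S + b * faceDepth ε S := by rw [← add_mul, hab, one_mul]
  linarith

theorem isClosed_associahedron : IsClosed (associahedron n ε) := by
  have : associahedron n ε =
      {x | ∑ i, x i = 1 ∧ ∀ S, IsFacet S → faceDepth ε S ≤ ∑ i ∈ S, x i} := by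
    ext x; exact mem_associahedron_iff
  rw [this]
  simp only [ofPred_and, ofPred_forall]
  exact (isClosed_eq (by fun_prop) continuous_const).inter (isClosed_iInter fun S =>
    isClosed_iInter fun _ => isClosed_le continuous_const (by fun_prop))

theorem mapsTo_minkowskiMap (hε : IsTruncationDepth ε) :
    MapsTo (minkowskiMap ε) (ratioClosure n) (associahedron n ε) :=
  fun _ hr => (isDistFamily_of_mem hr).minkowskiMap_mem hε

/-- A tight facet would force a chart coordinate to vanish, whereas those of a positive vector are
positive in every chart; any permutation serves. -/
theorem minkowskiMap_ratioFamily_mem (hε : IsTruncationDepth ε) {t : Fin (n + 1) → ℝ}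
    (ht : t ∈ posVec n) : minkowskiMap ε (ratioFamily t) ∈ associahedronInterior n ε := by
  have h1 := mem_associahedron_iff.1 ((isDistFamily_ratioFamily ht).minkowskiMap_mem hε)
  refine ⟨h1.1, fun S hS => lt_of_le_of_ne (h1.2 S hS) fun h => ?_⟩
  have hz := ratioCoord_pos (σ := Equiv.refl _) ht
  rw [← ratioChart_ratioCoord_ratioFamily (σ := Equiv.refl _) ht] at h
  obtain ⟨k, -, hk⟩ := (sum_minkowskiMap_ratioChart_eq_iff hε (posVec_subset_quadrant hz) hS).1 h.symm
  exact (hz k).ne' hk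

/-- The interior is connected and meets the image of the positive vectors. That image is open by the
inverse function theorem. It is relatively closed because a limit point comes from some point of R,
and if no facet is tight, none of its coordinates away from the root vanishes. -/
theorem associahedronInterior_subset_image (hε : IsTruncationDepth ε) :
    associahedronInterior n ε ⊆ minkowskiMap ε '' (ratioFamily '' posVec n) := by
  set σ : Equiv.Perm (Fin (n + 1)) := Equiv.refl _
  have hpos : ∀ z ∈ posVec n, ratioChart σ z ∈ ratioFamily '' posVec n := by
    intro z hz
    rw [ratioChart_eq_ratioFamily hz]
    exact mem_image_of_mem _ fun i => Finset.prod_pos fun k _ => hz k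
  have hopen : IsOpen (posVec n) := by
    simp only [posVec, ofPred_forall]
    exact isOpen_iInter_of_finite fun p => isOpen_lt continuous_const (by fun_prop)
  have huo : IsOpen (chartMap ε σ '' posVec n) := by
    rw [isOpen_iff_mem_nhds]
    rintro _ ⟨z, hz, rfl⟩
    have hzq := posVec_subset_quadrant hz
    obtain ⟨f', hf'⟩ := exists_hasFDerivAt_chartMap (σ := σ) hε hzq
    have hs := (contDiffAt_chartMap (ε := ε) (σ := σ) hzq).hasStrictFDerivAt' hf' (by simp)
    rw [← hs.map_nhds_eq_of_equiv]
    exact Filter.image_mem_map (hopen.mem_nhds hz)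
  have hroot : ∀ z ∈ posVec n, ∑ i, chartMap ε σ z i = 1 → z (treeRoot σ) = 1 := by
    intro z hz h
    rw [sum_chartMap (posVec_subset_quadrant hz), add_eq_left] at h
    have := (mul_eq_zero.1 h).resolve_left (by positivity)
    linarith
  have hsub : associahedronInterior n ε ⊆ chartMap ε σ '' posVec n := by
    refine convex_associahedronInterior.isPreconnected.subset_of_closure_inter_subset huo ?_ ?_
    · have ht : (fun _ => 1 : Fin (n + 1) → ℝ) ∈ posVec n := fun _ => one_pos
      refine ⟨_, minkowskiMap_ratioFamily_mem hε ht, ratioCoord σ (ratioFamily fun _ => 1),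
        ratioCoord_pos ht, ?_⟩
      rw [chartMap_of_root (by simp [ratioCoord]), ratioChart_ratioCoord_ratioFamily ht]
    · rintro x ⟨hx, hx1, hx2⟩
      have hcl : x ∈ minkowskiMap ε '' ratioClosure n := by
        have hK : IsClosed (minkowskiMap ε '' ratioClosure n) :=
          (isCompact_ratioClosure.image (continuous_minkowskiMap ε)).isClosed
        -- Projection to the hyperplane of coordinate sum 1, which removes the contribution of the
        -- dummy root variable.
        let p : (Fin (n + 1) → ℝ) → Fin (n + 1) → ℝ :=
          fun x i => x i - ((∑ i, x i) - 1) / (n + 1)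
        have hp : Continuous p := by fun_prop
        have hpx : p x = x := by funext i; simp [p, hx1]
        rw [← hpx]
        refine hK.closure_subset_iff.2 ?_ (mem_closure_image hp.continuousAt hx)
        rintro _ ⟨_, ⟨z, hz, rfl⟩, rfl⟩
        refine ⟨ratioChart σ z, ratioChart_mem (posVec_subset_quadrant hz), ?_⟩
        funext i
        simp only [p]
        rw [sum_chartMap (posVec_subset_quadrant hz), chartMap]
        field_simp
        ring
      obtain ⟨r, hr, rfl⟩ := hcl
      obtain ⟨τ, z, hz, -, rfl⟩ := exists_ratioChart hr
      have hzpos : ∀ k, k ≠ treeRoot τ → 0 < z k := by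
        intro k hk
        refine lt_of_le_of_ne (hz k) fun h => ?_
        have hF : IsFacet (treeIv τ k) := ⟨isIv_treeIv k, fun h => hk (treeIv_eq_univ_iff.1 h)⟩
        exact (hx2 _ hF).ne' ((sum_minkowskiMap_ratioChart_eq_iff hε hz hF).2 ⟨k, rfl, h.symm⟩)
      -- The root variable does not enter the chart and may be set to 1.
      have hz' : Function.update z (treeRoot τ) 1 ∈ posVec n := by
        intro k
        by_cases hk : k = treeRoot τ
        · subst hk; simp
        · rw [Function.update_of_ne hk]; exact hzpos k hk
      have e1 : ratioChart τ z = ratioChart τ (Function.update z (treeRoot τ) 1) :=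
        ratioChart_congr fun k hk => by rw [Function.update_of_ne hk]
      rw [e1, ratioChart_eq_ratioFamily hz']
      set t : Fin (n + 1) → ℝ := fun i => ∏ k ∈ Finset.univ.filter (fun k => i ∈ treeIv τ k),
        Function.update z (treeRoot τ) 1 k
      have ht : t ∈ posVec n := fun i => Finset.prod_pos fun k _ => hz' k
      refine ⟨ratioCoord σ (ratioFamily t), ratioCoord_pos ht, ?_⟩
      rw [chartMap_of_root (by simp [ratioCoord]), ratioChart_ratioCoord_ratioFamily ht]
  intro x hx
  obtain ⟨z, hz, rfl⟩ := hsub hx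
  rw [chartMap_of_root (hroot z hz hx.1)]
  exact mem_image_of_mem _ (hpos z hz)

theorem associahedron_subset_closure (hε : IsTruncationDepth ε) :
    associahedron n ε ⊆ closure (associahedronInterior n ε) := by
  intro x hx
  have h0 : minkowskiMap ε (ratioFamily fun _ => 1) ∈ associahedronInterior n ε :=
    minkowskiMap_ratioFamily_mem hε fun _ => one_pos
  set y := minkowskiMap ε (ratioFamily fun _ => 1) with hy
  rw [mem_associahedron_iff] at hx
  have hc : Filter.Tendsto (fun s : ℝ => x + s • (y - x)) (𝓝[>] 0) (𝓝 x) := by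
    have : Continuous fun s : ℝ => x + s • (y - x) := by fun_prop
    have h2 := this.tendsto 0
    simp only [zero_smul, add_zero] at h2
    exact h2.mono_left nhdsWithin_le_nhds
  refine mem_closure_of_tendsto hc ?_
  filter_upwards [Ioo_mem_nhdsGT (show (0 : ℝ) < 1 by norm_num)] with s hs
  have hsum : ∀ S : Finset (Fin (n + 1)), ∑ i ∈ S, (x + s • (y - x)) i =
      (1 - s) * ∑ i ∈ S, x i + s * ∑ i ∈ S, y i := by
    intro S
    simp only [Pi.add_apply, Pi.smul_apply, Pi.sub_apply, smul_eq_mul, Finset.sum_add_distrib,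
      ← Finset.mul_sum, Finset.sum_sub_distrib]
    ring
  refine ⟨by rw [hsum, hx.1, h0.1]; ring, fun S hS => ?_⟩
  rw [hsum]
  have h1 := mul_le_mul_of_nonneg_left (hx.2 S hS) (by linarith [hs.2] : 0 ≤ 1 - s)
  have h2 := mul_lt_mul_of_pos_left (h0.2 S hS) hs.1
  linarith

theorem image_minkowskiMap (hε : IsTruncationDepth ε) :
    minkowskiMap ε '' ratioClosure n = associahedron n ε := by
  refine Subset.antisymm (mapsTo_minkowskiMap hε).image_subset ?_
  refine (associahedron_subset_closure hε).trans ?_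
  have hK : IsClosed (minkowskiMap ε '' ratioClosure n) :=
    (isCompact_ratioClosure.image (continuous_minkowskiMap ε)).isClosed
  exact hK.closure_subset_iff.2
    ((associahedronInterior_subset_image hε).trans (image_mono subset_closure))

/-- Compactness and injectivity give a continuous inverse `g`. Near `x` it coincides on the
associahedron with `ratioChart σ ∘ h`, where `h` is the local inverse of the extended chart map, and
this composite is smooth on an ambient neighbourhood. -/
theorem isDiffeoOn_minkowskiMap (hε : IsTruncationDepth ε) :
    IsDiffeoOn (minkowskiMap ε) (ratioClosure n) (associahedron n ε) := by
  obtain ⟨g, hgm, hgc, hinv⟩ := exists_continuousOn_inverse isCompact_ratioClosure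
    (continuous_minkowskiMap ε).continuousOn (injOn_minkowskiMap hε) (image_minkowskiMap hε)
  refine ⟨mapsTo_minkowskiMap hε,
    isSmoothOnSet_of_forall_contDiffAt fun r _ => (contDiff_minkowskiMap ε).contDiffAt, g, hgm,
    isSmoothOnSet_of_contDiffAt fun x hx => ?_, hinv⟩
  obtain ⟨σ, z, hz, hroot, hzr⟩ := exists_ratioChart (hgm hx)
  obtain ⟨f', hf'⟩ := exists_hasFDerivAt_chartMap (σ := σ) hε hz
  have hcd := contDiffAt_chartMap (ε := ε) (σ := σ) hz
  have hx0 : chartMap ε σ z = x := by rw [chartMap_of_root hroot, hzr, hinv.2 hx]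
  set h := hcd.localInverse hf' (by simp) with hh
  have hhc : ContDiffAt ℝ ω h x := by
    have := hcd.to_localInverse hf' (by simp)
    rwa [hx0] at this
  have hhx : h x = z := by
    rw [← hx0]
    exact hcd.localInverse_apply_image hf' (by simp)
  have hleft : ∀ᶠ z' in 𝓝 z, h (chartMap ε σ z') = z' :=
    (hcd.hasStrictFDerivAt' hf' (by simp)).eventually_left_inverse
  refine ⟨ratioChart σ ∘ h, ?_, ?_⟩
  · refine ContDiffAt.comp x ?_ hhc
    rw [hhx]
    exact contDiffAt_ratioChart hz
  · have hdom : g x ∈ ratioDomain σ := by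
      rw [← hzr]
      exact fun p => ratioChart_self_pos hz p
    have hgx : Filter.Tendsto g (𝓝[associahedron n ε] x) (𝓝 (g x)) := hgc x hx
    have hzx : ratioCoord σ (g x) = z := by rw [← hzr, ratioCoord_ratioChart hz hroot]
    -- Continuity of `g` keeps the coordinates of `g y` near `z`, where `h` is a left inverse;
    -- injectivity on a neighbourhood alone would not suffice.
    have hcoord : Filter.Tendsto (fun x => ratioCoord σ (g x)) (𝓝[associahedron n ε] x) (𝓝 z) := by
      rw [← hzx]
      exact (continuousAt_ratioCoord hdom).tendsto.comp hgx
    filter_upwards [self_mem_nhdsWithin, hgx (isOpen_ratioDomain.mem_nhds hdom),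
      hcoord hleft] with y hy hyd hyl
    have e1 : ratioChart σ (ratioCoord σ (g y)) = g y := ratioChart_ratioCoord (hgm hy) hyd
    have e2 : chartMap ε σ (ratioCoord σ (g y)) = y := by
      rw [chartMap_of_root (by simp [ratioCoord]), e1, hinv.2 hy]
    have e3 : h (chartMap ε σ (ratioCoord σ (g y))) = ratioCoord σ (g y) := hyl
    rw [e2] at e3
    simp only [Function.comp]
    rw [e3, e1]

end MinkowskiDiffeo

/-! ## The compactified configuration spaces as closures of families of ratios -/

section ConfigurationRatios

variable {n : ℕ}

/-- The configuration with first point `0` and gaps `t`. -/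
def gapPoints (t : Fin (n + 1) → ℝ) (k : Fin (n + 2)) : ℝ :=
  ∑ l ∈ Finset.univ.filter (fun l : Fin (n + 1) => (l : ℕ) < k), t l

/-- The gaps between two points. -/
def gapSet (i j : Fin (n + 2)) : Finset (Fin (n + 1)) :=
  Finset.univ.filter fun l => min (i : ℕ) j ≤ l ∧ (l : ℕ) < max (i : ℕ) j

/-- The gaps in the hull of three points. -/
def gapHull (i j k : Fin (n + 2)) : Finset (Fin (n + 1)) :=
  Finset.univ.filter fun l =>
    min (min (i : ℕ) j) k ≤ l ∧ (l : ℕ) < max (max (i : ℕ) j) k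

theorem gapPoints_zero (t : Fin (n + 1) → ℝ) : gapPoints t 0 = 0 := by simp [gapPoints]

theorem gapPoints_last (t : Fin (n + 1) → ℝ) : gapPoints t (Fin.last (n + 1)) = ∑ l, t l := by
  unfold gapPoints
  rw [Finset.filter_true_of_mem]
  intro l _
  have := l.isLt
  rw [Fin.val_last]; omega

theorem gapPoints_sub (t : Fin (n + 1) → ℝ) {i j : Fin (n + 2)} (h : i ≤ j) :
    gapPoints t j - gapPoints t i = ∑ l ∈ gapSet i j, t l := by
  unfold gapPoints
  rw [sub_eq_iff_eq_add, ← Finset.sum_union]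
  · refine Finset.sum_congr ?_ fun _ _ => rfl
    ext l
    rw [Fin.le_def] at h
    simp only [gapSet, Finset.mem_filter, Finset.mem_univ, true_and, Finset.mem_union]
    omega
  · rw [gapSet, Finset.disjoint_filter]
    intro l _
    rw [Fin.le_def] at h
    omega

theorem gapPoints_succ_sub (t : Fin (n + 1) → ℝ) (l : Fin (n + 1)) :
    gapPoints t l.succ - gapPoints t l.castSucc = t l := by
  rw [gapPoints_sub t (Fin.castSucc_le_succ l)]
  have : gapSet l.castSucc l.succ = {l} := by
    ext m
    simp only [gapSet, Fin.val_castSucc, Fin.val_succ, Finset.mem_filter, Finset.mem_univ, true_and,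
      Finset.mem_singleton, Fin.ext_iff]
    omega
  rw [this, Finset.sum_singleton]

theorem gapSet_comm (i j : Fin (n + 2)) : gapSet i j = gapSet j i := by
  simp only [gapSet, min_comm (i : ℕ), max_comm (i : ℕ)]

theorem gapSet_nonempty {i j : Fin (n + 2)} (h : i ≠ j) : (gapSet i j).Nonempty := by
  have h' : (i : ℕ) ≠ j := fun e => h (Fin.ext e)
  refine ⟨⟨min i j, ?_⟩, ?_⟩
  · have := i.isLt; have := j.isLt; omega
  · simp only [gapSet, Finset.mem_filter, Finset.mem_univ, true_and]
    omega

theorem strictMono_gapPoints {t : Fin (n + 1) → ℝ} (ht : t ∈ posVec n) :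
    StrictMono (gapPoints t) := by
  intro i j h
  rw [← sub_pos, gapPoints_sub t h.le]
  exact sum_pos_of_posVec ht (gapSet_nonempty h.ne)

theorem norm_gapPoints_sub {t : Fin (n + 1) → ℝ} (ht : t ∈ posVec n) (i j : Fin (n + 2)) :
    ‖gapPoints t i - gapPoints t j‖ = ∑ l ∈ gapSet i j, t l := by
  rcases le_total i j with h | h
  · rw [norm_sub_rev, gapPoints_sub t h, Real.norm_of_nonneg]
    exact Finset.sum_nonneg fun l _ => (ht l).le
  · rw [gapPoints_sub t h, gapSet_comm, Real.norm_of_nonneg]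
    exact Finset.sum_nonneg fun l _ => (ht l).le

theorem eq_gapPoints (x : Fin (n + 2) → ℝ) (k : Fin (n + 2)) :
    gapPoints (fun l => x l.succ - x l.castSucc) k = x k - x 0 := by
  induction k using Fin.induction with
  | zero => simp [gapPoints_zero]
  | succ l ih =>
    have := gapPoints_succ_sub (fun l => x l.succ - x l.castSucc) l
    linarith

theorem isIv_gapHull {i j k : Fin (n + 2)} (h : i ≠ j) : IsIv (gapHull i j k) := by
  refine ⟨?_, fun a ha b hb c hac hcb => ?_⟩
  · obtain ⟨l, hl⟩ := gapSet_nonempty h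
    refine ⟨l, ?_⟩
    simp only [gapHull, gapSet, Finset.mem_filter, Finset.mem_univ, true_and] at hl ⊢
    omega
  · simp only [gapHull, Finset.mem_filter, Finset.mem_univ, true_and, Fin.lt_def] at *
    omega

theorem inter_gapHull_left (i j k : Fin (n + 2)) : gapHull i j k ∩ gapSet i j = gapSet i j := by
  ext l
  simp only [gapHull, gapSet, Finset.mem_filter, Finset.mem_univ, true_and, Finset.mem_inter]
  omega

theorem inter_gapHull_right (i j k : Fin (n + 2)) : gapHull i j k ∩ gapSet i k = gapSet i k := by
  ext l
  simp only [gapHull, gapSet, Finset.mem_filter, Finset.mem_univ, true_and, Finset.mem_inter]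
  omega

theorem gapHull_subset (i j k : Fin (n + 2)) : gapHull i j k ⊆ gapSet i j ∪ gapSet i k := by
  intro l
  simp only [gapHull, gapSet, Finset.mem_filter, Finset.mem_univ, true_and, Finset.mem_union]
  omega

/-- The coordinates of the compactified configuration space in terms of the ratios. -/
noncomputable def confOfRatios (r : Finset (Fin (n + 1)) → Fin (n + 1) → ℝ) :
    (Conf2 (n + 2) → ℝ) × (Conf3 (n + 2) → ℝ) :=
  (fun p => if p.1.1 < p.1.2 then -1 else 1, fun p =>
    (∑ l ∈ gapSet p.1.1 p.1.2.1, r (gapHull p.1.1 p.1.2.1 p.1.2.2) l) /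
      (∑ l ∈ gapSet p.1.1 p.1.2.1, r (gapHull p.1.1 p.1.2.1 p.1.2.2) l +
        ∑ l ∈ gapSet p.1.1 p.1.2.2, r (gapHull p.1.1 p.1.2.1 p.1.2.2) l))

theorem extCoord_div {a b : ℝ} (hb : b ≠ 0) : extCoord (a / b) = a / (a + b) := by
  unfold extCoord
  rcases eq_or_ne (a + b) 0 with h | h
  · have : 1 + a / b = 0 := by field_simp; linarith
    rw [this, h, div_zero, div_zero]
  · have : 1 + a / b = (a + b) / b := by field_simp; ring
    rw [this, div_div_div_cancel_right₀ hb]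

theorem unitDirection_of_strictMono {x : Fin (n + 2) → ℝ} (hx : StrictMono x)
    (p : Conf2 (n + 2)) : unitDirection x p = if p.1.1 < p.1.2 then -1 else 1 := by
  unfold unitDirection
  split_ifs with h
  · have := sub_neg.2 (hx h)
    rw [Real.norm_of_nonpos this.le, smul_eq_mul, inv_neg, neg_mul, inv_mul_cancel₀ this.ne]
  · have h1 : p.1.2 < p.1.1 := lt_of_le_of_ne (not_lt.1 h) p.2.symm
    have := sub_pos.2 (hx h1)
    rw [Real.norm_of_nonneg this.le, smul_eq_mul, inv_mul_cancel₀ this.ne']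

theorem confOfRatios_ratioFamily {t : Fin (n + 1) → ℝ} (ht : t ∈ posVec n) :
    confOfRatios (ratioFamily t) = iotaMap (n + 2) (gapPoints t) := by
  refine Prod.ext (funext fun p => ?_) (funext fun p => ?_)
  · exact (unitDirection_of_strictMono (strictMono_gapPoints ht) p).symm
  · obtain ⟨⟨i, j, k⟩, hij, hik, hjk⟩ := p
    have hI := isIv_gapHull (k := k) hij
    have h0 := (sum_pos_of_posVec ht hI.1).ne'
    simp only [confOfRatios, iotaMap, distanceRatio, norm_gapPoints_sub ht,
      sum_ratioFamily t hI, inter_gapHull_left, inter_gapHull_right]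
    rw [extCoord_div (sum_pos_of_posVec ht (gapSet_nonempty hik)).ne', ← add_div,
      div_div_div_cancel_right₀ h0]

/-- The gaps from `i` to `j` and from `i` to `k` together cover the hull, so the denominator is at
least the total mass 1. -/
theorem contDiffAt_confOfRatios {r : Finset (Fin (n + 1)) → Fin (n + 1) → ℝ}
    (hr : r ∈ ratioClosure n) : ContDiffAt ℝ ω confOfRatios r := by
  refine contDiffAt_const.prodMk (contDiffAt_pi.2 fun p => ?_)
  obtain ⟨⟨i, j, k⟩, hij, hik, hjk⟩ := p
  refine ContDiffAt.div (by fun_prop) (by fun_prop) (ne_of_gt ?_)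
  have hI := isIv_gapHull (k := k) hij
  have hd := isDistFamily_of_mem hr
  have h1 := hd.sum_eq_one hI (gapHull_subset i j k)
  have h2 := Finset.sum_union_inter (s₁ := gapSet i j) (s₂ := gapSet i k)
    (f := r (gapHull i j k))
  have h3 : 0 ≤ ∑ l ∈ gapSet i j ∩ gapSet i k, r (gapHull i j k) l :=
    Finset.sum_nonneg fun l _ => (hd _ hI).1 l
  simp only
  linarith

/-- The relative position of the point `j` in the interval from `a` to `b`. -/
noncomputable def relPosition (c : (Conf2 (n + 2) → ℝ) × (Conf3 (n + 2) → ℝ))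
    (a j b : Fin (n + 2)) : ℝ :=
  if h : a < j ∧ j < b then
    c.2 ⟨(a, j, b), h.1.ne, (h.1.trans h.2).ne, h.2.ne⟩ /
      (1 - c.2 ⟨(a, j, b), h.1.ne, (h.1.trans h.2).ne, h.2.ne⟩)
  else if j = b then 1 else 0

/-- The ratios in terms of the coordinates of the compactified configuration space. -/
noncomputable def ratiosOfConf (c : (Conf2 (n + 2) → ℝ) × (Conf3 (n + 2) → ℝ)) :
    Finset (Fin (n + 1)) → Fin (n + 1) → ℝ :=
  fun I i => if h : IsIv I ∧ i ∈ I then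
    relPosition c (I.min' h.1.1).castSucc i.succ (I.max' h.1.1).succ -
      relPosition c (I.min' h.1.1).castSucc i.castSucc (I.max' h.1.1).succ
  else 0

/-- Between the end points, `u / (1 - u)` undoes `extCoord`. At the end points there is no triple of
distinct indices, and the values 0 and 1 are supplied by the remaining branches. -/
theorem relPosition_iotaMap {t : Fin (n + 1) → ℝ} (ht : t ∈ posVec n) {a j b : Fin (n + 2)}
    (haj : a ≤ j) (hjb : j ≤ b) (hab : a < b) :
    relPosition (iotaMap (n + 2) (gapPoints t)) a j b =
      (gapPoints t j - gapPoints t a) / (gapPoints t b - gapPoints t a) := by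
  have hm := strictMono_gapPoints ht
  have hba : gapPoints t b - gapPoints t a ≠ 0 := (sub_pos.2 (hm hab)).ne'
  unfold relPosition
  split_ifs with h h1
  · simp only [iotaMap, distanceRatio]
    rw [norm_sub_rev, norm_sub_rev (gapPoints t a),
      Real.norm_of_nonneg (sub_pos.2 (hm h.1)).le, Real.norm_of_nonneg (sub_pos.2 (hm hab)).le,
      extCoord_div hba]
    have h1 := sub_pos.2 (hm h.1)
    have h2 := sub_pos.2 (hm hab)
    have h3 : (gapPoints t j - gapPoints t a) + (gapPoints t b - gapPoints t a) ≠ 0 := by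
      linarith
    rw [one_sub_div h3, div_div_div_cancel_right₀ h3, add_sub_cancel_left]
  · rw [h1, div_self hba]
  · have : j = a := by
      rcases haj.eq_or_lt with h2 | h2
      · exact h2.symm
      · exact absurd ⟨h2, lt_of_le_of_ne hjb h1⟩ h
    rw [this, sub_self, zero_div]

/-- The share of gap `i` in the interval `I` is the difference of the relative positions of its two
ends between the ends of `I`. -/
theorem ratiosOfConf_iotaMap {t : Fin (n + 1) → ℝ} (ht : t ∈ posVec n) :
    ratiosOfConf (iotaMap (n + 2) (gapPoints t)) = ratioFamily t := by
  funext I i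
  simp only [ratiosOfConf, ratioFamily]
  split_ifs with h
  · have h1 := I.min'_le i h.2
    have h2 := I.le_max' i h.2
    have hab : (I.min' h.1.1).castSucc < (I.max' h.1.1).succ := by
      rw [Fin.lt_def, Fin.val_castSucc, Fin.val_succ]
      rw [Fin.le_def] at h1 h2
      omega
    rw [relPosition_iotaMap ht _ _ hab, relPosition_iotaMap ht _ _ hab, ← sub_div,
      sub_sub_sub_cancel_right, gapPoints_succ_sub, gapPoints_sub t hab.le]
    · congr 2
      ext l
      simp only [gapSet, Finset.mem_filter, Finset.mem_univ, true_and, Fin.val_castSucc,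
        Fin.val_succ]
      constructor
      · intro hl
        have h3 := hl
        refine h.1.mem_of_le (I.min'_mem h.1.1) (I.max'_mem h.1.1) ?_ ?_ <;>
          rw [Fin.le_def] at * <;> omega
      · intro hl
        have h3 := I.min'_le l hl
        have h4 := I.le_max' l hl
        rw [Fin.le_def] at *
        omega
    all_goals
      simp only [Fin.le_def, Fin.val_castSucc, Fin.val_succ] at *
      omega
  · rfl

/-- For `a < j < b` the distance ratio is at most 1, so its compactified coordinate is at most `1 /
2`, and `1 - u` stays away from zero; the bound passes to the closure. -/
theorem contDiffAt_ratiosOfConf {c : (Conf2 (n + 2) → ℝ) × (Conf3 (n + 2) → ℝ)}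
    (hc : ∀ a j b : Fin (n + 2), ∀ h : a < j ∧ j < b,
      c.2 ⟨(a, j, b), h.1.ne, (h.1.trans h.2).ne, h.2.ne⟩ ≤ 1 / 2) :
    ContDiffAt ℝ ω ratiosOfConf c := by
  have hpos : ∀ a j b : Fin (n + 2), ContDiffAt ℝ ω (fun c => relPosition c a j b) c := by
    intro a j b
    unfold relPosition
    split_ifs with h
    · have := hc a j b h
      exact ContDiffAt.div (by fun_prop) (by fun_prop) (by linarith)
    · exact contDiffAt_const
    · exact contDiffAt_const
  refine contDiffAt_pi.2 fun I => contDiffAt_pi.2 fun i => ?_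
  unfold ratiosOfConf
  split_ifs with h
  · exact (hpos _ _ _).sub (hpos _ _ _)
  · exact contDiffAt_const

theorem le_half_of_mem_closure {c : (Conf2 (n + 2) → ℝ) × (Conf3 (n + 2) → ℝ)}
    (hc : c ∈ closure ((fun t => iotaMap (n + 2) (gapPoints t)) '' posVec n))
    (a j b : Fin (n + 2)) (h : a < j ∧ j < b) :
    c.2 ⟨(a, j, b), h.1.ne, (h.1.trans h.2).ne, h.2.ne⟩ ≤ 1 / 2 := by
  have hcl : IsClosed {c : (Conf2 (n + 2) → ℝ) × (Conf3 (n + 2) → ℝ) |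
      c.2 ⟨(a, j, b), h.1.ne, (h.1.trans h.2).ne, h.2.ne⟩ ≤ 1 / 2} :=
    isClosed_le (by fun_prop) continuous_const
  refine closure_minimal ?_ hcl hc
  rintro _ ⟨t, ht, rfl⟩
  have hm := strictMono_gapPoints ht
  have h1 := sub_pos.2 (hm h.1)
  have h2 := sub_pos.2 (hm (h.1.trans h.2))
  have h3 := hm h.2
  simp only [iotaMap, distanceRatio, mem_ofPred_eq]
  rw [norm_sub_rev, norm_sub_rev (gapPoints t a), Real.norm_of_nonneg h1.le,
    Real.norm_of_nonneg h2.le, extCoord_div h2.ne', div_le_div_iff₀ (by linarith) (by norm_num)]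
  linarith

theorem iotaMap_affine {x : Fin (n + 2) → ℝ} {c : ℝ} (hc : 0 < c) (d : ℝ) :
    iotaMap (n + 2) (fun i => c * x i + d) = iotaMap (n + 2) x := by
  have hn : ∀ i j, ‖(c * x i + d) - (c * x j + d)‖ = c * ‖x i - x j‖ := by
    intro i j
    rw [add_sub_add_right_eq_sub, ← mul_sub, norm_mul, Real.norm_of_nonneg hc.le]
  refine Prod.ext (funext fun p => ?_) (funext fun p => ?_)
  · simp only [iotaMap, unitDirection, hn, smul_eq_mul]
    rw [add_sub_add_right_eq_sub, ← mul_sub, mul_inv]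
    field_simp
  · simp only [iotaMap, distanceRatio, hn]
    rw [mul_div_mul_left _ _ hc.ne']

theorem gaps_mem_posVec {x : Fin (n + 2) → ℝ} (hx : StrictMono x) :
    (fun l : Fin (n + 1) => x l.succ - x l.castSucc) ∈ posVec n :=
  fun _ => sub_pos.2 (hx Fin.castSucc_lt_succ)

theorem iotaMap_gaps (x : Fin (n + 2) → ℝ) :
    iotaMap (n + 2) (gapPoints fun l => x l.succ - x l.castSucc) = iotaMap (n + 2) x := by
  rw [← iotaMap_affine (x := x) one_pos (-x 0)]
  congr 1
  funext k
  rw [eq_gapPoints]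
  ring

theorem image_confTilde : iotaMap (n + 2) '' {x | x ∈ confTilde (n + 2) ℝ ∧ StrictMono x} =
    (fun t => iotaMap (n + 2) (gapPoints t)) '' posVec n := by
  refine Subset.antisymm ?_ ?_
  · rintro _ ⟨x, ⟨-, hx⟩, rfl⟩
    exact ⟨_, gaps_mem_posVec hx, iotaMap_gaps x⟩
  · rintro _ ⟨t, ht, rfl⟩
    have hm := strictMono_gapPoints ht
    -- Subtracting the mean and dividing by the maximum norm produces the normalized representative.
    set m : ℝ := (∑ i, gapPoints t i) / (n + 2) with hmdef
    set y : Fin (n + 2) → ℝ := fun i => gapPoints t i - m with hy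
    have hy0 : y ≠ 0 := by
      intro h
      have h1 := congrFun h 0
      have h2 := congrFun h (Fin.last (n + 1))
      have h3 := hm (Fin.last_pos : (0 : Fin (n + 2)) < Fin.last (n + 1))
      simp only [hy, Pi.zero_apply] at h1 h2
      linarith
    have hpos : 0 < ‖y‖⁻¹ := inv_pos.2 (norm_pos_iff.2 hy0)
    have hform : (fun i => ‖y‖⁻¹ * gapPoints t i + -(‖y‖⁻¹ * m)) = ‖y‖⁻¹ • y := by
      funext i
      simp only [hy, Pi.smul_apply, smul_eq_mul]
      ring
    have hsm : StrictMono (‖y‖⁻¹ • y) := by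
      intro i j hij
      have := hm hij
      simp only [hy, Pi.smul_apply, smul_eq_mul]
      exact mul_lt_mul_of_pos_left (by linarith) hpos
    refine ⟨‖y‖⁻¹ • y, ⟨⟨hsm.injective, ?_, ?_⟩, hsm⟩, ?_⟩
    · simp only [Pi.smul_apply, smul_eq_mul, ← Finset.mul_sum]
      have : ∑ i, y i = 0 := by
        simp only [hy, Finset.sum_sub_distrib, Finset.sum_const, Finset.card_univ, Fintype.card_fin,
          nsmul_eq_mul, hmdef]
        push_cast
        field_simp
        ring
      rw [this, mul_zero]
    · rw [norm_smul, norm_inv, norm_norm, inv_mul_cancel₀ (norm_ne_zero_iff.2 hy0)]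
    · rw [← hform, iotaMap_affine hpos]

theorem extCoord_mem_Icc {s : ℝ} (hs : 0 ≤ s) : extCoord s ∈ Icc (0 : ℝ) 1 := by
  unfold extCoord
  exact ⟨by positivity, div_le_one_of_le₀ (by linarith) (by positivity)⟩

theorem norm_unitDirection {x : Fin (n + 2) → ℝ} (hx : Function.Injective x) (p : Conf2 (n + 2)) :
    ‖unitDirection x p‖ = 1 := by
  have : x p.1.1 - x p.1.2 ≠ 0 := sub_ne_zero.2 fun h => p.2 (hx h)
  rw [unitDirection, norm_smul, norm_inv, norm_norm, inv_mul_cancel₀ (norm_ne_zero_iff.2 this)]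

theorem iotaMap_mem_ambient {x : Fin (n + 2) → ℝ} (hx : Function.Injective x) :
    iotaMap (n + 2) x ∈ ambientTildeA (n + 2) ℝ :=
  ⟨norm_unitDirection hx, fun _ => extCoord_mem_Icc (div_nonneg (norm_nonneg _) (norm_nonneg _))⟩

theorem isClosed_ambientTildeA : IsClosed (ambientTildeA (n + 2) ℝ) := by
  simp only [ambientTildeA, ofPred_and, ofPred_forall, mem_Icc]
  refine (isClosed_iInter fun p => isClosed_eq (by fun_prop) continuous_const).inter
    (isClosed_iInter fun p => (isClosed_le continuous_const (by fun_prop)).inter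
      (isClosed_le (by fun_prop) continuous_const))

/-- The ambient product is closed, so intersecting with it changes nothing. -/
theorem confTildeCompactOrdered_eq : confTildeCompactOrdered (n + 2) =
    closure ((fun t => iotaMap (n + 2) (gapPoints t)) '' posVec n) := by
  unfold confTildeCompactOrdered closureIn
  rw [image_confTilde, inter_eq_left]
  refine closure_minimal ?_ isClosed_ambientTildeA
  rintro _ ⟨t, ht, rfl⟩
  exact iotaMap_mem_ambient (strictMono_gapPoints ht).injective

theorem isDiffeoOn_confOfRatios :
    IsDiffeoOn confOfRatios (ratioClosure n) (confTildeCompactOrdered (n + 2)) := by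
  rw [confTildeCompactOrdered_eq]
  exact isDiffeoOn_closure (g := ratiosOfConf) (fun _ hr => contDiffAt_confOfRatios hr)
    (fun _ hc => contDiffAt_ratiosOfConf (le_half_of_mem_closure hc))
    (fun _ ht => confOfRatios_ratioFamily ht) fun _ ht => ratiosOfConf_iotaMap ht

/-- The points of the unit interval in terms of the ratios. -/
def pointsOfRatios (r : Finset (Fin (n + 1)) → Fin (n + 1) → ℝ) (k : Fin (n + 2)) : ℝ :=
  gapPoints (r Finset.univ) k

theorem pointsOfRatios_ratioFamily (t : Fin (n + 1) → ℝ) (k : Fin (n + 2)) :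
    pointsOfRatios (ratioFamily t) k = gapPoints t k / ∑ l, t l := by
  unfold pointsOfRatios gapPoints
  rw [sum_ratioFamily t isIv_univ, Finset.univ_inter]

/-- With end points 0 and 1 the points are the normalized partial sums of the gaps, that is, of the
distribution on the full interval. -/
theorem image_confInterval :
    alphaMap (n + 2) '' {x | x ∈ confSpace (n + 2) (Icc (0 : ℝ) 1) ∧
      x 0 = 0 ∧ x (Fin.last (n + 1)) = 1 ∧ StrictMono x} =
    (fun t => (pointsOfRatios (ratioFamily t), iotaMap (n + 2) (gapPoints t))) '' posVec n := by
  refine Subset.antisymm ?_ ?_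
  · rintro _ ⟨x, ⟨-, h0, h1, hx⟩, rfl⟩
    refine ⟨_, gaps_mem_posVec hx, Prod.ext (funext fun k => ?_) (iotaMap_gaps x)⟩
    change pointsOfRatios (ratioFamily _) k = x k
    rw [pointsOfRatios_ratioFamily, ← gapPoints_last, eq_gapPoints, eq_gapPoints, h0, h1]
    simp
  · rintro _ ⟨t, ht, rfl⟩
    have hs : 0 < ∑ l, t l := sum_pos_of_posVec ht Finset.univ_nonempty
    have hm : StrictMono (pointsOfRatios (ratioFamily t)) := by
      intro i j hij
      rw [pointsOfRatios_ratioFamily, pointsOfRatios_ratioFamily]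
      exact div_lt_div_of_pos_right (strictMono_gapPoints ht hij) hs
    have h0 : pointsOfRatios (ratioFamily t) 0 = 0 := by
      rw [pointsOfRatios_ratioFamily, gapPoints_zero, zero_div]
    have h1 : pointsOfRatios (ratioFamily t) (Fin.last (n + 1)) = 1 := by
      rw [pointsOfRatios_ratioFamily, gapPoints_last, div_self hs.ne']
    refine ⟨pointsOfRatios (ratioFamily t), ⟨⟨fun i => ⟨?_, ?_⟩, hm.injective⟩, h0, h1, hm⟩, ?_⟩
    · rw [← h0]; exact hm.monotone (Fin.zero_le i)
    · rw [← h1]; exact hm.monotone (Fin.le_last i)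
    · refine Prod.ext rfl ?_
      change iotaMap (n + 2) (pointsOfRatios (ratioFamily t)) = iotaMap (n + 2) (gapPoints t)
      rw [← iotaMap_affine (x := gapPoints t) (inv_pos.2 hs) 0]
      congr 1
      funext k
      rw [pointsOfRatios_ratioFamily]
      ring

theorem isClosed_ambientA : IsClosed (ambientA (n + 2) (Icc (0 : ℝ) 1)) := by
  simp only [ambientA, ofPred_and, ofPred_forall, mem_Icc]
  refine (isClosed_iInter fun p => (isClosed_le continuous_const (by fun_prop)).inter
    (isClosed_le (by fun_prop) continuous_const)).inter
    ((isClosed_iInter fun p => isClosed_eq (by fun_prop) continuous_const).inter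
    (isClosed_iInter fun p => (isClosed_le continuous_const (by fun_prop)).inter
      (isClosed_le (by fun_prop) continuous_const)))

theorem confIntervalCompactOrdered_eq : confIntervalCompactOrdered n =
    closure ((fun t => (pointsOfRatios (ratioFamily t), iotaMap (n + 2) (gapPoints t))) ''
      posVec n) := by
  unfold confIntervalCompactOrdered closureIn confCompact closureIn
  rw [← image_confInterval, inter_eq_left]
  have hsub : alphaMap (n + 2) '' {x | x ∈ confSpace (n + 2) (Icc (0 : ℝ) 1) ∧
      x 0 = 0 ∧ x (Fin.last (n + 1)) = 1 ∧ StrictMono x} ⊆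
      alphaMap (n + 2) '' confSpace (n + 2) (Icc (0 : ℝ) 1) := image_mono fun x hx => hx.1
  refine subset_inter (closure_mono hsub) (closure_minimal ?_ isClosed_ambientA)
  rintro _ ⟨x, ⟨hx, -⟩, rfl⟩
  exact ⟨hx.1, iotaMap_mem_ambient hx.2⟩

/-- The positions in the unit interval are linear in the ratios, so they add no information: the
inverse simply forgets them. -/
theorem isDiffeoOn_intervalOfRatios :
    IsDiffeoOn (fun r => (pointsOfRatios r, confOfRatios r)) (ratioClosure n)
      (confIntervalCompactOrdered n) := by
  rw [confIntervalCompactOrdered_eq]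
  refine isDiffeoOn_closure (g := fun c => ratiosOfConf c.2) (fun r hr => ?_) (fun c hc => ?_)
    (fun t ht => ?_) fun t ht => ratiosOfConf_iotaMap ht
  · refine ContDiffAt.prodMk ?_ (contDiffAt_confOfRatios hr)
    refine contDiffAt_pi.2 fun k => ?_
    unfold pointsOfRatios gapPoints
    fun_prop
  · refine ContDiffAt.comp (g := ratiosOfConf) c (contDiffAt_ratiosOfConf ?_) contDiffAt_snd
    refine le_half_of_mem_closure ?_
    have := mem_closure_image (f := Prod.snd) continuous_snd.continuousAt hc
    rwa [image_image] at this
  · exact Prod.ext rfl (confOfRatios_ratioFamily ht)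

end ConfigurationRatios

/-! ## The face structure of the associahedron -/

section Faces

variable {n : ℕ} {ε : Finset (Fin (n + 1)) → ℝ}

/-- The labels of the facets that contain a point. -/
def tightSet (ε : Finset (Fin (n + 1)) → ℝ) (x : Fin (n + 1) → ℝ) :
    Set (Finset (Fin (n + 1))) :=
  {S | IsFacet S ∧ ∑ i ∈ S, x i = faceDepth ε S}

/-- The points of the associahedron that lie precisely in the facets of `N`. -/
def faceSet (ε : Finset (Fin (n + 1)) → ℝ) (N : Set (Finset (Fin (n + 1)))) :
    Set (Fin (n + 1) → ℝ) :=
  {x | x ∈ associahedron n ε ∧ tightSet ε x = N}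

/-- Read off from a monomial chart at the preimage of the point, where only tree intervals can be
tight. -/
theorem exists_tightSet_subset (hε : IsTruncationDepth ε) {x : Fin (n + 1) → ℝ}
    (hx : x ∈ associahedron n ε) :
    ∃ σ : Equiv.Perm (Fin (n + 1)), tightSet ε x ⊆ range (treeIv σ) := by
  rw [← image_minkowskiMap hε] at hx
  obtain ⟨r, hr, rfl⟩ := hx
  obtain ⟨σ, z, hz, -, rfl⟩ := exists_ratioChart hr
  refine ⟨σ, fun S hS => ?_⟩
  obtain ⟨k, hk, -⟩ := (sum_minkowskiMap_ratioChart_eq_iff hε hz hS.1).1 hS.2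
  exact ⟨k, hk.symm⟩

-- Affine corner charts at the vertices.

variable (σ : Equiv.Perm (Fin (n + 1)))

/-- The sums of the coordinates over the intervals of a search tree. -/
def treeSum : (Fin (n + 1) → ℝ) →ₗ[ℝ] (Fin (n + 1) → ℝ) :=
  LinearMap.pi fun k => ∑ i ∈ treeIv σ k, LinearMap.proj i

theorem treeSum_apply (v : Fin (n + 1) → ℝ) (k : Fin (n + 1)) :
    treeSum σ v k = ∑ i ∈ treeIv σ k, v i := by simp [treeSum]

/-- The system is triangular: apart from `k`, the interval of `k` contains only labels of lower
priority. -/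
theorem treeSum_injective : Function.Injective (treeSum σ) := by
  rw [← LinearMap.ker_eq_bot, LinearMap.ker_eq_bot']
  intro v hv
  have key : ∀ c : ℕ, ∀ k, (σ k : ℕ) = c → v k = 0 := by
    intro c
    induction c using Nat.strong_induction_on with
    | _ c ih =>
    intro k hk
    have h := congrFun hv k
    rw [treeSum_apply, Finset.sum_eq_single_of_mem k (self_mem_treeIv k)] at h
    · exact h
    · intro j hj hjk
      have h1 := lt_of_le_of_ne (le_of_mem_treeIv hj) fun h => hjk (σ.injective h)
      exact ih _ (by rw [← hk]; exact h1) j rfl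
  funext k
  exact key _ k rfl

/-- The sums over the intervals of a search tree as a linear isomorphism. -/
noncomputable def treeSumEquiv : (Fin (n + 1) → ℝ) ≃L[ℝ] (Fin (n + 1) → ℝ) :=
  (LinearEquiv.ofInjectiveEndo _ (treeSum_injective σ)).toContinuousLinearEquiv

theorem treeSumEquiv_apply (v : Fin (n + 1) → ℝ) (k : Fin (n + 1)) :
    treeSumEquiv σ v k = ∑ i ∈ treeIv σ k, v i := treeSum_apply σ v k

/-- The affine chart of the associahedron at the vertex given by a search tree. -/
noncomputable def vertexChart (ε : Finset (Fin (n + 1)) → ℝ) (x : Fin (n + 1) → ℝ) :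
    Fin n → ℝ :=
  fun j => ∑ i ∈ treeIv σ ((treeRoot σ).succAbove j), x i -
    faceDepth ε (treeIv σ ((treeRoot σ).succAbove j))

/-- The inverse of the affine chart at a vertex. -/
noncomputable def vertexChartSymm (ε : Finset (Fin (n + 1)) → ℝ) (w : Fin n → ℝ) :
    Fin (n + 1) → ℝ :=
  (treeSumEquiv σ).symm ((treeRoot σ).insertNth (α := fun _ => ℝ) 1
    fun j => w j + faceDepth ε (treeIv σ ((treeRoot σ).succAbove j)))

/-- The domain of the affine chart at a vertex. -/
def vertexDomain (ε : Finset (Fin (n + 1)) → ℝ) : Set (Fin (n + 1) → ℝ) :=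
  {x | ∀ S, IsFacet S → S ∉ range (treeIv σ) → faceDepth ε S < ∑ i ∈ S, x i}

theorem isOpen_vertexDomain : IsOpen (vertexDomain σ ε) := by
  simp only [vertexDomain, ofPred_forall]
  exact isOpen_iInter_of_finite fun S => isOpen_iInter_of_finite fun _ =>
    isOpen_iInter_of_finite fun _ => isOpen_lt continuous_const (by fun_prop)

theorem contDiff_vertexChart : ContDiff ℝ ∞ (vertexChart σ ε) := by
  unfold vertexChart
  fun_prop

theorem contDiff_vertexChartSymm : ContDiff ℝ ∞ (vertexChartSymm σ ε) := by
  unfold vertexChartSymm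
  refine (treeSumEquiv σ).symm.contDiff.comp (contDiff_pi.2 fun k => ?_)
  refine Fin.succAboveCases (treeRoot σ) ?_ (fun j => ?_) k
  · simp only [Fin.insertNth_apply_same]
    exact contDiff_const
  · simp only [Fin.insertNth_apply_succAbove]
    fun_prop

theorem isFacet_treeIv_succAbove (j : Fin n) : IsFacet (treeIv σ ((treeRoot σ).succAbove j)) :=
  ⟨isIv_treeIv _, fun h => Fin.succAbove_ne _ _ (treeIv_eq_univ_iff.1 h)⟩

theorem exists_succAbove_of_isFacet {S : Finset (Fin (n + 1))} (hS : IsFacet S)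
    (h : S ∈ range (treeIv σ)) : ∃ j, S = treeIv σ ((treeRoot σ).succAbove j) := by
  obtain ⟨k, rfl⟩ := h
  have hk : k ≠ treeRoot σ := fun h => hS.2 (treeIv_eq_univ_iff.2 h)
  obtain ⟨j, rfl⟩ := Fin.exists_succAbove_eq hk
  exact ⟨j, rfl⟩

theorem sum_vertexChartSymm_root (w : Fin n → ℝ) : ∑ i, vertexChartSymm σ ε w i = 1 := by
  have h := treeSumEquiv_apply σ (vertexChartSymm σ ε w) (treeRoot σ)
  rw [treeIv_treeRoot] at h
  rw [← h, vertexChartSymm, ContinuousLinearEquiv.apply_symm_apply, Fin.insertNth_apply_same]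

theorem sum_vertexChartSymm (w : Fin n → ℝ) (j : Fin n) :
    ∑ i ∈ treeIv σ ((treeRoot σ).succAbove j), vertexChartSymm σ ε w i =
      w j + faceDepth ε (treeIv σ ((treeRoot σ).succAbove j)) := by
  rw [← treeSumEquiv_apply σ (vertexChartSymm σ ε w), vertexChartSymm,
    ContinuousLinearEquiv.apply_symm_apply, Fin.insertNth_apply_succAbove]

/-- The coordinates are the slacks of the `n` facets labelled by the proper intervals of the search
tree, and together with the total sum they form a linear coordinate system. On the domain all other
inequalities are strict, so the associahedron is described there by nonnegativity of these slacks
alone. -/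
theorem isCornerChart_vertexChart :
    IsCornerChart n (associahedron n ε) (vertexDomain σ ε) (vertexChart σ ε) := by
  have hleft : ∀ x ∈ associahedron n ε, vertexChartSymm σ ε (vertexChart σ ε x) = x := by
    intro x hx
    rw [vertexChartSymm, ContinuousLinearEquiv.symm_apply_eq]
    funext k
    rw [treeSumEquiv_apply]
    refine Fin.succAboveCases (treeRoot σ) ?_ (fun j => ?_) k
    · rw [Fin.insertNth_apply_same, treeIv_treeRoot, (mem_associahedron_iff.1 hx).1]
    · rw [Fin.insertNth_apply_succAbove, vertexChart, sub_add_cancel]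
  have hright : ∀ w, vertexChart σ ε (vertexChartSymm σ ε w) = w := by
    intro w
    funext j
    rw [vertexChart, sum_vertexChartSymm, add_sub_cancel_right]
  refine ⟨isOpen_vertexDomain σ, vertexChartSymm σ ε ⁻¹' vertexDomain σ ε,
    (isOpen_vertexDomain σ).preimage (contDiff_vertexChartSymm σ).continuous, ?_,
    (contDiff_vertexChart σ).isSmoothOnSet _, vertexChartSymm σ ε, ?_,
    (contDiff_vertexChartSymm σ).isSmoothOnSet _, fun x hx => hleft x hx.1, fun w _ => hright w⟩
  · rintro x ⟨hx, hxU⟩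
    refine ⟨fun j => sub_nonneg.2 ((mem_associahedron_iff.1 hx).2 _ (isFacet_treeIv_succAbove σ j)),
      ?_⟩
    rw [mem_preimage, hleft x hx]
    exact hxU
  · rintro w ⟨hw, hwV⟩
    refine ⟨mem_associahedron_iff.2 ⟨sum_vertexChartSymm_root σ w, fun S hS => ?_⟩, hwV⟩
    by_cases h : S ∈ range (treeIv σ)
    · obtain ⟨j, rfl⟩ := exists_succAbove_of_isFacet σ hS h
      rw [sum_vertexChartSymm]
      have := hw j
      linarith
    · exact (hwV S hS h).le

theorem mem_vertexDomain {x : Fin (n + 1) → ℝ} (hx : x ∈ associahedron n ε)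
    (h : tightSet ε x ⊆ range (treeIv σ)) : x ∈ vertexDomain σ ε := fun S hS hSr =>
  lt_of_le_of_ne ((mem_associahedron_iff.1 hx).2 S hS) fun h' => hSr (h ⟨hS, h'.symm⟩)

theorem ncard_zeros_vertexChart {x : Fin (n + 1) → ℝ} (h : tightSet ε x ⊆ range (treeIv σ)) :
    {j | vertexChart σ ε x j = 0}.ncard = (tightSet ε x).ncard := by
  have hinj : Function.Injective fun j => treeIv σ ((treeRoot σ).succAbove j) :=
    treeIv_injective.comp Fin.succAbove_right_injective
  rw [← ncard_image_of_injective _ hinj]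
  congr 1
  ext S
  constructor
  · rintro ⟨j, hj, rfl⟩
    exact ⟨isFacet_treeIv_succAbove σ j, sub_eq_zero.1 hj⟩
  · intro hS
    obtain ⟨j, rfl⟩ := exists_succAbove_of_isFacet σ hS.1 (h hS)
    exact ⟨j, sub_eq_zero.2 hS.2, rfl⟩

theorem isManifoldWithCorners_associahedron (hε : IsTruncationDepth ε) :
    IsManifoldWithCorners n (associahedron n ε) := by
  intro x hx
  obtain ⟨σ, hσ⟩ := exists_tightSet_subset hε hx
  exact ⟨_, _, mem_vertexDomain σ hx hσ, isCornerChart_vertexChart σ⟩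

/-- An affine vertex chart counts the tight facets, and the depth is the same in every chart by
`IsCornerChart.card_zeros_eq`. -/
theorem mem_depthStratum_iff (hε : IsTruncationDepth ε) {k : ℕ} {x : Fin (n + 1) → ℝ} :
    x ∈ depthStratum n (associahedron n ε) k ↔
      x ∈ associahedron n ε ∧ (tightSet ε x).ncard = k := by
  constructor
  · rintro ⟨hx, U, φ, hxU, hφ, hk⟩
    obtain ⟨σ, hσ⟩ := exists_tightSet_subset hε hx
    refine ⟨hx, ?_⟩
    rw [← ncard_zeros_vertexChart σ hσ, ← hk]
    exact hφ.card_zeros_eq (isCornerChart_vertexChart σ) hx hxU (mem_vertexDomain σ hx hσ)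
  · rintro ⟨hx, hk⟩
    obtain ⟨σ, hσ⟩ := exists_tightSet_subset hε hx
    exact ⟨hx, _, _, mem_vertexDomain σ hx hσ, isCornerChart_vertexChart σ, by
      rw [ncard_zeros_vertexChart σ hσ, hk]⟩

-- Open faces, their closures and the strata.

theorem sum_convexCombination (x y : Fin (n + 1) → ℝ) (a b : ℝ) (S : Finset (Fin (n + 1))) :
    ∑ i ∈ S, (a • x + b • y) i = a * ∑ i ∈ S, x i + b * ∑ i ∈ S, y i := by
  simp [Finset.sum_add_distrib, Finset.mul_sum]

/-- The facets that contain an inner point of a segment contain both end points. -/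
theorem tightSet_convexCombination {x y : Fin (n + 1) → ℝ} (hx : x ∈ associahedron n ε)
    (hy : y ∈ associahedron n ε) {a b : ℝ} (ha : 0 < a) (hb : 0 < b) (hab : a + b = 1) :
    tightSet ε (a • x + b • y) = tightSet ε x ∩ tightSet ε y := by
  ext S
  have key : IsFacet S → (∑ i ∈ S, (a • x + b • y) i = faceDepth ε S ↔
      ∑ i ∈ S, x i = faceDepth ε S ∧ ∑ i ∈ S, y i = faceDepth ε S) := by
    intro hS
    have h1 := (mem_associahedron_iff.1 hx).2 S hS
    have h2 := (mem_associahedron_iff.1 hy).2 S hS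
    have e : faceDepth ε S = a * faceDepth ε S + b * faceDepth ε S := by rw [← add_mul, hab, one_mul]
    rw [sum_convexCombination]
    constructor
    · intro h
      have h3 := mul_le_mul_of_nonneg_left h1 ha.le
      have h4 := mul_le_mul_of_nonneg_left h2 hb.le
      exact ⟨(mul_left_cancel₀ ha.ne' (by linarith)), (mul_left_cancel₀ hb.ne' (by linarith))⟩
    · rintro ⟨h3, h4⟩
      rw [h3, h4, ← e]
  simp only [tightSet, mem_ofPred_eq, mem_inter_iff]
  constructor
  · rintro ⟨hS, h⟩
    exact ⟨⟨hS, ((key hS).1 h).1⟩, ⟨hS, ((key hS).1 h).2⟩⟩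
  · rintro ⟨⟨hS, h1⟩, ⟨-, h2⟩⟩
    exact ⟨hS, (key hS).2 ⟨h1, h2⟩⟩

theorem convex_faceSet (N : Set (Finset (Fin (n + 1)))) : Convex ℝ (faceSet ε N) := by
  rintro x ⟨hx, hxN⟩ y ⟨hy, hyN⟩ a b ha hb hab
  refine ⟨convex_associahedron hx hy ha hb hab, ?_⟩
  rcases ha.eq_or_lt with rfl | ha
  · rw [zero_add] at hab
    subst hab
    simpa using hyN
  rcases hb.eq_or_lt with rfl | hb
  · rw [add_zero] at hab
    subst hab
    simpa using hxN
  · rw [tightSet_convexCombination hx hy ha hb hab, hxN, hyN, inter_self]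

/-- Strict inequalities persist nearby, so facets can be lost but not gained. -/
theorem eventually_tightSet_subset {x : Fin (n + 1) → ℝ} (hx : x ∈ associahedron n ε) :
    ∀ᶠ y in 𝓝 x, tightSet ε y ⊆ tightSet ε x := by
  have : ∀ S, ∀ᶠ y in 𝓝 x, S ∈ tightSet ε y → S ∈ tightSet ε x := by
    intro S
    by_cases hS : S ∈ tightSet ε x
    · exact Filter.Eventually.of_forall fun _ _ => hS
    · by_cases hF : IsFacet S
      · have h1 : faceDepth ε S < ∑ i ∈ S, x i :=
          lt_of_le_of_ne ((mem_associahedron_iff.1 hx).2 S hF) fun h => hS ⟨hF, h.symm⟩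
        have hc : ContinuousAt (fun y : Fin (n + 1) → ℝ => ∑ i ∈ S, y i) x := by fun_prop
        filter_upwards [hc.eventually (lt_mem_nhds h1)] with y hy hyS
        exact absurd hyS.2 hy.ne'
      · exact Filter.Eventually.of_forall fun _ h => absurd h.1 hF
  exact (Filter.eventually_all.2 this).mono fun y hy S hS => hy S hS

/-- On a depth stratum the tight set is locally constant: nearby it can only shrink, and its size is
fixed. So a component has one tight set. Conversely all points with that tight set form a convex,
hence connected, set. -/
theorem connectedComponentIn_depthStratum (hε : IsTruncationDepth ε) {k : ℕ}
    {x : Fin (n + 1) → ℝ} (hx : x ∈ depthStratum n (associahedron n ε) k) :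
    connectedComponentIn (depthStratum n (associahedron n ε) k) x =
      faceSet ε (tightSet ε x) := by
  classical
  have hx' := (mem_depthStratum_iff hε).1 hx
  refine Subset.antisymm (fun y hy => ?_) ?_
  · have hyk := (mem_depthStratum_iff hε).1 (connectedComponentIn_subset _ _ hy)
    refine ⟨hyk.1, ?_⟩
    have hcont : ContinuousOn (fun y => decide (tightSet ε y = tightSet ε x))
        (connectedComponentIn (depthStratum n (associahedron n ε) k) x) := by
      intro w hw
      have hwk := (mem_depthStratum_iff hε).1 (connectedComponentIn_subset _ _ hw)
      refine Filter.Tendsto.mono_right ?_ (pure_le_nhds _)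
      rw [Filter.tendsto_pure]
      filter_upwards [self_mem_nhdsWithin,
        nhdsWithin_le_nhds (eventually_tightSet_subset hwk.1)] with u hu hus
      have huk := (mem_depthStratum_iff hε).1 (connectedComponentIn_subset _ _ hu)
      have : tightSet ε u = tightSet ε w :=
        eq_of_subset_of_ncard_le hus (by rw [huk.2, hwk.2])
      rw [this]
    have := isPreconnected_connectedComponentIn.constant hcont hy (mem_connectedComponentIn hx)
    simpa using this
  · refine (convex_faceSet _).isPreconnected.subset_connectedComponentIn ⟨hx'.1, rfl⟩ ?_
    rintro y ⟨hy, hyt⟩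
    exact (mem_depthStratum_iff hε).2 ⟨hy, by rw [hyt, hx'.2]⟩

/-- A point with more tight facets is pushed slightly towards a point of the open face; by
`tightSet_convexCombination` only the facets in `N` stay tight. -/
theorem closure_faceSet {N : Set (Finset (Fin (n + 1)))} (hN : (faceSet ε N).Nonempty) :
    closure (faceSet ε N) = {x | x ∈ associahedron n ε ∧ N ⊆ tightSet ε x} := by
  obtain ⟨y, hy, hyN⟩ := hN
  refine Subset.antisymm ?_ ?_
  · have hset : {x | x ∈ associahedron n ε ∧ N ⊆ tightSet ε x} =
        associahedron n ε ∩ ⋂ S ∈ N, {x | ∑ i ∈ S, x i = faceDepth ε S} := by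
      ext x
      simp only [mem_ofPred_eq, mem_inter_iff, mem_iInter]
      refine and_congr_right fun _ => ⟨fun h S hS => (h hS).2, fun h S hS => ⟨?_, h S hS⟩⟩
      rw [← hyN] at hS
      exact hS.1
    have hcl : IsClosed {x | x ∈ associahedron n ε ∧ N ⊆ tightSet ε x} := by
      rw [hset]
      exact isClosed_associahedron.inter (isClosed_biInter fun S _ =>
        isClosed_eq (by fun_prop) continuous_const)
    exact closure_minimal (fun x hx => ⟨hx.1, hx.2.symm.subset⟩) hcl
  · rintro x ⟨hx, hxN⟩
    have hc : Filter.Tendsto (fun s : ℝ => (1 - s) • x + s • y) (𝓝[>] 0) (𝓝 x) := by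
      have : Continuous fun s : ℝ => (1 - s) • x + s • y := by fun_prop
      have h2 := this.tendsto 0
      simp only [sub_zero, one_smul, zero_smul, add_zero] at h2
      exact h2.mono_left nhdsWithin_le_nhds
    refine mem_closure_of_tendsto hc ?_
    filter_upwards [Ioo_mem_nhdsGT (show (0 : ℝ) < 1 by norm_num)] with s hs
    have h1 : 0 < 1 - s := by linarith [hs.2]
    have h2 : (1 - s) + s = 1 := by ring
    refine ⟨convex_associahedron hx hy h1.le hs.1.le h2, ?_⟩
    rw [tightSet_convexCombination hx hy h1 hs.1 h2, hyN, inter_eq_right.2 hxN]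

theorem faceSet_subset_closure_iff {N M : Set (Finset (Fin (n + 1)))}
    (hN : (faceSet ε N).Nonempty) (hM : (faceSet ε M).Nonempty) :
    faceSet ε N ⊆ closure (faceSet ε M) ↔ M ⊆ N := by
  rw [closure_faceSet hM]
  constructor
  · intro h
    obtain ⟨x, hx⟩ := hN
    have := (h hx).2
    rwa [hx.2] at this
  · rintro h x ⟨hx, rfl⟩
    exact ⟨hx, h⟩

/-! ### Nested sets of intervals -/

/-- A set of pairwise compatible labels of facets. -/
def IsNested (N : Set (Finset (Fin (n + 1)))) : Prop :=
  (∀ S ∈ N, IsFacet S) ∧ ∀ S ∈ N, ∀ T ∈ N, S ⊆ T ∨ T ⊆ S ∨ ¬ IsIv (S ∪ T)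

/-- If the union of two intervals of a search tree is an interval, its top label lies in one of
them, which then contains the other. -/
theorem isNested_tightSet (hε : IsTruncationDepth ε) {x : Fin (n + 1) → ℝ}
    (hx : x ∈ associahedron n ε) : IsNested (tightSet ε x) := by
  refine ⟨fun S hS => hS.1, fun S hS T hT => ?_⟩
  obtain ⟨σ, hσ⟩ := exists_tightSet_subset hε hx
  obtain ⟨k, rfl⟩ := hσ hS
  obtain ⟨l, rfl⟩ := hσ hT
  by_cases h : IsIv (treeIv σ k ∪ treeIv σ l)
  · obtain ⟨m, hm, hmax⟩ := h.exists_top σ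
    rcases Finset.mem_union.1 hm with h1 | h1
    · exact Or.inr (Or.inl (Finset.subset_union_right.trans
        ((subset_treeIv_iff h hm hmax).2 h1)))
    · exact Or.inl (Finset.subset_union_left.trans ((subset_treeIv_iff h hm hmax).2 h1))
  · exact Or.inr (Or.inr h)

/-- Take the label of `I` outside `S` that is nearest to `i`: everything between it and `S` is
already in `S`. -/
theorem exists_adjacent {S I : Finset (Fin (n + 1))} (hS : IsIv S) (hI : IsIv I)
    {i : Fin (n + 1)} (hiS : i ∈ S) (hiI : i ∈ I) (h : ¬ I ⊆ S) :
    ∃ j ∈ I, j ∉ S ∧ IsIv (insert j S) := by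
  have hne : (I \ S).Nonempty := Finset.sdiff_nonempty.2 h
  obtain ⟨j, hj, hmin⟩ := Finset.exists_min_image (I \ S) (fun j => ((j : ℤ) - (i : ℤ)).natAbs) hne
  rw [Finset.mem_sdiff] at hj
  refine ⟨j, hj.1, hj.2, ⟨j, Finset.mem_insert_self _ _⟩, fun a ha b hb c hac hcb => ?_⟩
  rw [Finset.mem_insert] at ha hb ⊢
  by_contra hcon
  rw [not_or] at hcon
  rcases ha with rfl | ha
  · rcases hb with rfl | hb
    · exact absurd (hac.trans hcb) (lt_irrefl _)
    · have hci : c < i := by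
        by_contra hci
        exact hcon.2 (hS.mem_of_le hiS hb (not_lt.1 hci) hcb.le)
      have := hmin c (Finset.mem_sdiff.2 ⟨hI.mem_of_le hj.1 hiI hac.le hci.le, hcon.2⟩)
      rw [Fin.lt_def] at hac hci
      omega
  · rcases hb with rfl | hb
    · have hci : i < c := by
        by_contra hci
        exact hcon.2 (hS.mem_of_le ha hiS hac.le (not_lt.1 hci))
      have := hmin c (Finset.mem_sdiff.2 ⟨hI.mem_of_le hiI hj.1 hci.le hcb.le, hcon.2⟩)
      rw [Fin.lt_def] at hcb hci
      omega
    · exact hcon.2 (hS.2 a ha b hb c hac hcb)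

/-- The number of members of `N` that contain a label. -/
noncomputable def nestDepth (N : Set (Finset (Fin (n + 1)))) (i : Fin (n + 1)) : ℕ :=
  {T | T ∈ N ∧ i ∈ T}.ncard

/-- A member of `N` that contains a neighbour `j` of `S` is neither inside `S` nor separated from
`S`, so it contains `S`. Thus it is counted for `i` too, while `S` is counted only for `i`. -/
theorem IsNested.nestDepth_lt {N : Set (Finset (Fin (n + 1)))} (hN : IsNested N)
    {S : Finset (Fin (n + 1))} (hS : S ∈ N) {i j : Fin (n + 1)} (hi : i ∈ S) (hj : j ∉ S)
    (hadj : IsIv (insert j S)) : nestDepth N j < nestDepth N i := by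
  refine ncard_lt_ncard ⟨?_, fun h => hj (h ⟨hS, hi⟩).2⟩
  rintro T ⟨hT, hjT⟩
  refine ⟨hT, ?_⟩
  rcases hN.2 S hS T hT with h | h | h
  · exact h hi
  · exact absurd (h hjT) hj
  · refine absurd ?_ h
    have : S ∪ T = insert j S ∪ T := by
      rw [Finset.insert_union, Finset.insert_eq_of_mem (Finset.mem_union_right _ hjT)]
    rw [this]
    exact hadj.union (hN.1 T hT).1 ⟨j, by simp [hjT]⟩

/-- The uniform distributions on the labels of least depth in an interval. -/
noncomputable def nestDistribution (N : Set (Finset (Fin (n + 1)))) (I : Finset (Fin (n + 1)))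
    (i : Fin (n + 1)) : ℝ :=
  if i ∈ I.filter (fun i => ∀ j ∈ I, nestDepth N i ≤ nestDepth N j) then
    ((I.filter fun i => ∀ j ∈ I, nestDepth N i ≤ nestDepth N j).card : ℝ)⁻¹ else 0

theorem nestDistribution_eq_zero_iff {N : Set (Finset (Fin (n + 1)))} {I : Finset (Fin (n + 1))}
    {i : Fin (n + 1)} : nestDistribution N I i = 0 ↔
      ¬ (i ∈ I ∧ ∀ j ∈ I, nestDepth N i ≤ nestDepth N j) := by
  unfold nestDistribution
  rw [← Finset.mem_filter (p := fun i => ∀ j ∈ I, nestDepth N i ≤ nestDepth N j)]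
  split_ifs with h
  · simp only [h, not_true, iff_false]
    have := Finset.card_pos.2 ⟨i, h⟩
    positivity
  · simp [h]

theorem isDistFamily_nestDistribution (N : Set (Finset (Fin (n + 1)))) :
    IsDistFamily (nestDistribution N) := by
  intro I hI
  refine ⟨fun i => ?_, fun i hi => nestDistribution_eq_zero_iff.2 fun h => hi h.1, ?_⟩
  · unfold nestDistribution
    split_ifs
    · positivity
    · exact le_rfl
  · unfold nestDistribution
    rw [Finset.sum_ite_mem, Finset.univ_inter, Finset.sum_const, nsmul_eq_mul]
    refine mul_inv_cancel₀ ?_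
    obtain ⟨m, hm, hmin⟩ := Finset.exists_min_image I (nestDepth N) hI.1
    have := Finset.card_pos.2 ⟨m, (Finset.mem_filter (p := fun i =>
      ∀ j ∈ I, nestDepth N i ≤ nestDepth N j)).2 ⟨hm, hmin⟩⟩
    positivity

/-- Every nested set is the set of facets through some point. -/
theorem IsNested.faceSet_nonempty (hε : IsTruncationDepth ε) {N : Set (Finset (Fin (n + 1)))}
    (hN : IsNested N) : (faceSet ε N).Nonempty := by
  have hd := isDistFamily_nestDistribution N
  -- Heuristically these are the limits of the ratios of `t_i = δ ^ (depth of i)` as `δ` tends to 0.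
  refine ⟨minkowskiMap ε (nestDistribution N), hd.minkowskiMap_mem hε, ?_⟩
  ext S
  constructor
  · rintro ⟨hS, h⟩
    rw [hd.sum_minkowskiMap_eq_iff hε hS.1] at h
    obtain ⟨i, hi, hmin⟩ := Finset.exists_min_image S (nestDepth N) hS.1.1
    -- Tightness of `S` makes every neighbour of `S` shallower than every label in `S`; otherwise a
    -- label of least depth in `S` would keep mass in the enlarged interval.
    have hadj : ∀ j, j ∉ S → IsIv (insert j S) → nestDepth N j < nestDepth N i := by
      intro j hj hjS
      have h1 := nestDistribution_eq_zero_iff.1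
        (h _ hjS (fun h => hj (h (Finset.mem_insert_self _ _))) i hi)
      by_contra hcon
      refine h1 ⟨Finset.mem_insert_of_mem hi, fun k hk => ?_⟩
      rcases Finset.mem_insert.1 hk with rfl | hk
      · exact not_lt.1 hcon
      · exact hmin k hk
    obtain ⟨j0, -, hj0, hj0S⟩ := exists_adjacent hS.1 isIv_univ hi (Finset.mem_univ i)
      fun h => hS.2 (Finset.univ_subset_iff.1 h)
    have hne : {T | T ∈ N ∧ i ∈ T}.Nonempty := by
      refine (ncard_pos).1 ((Nat.zero_le _).trans_lt (hadj j0 hj0 hj0S))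
    -- The smallest member of `N` through the shallowest label `i` of `S` turns out to be `S`. If it
    -- left `S`, it would contain a neighbour of `S` at least as deep as `i`; if it did not contain
    -- `S`, some label of `S` next to it would be shallower than `i`.
    obtain ⟨T, ⟨hTN, hiT⟩, hTmin⟩ := exists_min_image _ Finset.card (toFinite _) hne
    have hT : IsFacet T := hN.1 T hTN
    have hchain : ∀ T' ∈ N, i ∈ T' → T ⊆ T' := by
      intro T' hT' hiT'
      rcases hN.2 T hTN T' hT' with h1 | h1 | h1
      · exact h1
      · rw [Finset.eq_of_subset_of_card_le h1 (hTmin T' ⟨hT', hiT'⟩)]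
      · exact absurd (hT.1.union (hN.1 T' hT').1 ⟨i, by simp [hiT, hiT']⟩) h1
    have hTS : T ⊆ S := by
      by_contra hcon
      obtain ⟨j, hjT, hjS, hjadj⟩ := exists_adjacent hS.1 hT.1 hi hiT hcon
      refine absurd (hadj j hjS hjadj) (not_lt.2 (ncard_le_ncard ?_))
      rintro T' ⟨hT', hiT'⟩
      exact ⟨hT', hchain T' hT' hiT' hjT⟩
    have hST : S ⊆ T := by
      by_contra hcon
      obtain ⟨j, hjS, hjT, hjadj⟩ := exists_adjacent hT.1 hS.1 hiT hi hcon
      exact absurd (hN.nestDepth_lt hTN hiT hjT hjadj) (not_lt.2 (hmin j hjS))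
    rwa [hST.antisymm hTS]
  -- Conversely, an interval that meets a member `S` of `N` and leaves it contains a neighbour of
  -- `S`, which is shallower than all labels in `S` and takes away their mass.
  · intro hS
    have hF := hN.1 S hS
    refine ⟨hF, (hd.sum_minkowskiMap_eq_iff hε hF.1).2 fun I hI hIS i hi => ?_⟩
    rw [nestDistribution_eq_zero_iff]
    rintro ⟨hiI, hmin⟩
    obtain ⟨j, hjI, hjS, hjadj⟩ := exists_adjacent hF.1 hI hi hiI hIS
    exact absurd (hN.nestDepth_lt hS hi hjS hjadj) (not_lt.2 (hmin j hjI))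

end Faces

/-! ## Planar trees and nested sets of intervals -/

namespace PlanarTree

/-- The number of leaves of a list of trees. -/
def forestLeaves (ts : List PlanarTree) : ℕ := (ts.map numLeaves).sum

@[simp] theorem forestLeaves_nil : forestLeaves [] = 0 := rfl

@[simp] theorem forestLeaves_cons (t : PlanarTree) (ts : List PlanarTree) :
    forestLeaves (t :: ts) = t.numLeaves + forestLeaves ts := by simp [forestLeaves]

@[simp] theorem forestLeaves_append (l r : List PlanarTree) :
    forestLeaves (l ++ r) = forestLeaves l + forestLeaves r := by simp [forestLeaves]

theorem numLeaves_node (ts : List PlanarTree) : (node ts).numLeaves = forestLeaves ts := by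
  simp [numLeaves, forestLeaves]

@[simp] theorem numLeaves_leaf : leaf.numLeaves = 1 := by simp [numLeaves]

mutual

/-- The ranges of leaves above the non-leaf vertices of a tree whose first leaf has number `a`. -/
def nodeIvs : PlanarTree → ℕ → Set (ℕ × ℕ)
  | leaf, _ => ∅
  | node ts, a => insert (a, a + forestLeaves ts) (forestIvs ts a)

/-- The ranges of leaves above the non-leaf vertices of a list of trees. -/
def forestIvs : List PlanarTree → ℕ → Set (ℕ × ℕ)
  | [], _ => ∅
  | t :: ts, a => nodeIvs t a ∪ forestIvs ts (a + t.numLeaves)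

end

theorem nodeIvs_leaf (a : ℕ) : nodeIvs leaf a = ∅ := by simp [nodeIvs]

theorem nodeIvs_node (ts : List PlanarTree) (a : ℕ) :
    nodeIvs (node ts) a = insert (a, a + forestLeaves ts) (forestIvs ts a) := by simp [nodeIvs]

theorem forestIvs_nil (a : ℕ) : forestIvs [] a = ∅ := by simp [forestIvs]

theorem forestIvs_cons (t : PlanarTree) (ts : List PlanarTree) (a : ℕ) :
    forestIvs (t :: ts) a = nodeIvs t a ∪ forestIvs ts (a + t.numLeaves) := by simp [forestIvs]

theorem forestIvs_append (l r : List PlanarTree) (a : ℕ) :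
    forestIvs (l ++ r) a = forestIvs l a ∪ forestIvs r (a + forestLeaves l) := by
  induction l generalizing a with
  | nil => simp [forestIvs_nil]
  | cons t l ih =>
    rw [List.cons_append, forestIvs_cons, forestIvs_cons, ih, forestLeaves_cons, union_assoc,
      add_assoc]

theorem IsReduced.children {ts : List PlanarTree} (h : IsReduced (PlanarTree.node ts)) :
    2 ≤ ts.length ∧ ∀ t ∈ ts, IsReduced t := by
  cases h with
  | node _ h1 h2 => exact ⟨h1, h2⟩

theorem length_le_forestLeaves {ts : List PlanarTree} (h : ∀ t ∈ ts, 1 ≤ t.numLeaves) :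
    ts.length ≤ forestLeaves ts := by
  induction ts with
  | nil => simp
  | cons t ts ih =>
    have h1 := h t (by simp)
    have h2 := ih fun t ht => h t (by simp [ht])
    simp only [List.length_cons, forestLeaves_cons]
    omega

theorem IsReduced.one_le_numLeaves {t : PlanarTree} (h : IsReduced t) : 1 ≤ t.numLeaves := by
  induction h with
  | leaf => simp
  | node ts h1 _ ih =>
    have := length_le_forestLeaves ih
    rw [numLeaves_node]
    omega

theorem IsReduced.two_le_numLeaves {ts : List PlanarTree} (h : IsReduced (PlanarTree.node ts)) :
    2 ≤ forestLeaves ts := by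
  have h1 := length_le_forestLeaves fun t ht => (h.children.2 t ht).one_le_numLeaves
  have := h.children.1
  omega

theorem forestIvs_bounds {ts : List PlanarTree} {a : ℕ} {p : ℕ × ℕ}
    (h : ∀ t ∈ ts, ∀ a, ∀ p ∈ nodeIvs t a, a ≤ p.1 ∧ p.2 ≤ a + t.numLeaves ∧ p.1 + 2 ≤ p.2)
    (hp : p ∈ forestIvs ts a) : a ≤ p.1 ∧ p.2 ≤ a + forestLeaves ts ∧ p.1 + 2 ≤ p.2 := by
  induction ts generalizing a with
  | nil => simp [forestIvs_nil] at hp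
  | cons t ts ih =>
    rw [forestIvs_cons] at hp
    rw [forestLeaves_cons]
    rcases hp with hp | hp
    · have := h t (by simp) a p hp
      omega
    · have := ih (fun t ht => h t (by simp [ht])) hp
      omega

theorem IsReduced.nodeIvs_bounds {t : PlanarTree} (h : IsReduced t) {a : ℕ} {p : ℕ × ℕ}
    (hp : p ∈ nodeIvs t a) : a ≤ p.1 ∧ p.2 ≤ a + t.numLeaves ∧ p.1 + 2 ≤ p.2 := by
  induction h generalizing a p with
  | leaf => simp [nodeIvs_leaf] at hp
  | node ts h1 h2 ih =>
    have h3 := (IsReduced.node ts h1 h2).two_le_numLeaves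
    rw [nodeIvs_node] at hp
    rw [numLeaves_node]
    rcases hp with rfl | hp
    · simp only; omega
    · exact forestIvs_bounds (fun t ht a p hp => ih t ht hp) hp

theorem forestIvs_bounds' {ts : List PlanarTree} {a : ℕ} {p : ℕ × ℕ} (h : ∀ t ∈ ts, IsReduced t)
    (hp : p ∈ forestIvs ts a) : a ≤ p.1 ∧ p.2 ≤ a + forestLeaves ts ∧ p.1 + 2 ≤ p.2 :=
  forestIvs_bounds (fun t ht _ _ hp => (h t ht).nodeIvs_bounds hp) hp

/-- With at least two children, each having a leaf, no vertex above the root has all the leaves. -/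
theorem IsReduced.root_notMem {ts : List PlanarTree} (h : IsReduced (PlanarTree.node ts)) (a : ℕ) :
    (a, a + forestLeaves ts) ∉ forestIvs ts a := by
  obtain ⟨h1, h2⟩ := h.children
  match ts, h1, h2 with
  | t :: t' :: ts, _, h2 =>
    rw [forestIvs_cons]
    have e1 := (h2 t (by simp)).one_le_numLeaves
    have e2 := (h2 t' (by simp)).one_le_numLeaves
    rintro (h | h)
    · have := (h2 t (by simp)).nodeIvs_bounds h
      simp only [forestLeaves_cons] at this
      omega
    · have := forestIvs_bounds' (fun s hs => h2 s (List.mem_cons_of_mem _ hs)) h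
      omega

/-- Two ranges of leaves are disjoint or nested. -/
def Compat (p q : ℕ × ℕ) : Prop :=
  p.2 ≤ q.1 ∨ q.2 ≤ p.1 ∨ (q.1 ≤ p.1 ∧ p.2 ≤ q.2) ∨ (p.1 ≤ q.1 ∧ q.2 ≤ p.2)

theorem forestIvs_compat {ts : List PlanarTree} {a : ℕ} (hred : ∀ t ∈ ts, IsReduced t)
    (h : ∀ t ∈ ts, ∀ a, ∀ p ∈ nodeIvs t a, ∀ q ∈ nodeIvs t a, Compat p q) {p q : ℕ × ℕ}
    (hp : p ∈ forestIvs ts a) (hq : q ∈ forestIvs ts a) : Compat p q := by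
  induction ts generalizing a with
  | nil => simp [forestIvs_nil] at hp
  | cons t ts ih =>
    rw [forestIvs_cons] at hp hq
    have hred' : ∀ t ∈ ts, IsReduced t := fun t ht => hred t (by simp [ht])
    rcases hp with hp | hp
    · rcases hq with hq | hq
      · exact h t (by simp) a p hp q hq
      · have e1 := (hred t (by simp)).nodeIvs_bounds hp
        have e2 := forestIvs_bounds' hred' hq
        exact Or.inl (by omega)
    · rcases hq with hq | hq
      · have e1 := (hred t (by simp)).nodeIvs_bounds hq
        have e2 := forestIvs_bounds' hred' hp
        exact Or.inr (Or.inl (by omega))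
      · exact ih hred' (fun t ht => h t (by simp [ht])) hp hq

theorem IsReduced.compat {t : PlanarTree} (h : IsReduced t) {a : ℕ} {p q : ℕ × ℕ}
    (hp : p ∈ nodeIvs t a) (hq : q ∈ nodeIvs t a) : Compat p q := by
  induction h generalizing a p q with
  | leaf => simp [nodeIvs_leaf] at hp
  | node ts h1 h2 ih =>
    have hpb := (IsReduced.node ts h1 h2).nodeIvs_bounds hp
    have hqb := (IsReduced.node ts h1 h2).nodeIvs_bounds hq
    rw [numLeaves_node] at hpb hqb
    rw [nodeIvs_node] at hp hq
    rcases hp with rfl | hp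
    · exact Or.inr (Or.inr (Or.inr ⟨by omega, by omega⟩))
    · rcases hq with rfl | hq
      · exact Or.inr (Or.inr (Or.inl ⟨by omega, by omega⟩))
      · exact forestIvs_compat h2 (fun t ht a p hp q hq => ih t ht hp hq) hp hq

theorem ContractsTo.numLeaves_eq {t t' : PlanarTree} (h : ContractsTo t t') :
    t'.numLeaves = t.numLeaves := by
  induction h with
  | root l cs r => simp [numLeaves_node]
  | above l r t t' _ ih => simp [numLeaves_node, ih]

/-- Contracting an edge drops one vertex and leaves the leaves above the other vertices unchanged.
-/
theorem ContractsTo.nodeIvs_subset {t t' : PlanarTree} (h : ContractsTo t t') (a : ℕ) :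
    nodeIvs t' a ⊆ nodeIvs t a := by
  induction h generalizing a with
  | root l cs r =>
    rw [nodeIvs_node, nodeIvs_node]
    have e : forestLeaves (l ++ cs ++ r) = forestLeaves (l ++ PlanarTree.node cs :: r) := by
      simp [numLeaves_node]
    rw [e]
    refine insert_subset_insert ?_
    rw [forestIvs_append, forestIvs_append, forestIvs_append, forestIvs_cons, nodeIvs_node,
      numLeaves_node, forestLeaves_append, add_assoc]
    rintro p ((hp | hp) | hp)
    · exact Or.inl hp
    · exact Or.inr (Or.inl (Or.inr hp))
    · exact Or.inr (Or.inr hp)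
  | above l r t t' h ih =>
    rw [nodeIvs_node, nodeIvs_node]
    have e : forestLeaves (l ++ t' :: r) = forestLeaves (l ++ t :: r) := by
      simp [h.numLeaves_eq]
    rw [e]
    refine insert_subset_insert ?_
    rw [forestIvs_append, forestIvs_append, forestIvs_cons, forestIvs_cons, h.numLeaves_eq]
    exact union_subset_union_right _ (union_subset_union_left _ (ih _))

/-- Once the first trees are known to have equally many leaves, the ranges split at that position
into those of the first tree and those of the rest. -/
theorem forest_eq_of_forestIvs_eq {ts ts' : List PlanarTree} {a : ℕ}
    (hred : ∀ t ∈ ts, IsReduced t) (hred' : ∀ t ∈ ts', IsReduced t)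
    (ih : ∀ t ∈ ts, ∀ t' a, IsReduced t' → t.numLeaves = t'.numLeaves →
      nodeIvs t a = nodeIvs t' a → t = t')
    (hl : forestLeaves ts = forestLeaves ts') (h : forestIvs ts a = forestIvs ts' a) :
    ts = ts' := by
  induction ts generalizing ts' a with
  | nil =>
    match ts' with
    | [] => rfl
    | t :: ts' =>
      have := (hred' t (by simp)).one_le_numLeaves
      simp only [forestLeaves_nil, forestLeaves_cons] at hl
      omega
  | cons t ts ihl =>
    match ts' with
    | [] =>
      have := (hred t (by simp)).one_le_numLeaves
      simp only [forestLeaves_nil, forestLeaves_cons] at hl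
      omega
    | t' :: ts' =>
      -- A range starting at `a` can only belong to the first tree of the other forest, so its root
      -- range bounds the size from both sides by symmetry.
      have key : ∀ (t t' : PlanarTree) (ts ts' : List PlanarTree), IsReduced t → IsReduced t' →
          (∀ t ∈ ts', IsReduced t) → forestIvs (t :: ts) a = forestIvs (t' :: ts') a →
          t.numLeaves ≤ t'.numLeaves := by
        intro t t' ts ts' ht ht' hts' h
        have h1 := ht'.one_le_numLeaves
        cases t with
        | leaf => simpa using h1
        | node cs =>
          have h2 : (a, a + forestLeaves cs) ∈ forestIvs (PlanarTree.node cs :: ts) a := by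
            rw [forestIvs_cons, nodeIvs_node]
            exact Or.inl (mem_insert _ _)
          rw [h, forestIvs_cons] at h2
          rw [numLeaves_node]
          rcases h2 with h2 | h2
          · have := (ht'.nodeIvs_bounds h2).2.1
            simp only at this
            omega
          · have := (forestIvs_bounds' hts' h2).1
            simp only at this
            omega
      have ht := hred t (by simp)
      have ht' := hred' t' (by simp)
      have hts : ∀ t ∈ ts, IsReduced t := fun t ht => hred t (by simp [ht])
      have hts' : ∀ t ∈ ts', IsReduced t := fun t ht => hred' t (by simp [ht])
      have hn : t.numLeaves = t'.numLeaves :=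
        (key t t' ts ts' ht ht' hts' h).antisymm (key t' t ts' ts ht' ht hts h.symm)
      have hhead : ∀ (t : PlanarTree) (ts : List PlanarTree), IsReduced t →
          (∀ t ∈ ts, IsReduced t) →
          nodeIvs t a = {p | p ∈ forestIvs (t :: ts) a ∧ p.2 ≤ a + t.numLeaves} := by
        intro t ts ht hts
        ext p
        rw [forestIvs_cons]
        constructor
        · exact fun hp => ⟨Or.inl hp, (ht.nodeIvs_bounds hp).2.1⟩
        · rintro ⟨hp | hp, h1⟩
          · exact hp
          · have := forestIvs_bounds' hts hp
            omega
      have htail : ∀ (t : PlanarTree) (ts : List PlanarTree), IsReduced t →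
          (∀ t ∈ ts, IsReduced t) → forestIvs ts (a + t.numLeaves) =
            {p | p ∈ forestIvs (t :: ts) a ∧ a + t.numLeaves ≤ p.1} := by
        intro t ts ht hts
        ext p
        rw [forestIvs_cons]
        constructor
        · exact fun hp => ⟨Or.inr hp, (forestIvs_bounds' hts hp).1⟩
        · rintro ⟨hp | hp, h1⟩
          · have := ht.nodeIvs_bounds hp
            omega
          · exact hp
      have e1 : t = t' := ih t (by simp) t' a ht' hn (by
        rw [hhead t ts ht hts, hhead t' ts' ht' hts', h, hn])
      have e2 : ts = ts' := ihl (a := a + t.numLeaves) hts hts'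
        (fun s hs => ih s (by simp [hs]))
        (by simp only [forestLeaves_cons] at hl; omega) (by
          rw [htail t ts ht hts, h, hn, htail t' ts' ht' hts'])
      rw [e1, e2]

/-- A reduced tree is determined by its ranges of leaves. -/
theorem IsReduced.eq_of_nodeIvs_eq {t : PlanarTree} (h : IsReduced t) :
    ∀ t' a, IsReduced t' → t.numLeaves = t'.numLeaves → nodeIvs t a = nodeIvs t' a → t = t' := by
  induction h with
  | leaf =>
    intro t' a h' hl _
    cases t' with
    | leaf => rfl
    | node ts =>
      have := h'.two_le_numLeaves
      rw [numLeaves_node, numLeaves_leaf] at hl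
      omega
  | node ts h1 h2 ih =>
    intro t' a h' hl he
    have h := IsReduced.node ts h1 h2
    cases t' with
    | leaf =>
      have := h.two_le_numLeaves
      rw [numLeaves_node, numLeaves_leaf] at hl
      omega
    | node ts' =>
      rw [numLeaves_node, numLeaves_node] at hl
      rw [nodeIvs_node, nodeIvs_node, ← hl] at he
      have e1 := h.root_notMem a
      have e2 := h'.root_notMem a
      rw [← hl] at e2
      have e3 : forestIvs ts a = forestIvs ts' a := by
        rw [← insert_sdiff_self_of_notMem e1, he, insert_sdiff_self_of_notMem e2]
      rw [forest_eq_of_forestIvs_eq h2 h'.children.2 ih hl e3]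

/-- A position is a boundary between two trees or lies inside a tree. -/
theorem exists_split (ts : List PlanarTree) {a x : ℕ} (h1 : a ≤ x) (h2 : x ≤ a + forestLeaves ts) :
    (∃ l r, ts = l ++ r ∧ a + forestLeaves l = x) ∨
    ∃ l t r, ts = l ++ t :: r ∧ a + forestLeaves l < x ∧
      x < a + forestLeaves l + t.numLeaves := by
  induction ts generalizing a with
  | nil => exact Or.inl ⟨[], [], rfl, by simp at h2 ⊢; omega⟩
  | cons t ts ih =>
    rcases h1.eq_or_lt with h1 | h1
    · exact Or.inl ⟨[], t :: ts, rfl, by simp [h1]⟩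
    by_cases h3 : x < a + t.numLeaves
    · exact Or.inr ⟨[], t, ts, rfl, by simpa using h1, by simpa using h3⟩
    · rw [forestLeaves_cons] at h2
      rcases ih (a := a + t.numLeaves) (by omega) (by omega) with ⟨l, r, rfl, h4⟩ |
        ⟨l, s, r, rfl, h4, h5⟩
      · exact Or.inl ⟨t :: l, r, rfl, by rw [forestLeaves_cons]; omega⟩
      · exact Or.inr ⟨t :: l, s, r, rfl, by rw [forestLeaves_cons]; omega,
          by rw [forestLeaves_cons]; omega⟩

theorem root_mem_forestIvs {l r : List PlanarTree} {t : PlanarTree} {a : ℕ} (ht : IsReduced t)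
    (h : 2 ≤ t.numLeaves) : (a + forestLeaves l, a + forestLeaves l + t.numLeaves) ∈
      forestIvs (l ++ t :: r) a := by
  cases t with
  | leaf => simp at h
  | node cs =>
    rw [forestIvs_append, forestIvs_cons, nodeIvs_node, numLeaves_node]
    exact Or.inr (Or.inl (mem_insert _ _))

/-- A compatible range of leaves can be added to a tree. -/
theorem IsReduced.exists_expansion {T : PlanarTree} (hT : IsReduced T) : ∀ {a c d : ℕ}, a ≤ c →
    c + 2 ≤ d → d ≤ a + T.numLeaves → (∀ q ∈ nodeIvs T a, Compat (c, d) q) →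
    (c, d) ∉ nodeIvs T a → ∃ T1, IsReduced T1 ∧ ContractsTo T1 T ∧
      nodeIvs T1 a = insert (c, d) (nodeIvs T a) := by
  induction hT with
  | leaf =>
    intro a c d h1 h2 h3
    rw [numLeaves_leaf] at h3
    omega
  | node ts hlen hred ih =>
    intro a c d h1 h2 h3 hcomp hnot
    rw [numLeaves_node] at h3
    -- Compatibility with the ranges of the children forbids an end point of `(c, d)` strictly
    -- inside a child unless the whole range lies in that child. So it sits inside one child or is a
    -- union of consecutive children.
    have hsplit : (∃ l t r, ts = l ++ t :: r ∧ a + forestLeaves l ≤ c ∧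
        d ≤ a + forestLeaves l + t.numLeaves) ∨
        ∃ l cs r, ts = l ++ cs ++ r ∧ a + forestLeaves l = c ∧ c + forestLeaves cs = d := by
      rcases exists_split ts h1 (by omega) with ⟨l, r, rfl, hl⟩ | ⟨l, t, r, rfl, hl, hl'⟩
      · rw [forestLeaves_append] at h3
        rcases exists_split r (a := c) (x := d) (by omega) (by omega) with
          ⟨cs, r', rfl, hcs⟩ | ⟨l', t, r', rfl, hl', hl''⟩
        · exact Or.inr ⟨l, cs, r', by simp, hl, hcs⟩
        · have hmem : (a + forestLeaves (l ++ l'), a + forestLeaves (l ++ l') + t.numLeaves) ∈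
              nodeIvs (PlanarTree.node (l ++ l' ++ t :: r')) a := by
            rw [nodeIvs_node]
            exact Or.inr (root_mem_forestIvs (hred t (by simp)) (by omega))
          rw [List.append_assoc] at hmem
          have := hcomp _ hmem
          rw [forestLeaves_append] at this
          refine Or.inl ⟨l ++ l', t, r', by simp, ?_, ?_⟩ <;> rw [forestLeaves_append] <;>
            simp only [Compat] at this <;> omega
      · have hmem : (a + forestLeaves l, a + forestLeaves l + t.numLeaves) ∈
            nodeIvs (PlanarTree.node (l ++ t :: r)) a := by
          rw [nodeIvs_node]
          exact Or.inr (root_mem_forestIvs (hred t (by simp)) (by omega))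
        have := hcomp _ hmem
        refine Or.inl ⟨l, t, r, rfl, ?_, ?_⟩ <;> simp only [Compat] at this <;> omega
    rcases hsplit with ⟨l, t, r, rfl, hl, hl'⟩ | ⟨l, cs, r, rfl, hl, hcs⟩
    -- Inside one child: expand that child.
    · have hsub : nodeIvs t (a + forestLeaves l) ⊆ nodeIvs (PlanarTree.node (l ++ t :: r)) a := by
        rw [nodeIvs_node, forestIvs_append, forestIvs_cons]
        exact fun q hq => Or.inr (Or.inr (Or.inl hq))
      obtain ⟨t1, ht1, hc1, hi1⟩ := ih t (by simp) hl h2 hl' (fun q hq => hcomp q (hsub hq))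
        fun h => hnot (hsub h)
      refine ⟨PlanarTree.node (l ++ t1 :: r), IsReduced.node _ (by simpa using hlen) fun s hs => ?_,
        ContractsTo.above l r t1 t hc1, ?_⟩
      · rw [List.mem_append, List.mem_cons] at hs
        rcases hs with hs | rfl | hs
        · exact hred s (by simp [hs])
        · exact ht1
        · exact hred s (by simp [hs])
      · rw [nodeIvs_node, nodeIvs_node, forestIvs_append, forestIvs_append, forestIvs_cons,
          forestIvs_cons, hi1, forestLeaves_append, forestLeaves_append, forestLeaves_cons,
          forestLeaves_cons, hc1.numLeaves_eq, insert_union, union_insert, insert_comm]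
    -- A block of children: graft it onto a new vertex. The block has at least two trees, since the
    -- range of a single tree with two leaves is already present.
    · have hcs2 : 2 ≤ cs.length := by
        match cs, hcs with
        | [], hcs => simp at hcs; omega
        | [t], hcs =>
          exfalso
          simp only [forestLeaves_cons, forestLeaves_nil, add_zero] at hcs
          refine hnot ?_
          rw [nodeIvs_node, List.append_assoc, List.singleton_append]
          have := root_mem_forestIvs (l := l) (r := r) (a := a) (hred t (by simp)) (by omega)
          rw [hl, hcs] at this
          exact Or.inr this
        | _ :: _ :: _, _ => simp
      -- The root keeps at least two children, since otherwise the new range would be that of the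
      -- root.
      have hlen' : 2 ≤ (l ++ PlanarTree.node cs :: r).length := by
        by_contra hcon
        simp only [List.length_append, List.length_cons] at hcon
        have hl0 : l = [] := List.eq_nil_of_length_eq_zero (by omega)
        have hr0 : r = [] := List.eq_nil_of_length_eq_zero (by omega)
        subst hl0; subst hr0
        refine hnot ?_
        rw [nodeIvs_node, ← hcs, ← hl]
        exact Or.inl (by simp)
      refine ⟨PlanarTree.node (l ++ PlanarTree.node cs :: r), IsReduced.node _ hlen' fun s hs => ?_,
        ContractsTo.root l cs r, ?_⟩
      · rw [List.mem_append, List.mem_cons] at hs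
        rcases hs with hs | rfl | hs
        · exact hred s (by simp [hs])
        · exact IsReduced.node _ hcs2 fun s hs => hred s (by simp [hs])
        · exact hred s (by simp [hs])
      · have e : forestLeaves (l ++ cs ++ r) = forestLeaves (l ++ PlanarTree.node cs :: r) := by
          simp [numLeaves_node]
        have e2 : a + (forestLeaves l + forestLeaves cs) = d := by omega
        rw [nodeIvs_node, nodeIvs_node, e, forestIvs_append, forestIvs_append, forestIvs_append,
          forestIvs_cons, nodeIvs_node, numLeaves_node, forestLeaves_append, hl, hcs,
          insert_union, union_insert, insert_comm, union_assoc, forestLeaves_append, e2]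

/-- A tree can be expanded to any larger set of pairwise compatible ranges of leaves. -/
theorem IsReduced.exists_expansion_eq {m : ℕ} {P : Set (ℕ × ℕ)} (hP : P.Finite)
    (hv : ∀ p ∈ P, p.1 + 2 ≤ p.2 ∧ p.2 ≤ m) (hc : ∀ p ∈ P, ∀ q ∈ P, Compat p q)
    {T : PlanarTree} (hT : IsReduced T) (hm : T.numLeaves = m) (hsub : nodeIvs T 0 ⊆ P) :
    ∃ T1, IsReduced T1 ∧ T1.numLeaves = m ∧ nodeIvs T1 0 = P ∧
      Relation.ReflTransGen ContractsTo T1 T := by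
  -- Missing ranges are inserted one at a time; each insertion is undone by a contraction.
  induction hk : (P \ nodeIvs T 0).ncard generalizing T with
  | zero =>
    rw [ncard_eq_zero (hP.sdiff), sdiff_eq_empty] at hk
    exact ⟨T, hT, hm, hsub.antisymm hk, Relation.ReflTransGen.refl⟩
  | succ k ih =>
    have hne : (P \ nodeIvs T 0).Nonempty := by
      rw [← ncard_pos hP.sdiff]; omega
    obtain ⟨⟨c, d⟩, hpP, hpT⟩ := hne
    have hv' := hv _ hpP
    obtain ⟨T1, hT1, hc1, hi1⟩ := hT.exists_expansion (a := 0) (c := c) (d := d) (Nat.zero_le _)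
      hv'.1 (by rw [hm, zero_add]; exact hv'.2) (fun q hq => hc _ hpP q (hsub hq)) hpT
    obtain ⟨T2, h1, h2, h3, h4⟩ := ih hT1 (by rw [← hc1.numLeaves_eq, hm])
      (by rw [hi1]; exact insert_subset hpP hsub) (by
        have : P \ insert (c, d) (nodeIvs T 0) = (P \ nodeIvs T 0) \ {(c, d)} := by
          ext p
          simp only [mem_sdiff, mem_insert_iff, mem_singleton_iff]
          tauto
        have hmem : (c, d) ∈ P \ nodeIvs T 0 := ⟨hpP, hpT⟩
        rw [hi1, this, ncard_sdiff_singleton_of_mem hmem, hk]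
        rfl)
    exact ⟨T2, h1, h2, h3, h4.tail hc1⟩

theorem nodeIvs_subset_of_reflTransGen {T T' : PlanarTree}
    (h : Relation.ReflTransGen ContractsTo T T') (a : ℕ) : nodeIvs T' a ⊆ nodeIvs T a := by
  induction h with
  | refl => exact subset_rfl
  | tail _ h ih => exact (h.nodeIvs_subset a).trans ih

theorem finite_nodeIvs {T : PlanarTree} (hT : IsReduced T) (a : ℕ) : (nodeIvs T a).Finite := by
  refine ((finite_Iic (a + T.numLeaves)).prod (finite_Iic (a + T.numLeaves))).subset ?_
  intro p hp
  have := hT.nodeIvs_bounds hp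
  exact ⟨by simp only [mem_Iic]; omega, this.2.1⟩

/-- The tree with a single non-leaf vertex. -/
def corolla (m : ℕ) : PlanarTree := PlanarTree.node (List.replicate m leaf)

theorem isReduced_corolla {m : ℕ} (hm : 2 ≤ m) : IsReduced (corolla m) := by
  refine IsReduced.node _ (by simpa using hm) fun t ht => ?_
  rw [List.eq_of_mem_replicate ht]
  exact IsReduced.leaf

theorem numLeaves_corolla (m : ℕ) : (corolla m).numLeaves = m := by
  simp [corolla, numLeaves_node, forestLeaves]

theorem nodeIvs_corolla (m : ℕ) : nodeIvs (corolla m) 0 = {(0, m)} := by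
  have h : ∀ m a, forestIvs (List.replicate m leaf) a = ∅ := by
    intro m
    induction m with
    | zero => simp [forestIvs_nil]
    | succ m ih => simp [List.replicate_succ, forestIvs_cons, nodeIvs_leaf, ih]
  have h2 : forestLeaves (List.replicate m leaf) = m := by simp [forestLeaves]
  rw [corolla, nodeIvs_node, h, h2, zero_add, insert_empty_eq]

theorem IsReduced.root_mem {T : PlanarTree} (hT : IsReduced T) (h : 2 ≤ T.numLeaves) :
    (0, T.numLeaves) ∈ nodeIvs T 0 := by
  cases T with
  | leaf => simp at h
  | node ts => rw [nodeIvs_node, numLeaves_node, zero_add]; exact mem_insert _ _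

end PlanarTree

-- Ranges of leaves as intervals of gaps.

section TreeFaces

open PlanarTree

variable {n : ℕ}

/-- The gaps in a range of leaves. -/
def rangeGaps (n : ℕ) (p : ℕ × ℕ) : Finset (Fin (n + 1)) :=
  Finset.univ.filter fun l => p.1 ≤ l ∧ (l : ℕ) + 1 < p.2

/-- The ranges of at least two of the leaves of a tree with `n + 2` leaves. -/
def IsLeafRange (n : ℕ) (p : ℕ × ℕ) : Prop := p.1 + 2 ≤ p.2 ∧ p.2 ≤ n + 2

theorem mem_rangeGaps {p : ℕ × ℕ} {l : Fin (n + 1)} :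
    l ∈ rangeGaps n p ↔ p.1 ≤ l ∧ (l : ℕ) + 1 < p.2 := by simp [rangeGaps]

theorem rangeGaps_subset_iff {p q : ℕ × ℕ} (hp : IsLeafRange n p) :
    rangeGaps n p ⊆ rangeGaps n q ↔ q.1 ≤ p.1 ∧ p.2 ≤ q.2 := by
  unfold IsLeafRange at hp
  constructor
  · intro h
    -- The first and the last gap of a range determine its ends.
    have h1 := mem_rangeGaps.1 (h (mem_rangeGaps.2
      (show p.1 ≤ ((⟨p.1, by omega⟩ : Fin (n + 1)) : ℕ) ∧ _ from ⟨le_rfl, by simp only; omega⟩)))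
    have h2 := mem_rangeGaps.1 (h (mem_rangeGaps.2
      (show p.1 ≤ ((⟨p.2 - 2, by omega⟩ : Fin (n + 1)) : ℕ) ∧ _ from
        ⟨by simp only; omega, by simp only; omega⟩)))
    simp only at h1 h2
    omega
  · intro h l hl
    rw [mem_rangeGaps] at *
    omega

theorem rangeGaps_injOn {p q : ℕ × ℕ} (hp : IsLeafRange n p) (hq : IsLeafRange n q)
    (h : rangeGaps n p = rangeGaps n q) : p = q := by
  have h1 := (rangeGaps_subset_iff hp).1 h.subset
  have h2 := (rangeGaps_subset_iff hq).1 h.symm.subset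
  exact Prod.ext (by omega) (by omega)

theorem isIv_rangeGaps {p : ℕ × ℕ} (hp : IsLeafRange n p) : IsIv (rangeGaps n p) := by
  unfold IsLeafRange at hp
  refine ⟨⟨⟨p.1, by omega⟩, mem_rangeGaps.2 ⟨le_rfl, by simp only; omega⟩⟩,
    fun a ha b hb c hac hcb => ?_⟩
  rw [mem_rangeGaps] at *
  rw [Fin.lt_def] at *
  omega

theorem isLeafRange_root : IsLeafRange n (0, n + 2) := ⟨by simp, by simp⟩

theorem rangeGaps_root : rangeGaps n (0, n + 2) = Finset.univ := by
  ext l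
  have := l.isLt
  simp only [mem_rangeGaps, Finset.mem_univ, iff_true]
  omega

theorem exists_rangeGaps {S : Finset (Fin (n + 1))} (hS : IsIv S) :
    ∃ p, IsLeafRange n p ∧ rangeGaps n p = S := by
  -- Gap `l` lies between the leaves `l` and `l + 1` and the upper end is exclusive, whence the `+
  -- 2`.
  refine ⟨((S.min' hS.1 : ℕ), (S.max' hS.1 : ℕ) + 2), ⟨?_, ?_⟩, ?_⟩
  · have := S.min'_le_max' hS.1
    rw [Fin.le_def] at this
    simp only
    omega
  · have := (S.max' hS.1).isLt
    simp only
    omega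
  · ext l
    rw [mem_rangeGaps]
    constructor
    · rintro ⟨h1, h2⟩
      exact hS.mem_of_le (S.min'_mem hS.1) (S.max'_mem hS.1) (Fin.le_def.2 h1)
        (Fin.le_def.2 (by simp only at h2; omega))
    · intro hl
      have h1 := Fin.le_def.1 (S.min'_le l hl)
      have h2 := Fin.le_def.1 (S.le_max' l hl)
      exact ⟨h1, by simp only; omega⟩

/-- Disjoint ranges of leaves, even adjacent ones, miss the gap between them, so the union of their
gap sets is not an interval; overlapping ranges do have an interval as union. -/
theorem compat_iff {p q : ℕ × ℕ} (hp : IsLeafRange n p) (hq : IsLeafRange n q) :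
    Compat p q ↔ rangeGaps n p ⊆ rangeGaps n q ∨ rangeGaps n q ⊆ rangeGaps n p ∨
      ¬ IsIv (rangeGaps n p ∪ rangeGaps n q) := by
  rw [rangeGaps_subset_iff hp, rangeGaps_subset_iff hq]
  have hsep : ∀ {p q : ℕ × ℕ}, IsLeafRange n p → IsLeafRange n q → p.2 ≤ q.1 →
      ¬ IsIv (rangeGaps n p ∪ rangeGaps n q) := by
    intro p q hp hq h hI
    unfold IsLeafRange at hp hq
    have h1 : (⟨p.1, by omega⟩ : Fin (n + 1)) ∈ rangeGaps n p ∪ rangeGaps n q :=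
      Finset.mem_union_left _ (mem_rangeGaps.2 ⟨le_rfl, by simp only; omega⟩)
    have h2 : (⟨q.1, by omega⟩ : Fin (n + 1)) ∈ rangeGaps n p ∪ rangeGaps n q :=
      Finset.mem_union_right _ (mem_rangeGaps.2 ⟨le_rfl, by simp only; omega⟩)
    -- The gap just after the last leaf of `p` belongs to neither range.
    have h3 := hI.2 _ h1 _ h2 ⟨p.2 - 1, by omega⟩ (Fin.lt_def.2 (by simp only; omega))
      (Fin.lt_def.2 (by simp only; omega))
    rw [Finset.mem_union, mem_rangeGaps, mem_rangeGaps] at h3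
    simp only at h3
    omega
  constructor
  · rintro (h | h | h | h)
    · exact Or.inr (Or.inr (hsep hp hq h))
    · refine Or.inr (Or.inr ?_)
      rw [Finset.union_comm]
      exact hsep hq hp h
    · exact Or.inl h
    · exact Or.inr (Or.inl h)
  · rintro (h | h | h)
    · exact Or.inr (Or.inr (Or.inl h))
    · exact Or.inr (Or.inr (Or.inr h))
    · by_contra hcon
      refine h ?_
      have : rangeGaps n p ∪ rangeGaps n q = rangeGaps n (min p.1 q.1, max p.2 q.2) := by
        ext l
        simp only [Finset.mem_union, mem_rangeGaps]
        simp only [Compat, not_or] at hcon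
        unfold IsLeafRange at hp hq
        omega
      rw [this]
      refine isIv_rangeGaps ?_
      unfold IsLeafRange at *
      simp only
      omega

/-- The labels of the facets through the face that corresponds to a tree. -/
def treeFaces (T : PsiO (n + 2)) : Set (Finset (Fin (n + 1))) :=
  rangeGaps n '' (nodeIvs T.1 0 \ {(0, n + 2)})

theorem isLeafRange_of_mem (T : PsiO (n + 2)) {p : ℕ × ℕ} (hp : p ∈ nodeIvs T.1 0) :
    IsLeafRange n p := by
  have := T.2.1.nodeIvs_bounds hp
  rw [T.2.2] at this
  exact ⟨this.2.2, by omega⟩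

theorem root_mem_nodeIvs (T : PsiO (n + 2)) : (0, n + 2) ∈ nodeIvs T.1 0 := by
  have := T.2.1.root_mem (by rw [T.2.2]; omega)
  rwa [T.2.2] at this

theorem isNested_treeFaces (T : PsiO (n + 2)) : IsNested (treeFaces T) := by
  constructor
  · rintro _ ⟨p, ⟨hp, hpr⟩, rfl⟩
    have h := isLeafRange_of_mem T hp
    refine ⟨isIv_rangeGaps h, fun hu => hpr ?_⟩
    rw [← rangeGaps_root] at hu
    exact rangeGaps_injOn h isLeafRange_root hu
  · rintro _ ⟨p, ⟨hp, -⟩, rfl⟩ _ ⟨q, ⟨hq, -⟩, rfl⟩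
    exact (compat_iff (isLeafRange_of_mem T hp) (isLeafRange_of_mem T hq)).1 (T.2.1.compat hp hq)

/-- Given the inclusion, expand the tree with fewer ranges to all ranges of the other; since a
reduced tree is determined by its ranges, the expansion is that other tree. -/
theorem le_iff_nodeIvs_subset {T T' : PsiO (n + 2)} :
    T ≤ T' ↔ nodeIvs T'.1 0 ⊆ nodeIvs T.1 0 := by
  constructor
  · exact fun h => nodeIvs_subset_of_reflTransGen h 0
  · intro h
    obtain ⟨T1, h1, h2, h3, h4⟩ := T'.2.1.exists_expansion_eq (finite_nodeIvs T.2.1 0)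
      (fun p hp => isLeafRange_of_mem T hp) (fun p hp q hq => T.2.1.compat hp hq) T'.2.2 h
    have := h1.eq_of_nodeIvs_eq T.1 0 T.2.1 (by rw [h2, T.2.2]) h3
    rw [this] at h4
    exact h4

theorem le_iff_treeFaces_subset {T T' : PsiO (n + 2)} : T ≤ T' ↔ treeFaces T' ⊆ treeFaces T := by
  rw [le_iff_nodeIvs_subset]
  constructor
  · exact fun h => image_mono (sdiff_subset_sdiff_left h)
  · intro h p hp
    by_cases hpr : p = (0, n + 2)
    · rw [hpr]; exact root_mem_nodeIvs T
    · obtain ⟨q, hq, hqp⟩ := h (mem_image_of_mem _ ⟨hp, hpr⟩)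
      rw [← rangeGaps_injOn (isLeafRange_of_mem T hq.1) (isLeafRange_of_mem T' hp) hqp]
      exact hq.1

/-- Every family of compatible ranges that contains the root range is reached by expanding the
corolla. -/
theorem exists_treeFaces_eq {N : Set (Finset (Fin (n + 1)))} (hN : IsNested N) :
    ∃ T : PsiO (n + 2), treeFaces T = N := by
  set P : Set (ℕ × ℕ) := insert (0, n + 2) {p | IsLeafRange n p ∧ rangeGaps n p ∈ N} with hP
  have hv : ∀ p ∈ P, IsLeafRange n p := by
    rintro p (rfl | hp)
    · exact isLeafRange_root
    · exact hp.1
  have hfin : P.Finite := by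
    refine ((finite_Iic (n + 2)).prod (finite_Iic (n + 2))).subset fun p hp => ?_
    have := hv p hp
    unfold IsLeafRange at this
    exact ⟨by simp only [mem_Iic]; omega, this.2⟩
  have hc : ∀ p ∈ P, ∀ q ∈ P, Compat p q := by
    intro p hp q hq
    have h1 := hv p hp
    have h2 := hv q hq
    unfold IsLeafRange at h1 h2
    rcases hp with rfl | hp
    · exact Or.inr (Or.inr (Or.inr ⟨by simp only; omega, h2.2⟩))
    · rcases hq with rfl | hq
      · exact Or.inr (Or.inr (Or.inl ⟨by simp only; omega, h1.2⟩))
      · exact (compat_iff hp.1 hq.1).2 (hN.2 _ hp.2 _ hq.2)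
  obtain ⟨T, h1, h2, h3, -⟩ := (isReduced_corolla (m := n + 2) (by omega)).exists_expansion_eq hfin
    hv hc (numLeaves_corolla _) (by
      rw [nodeIvs_corolla, singleton_subset_iff]; exact mem_insert _ _)
  refine ⟨⟨T, h1, h2⟩, ?_⟩
  unfold treeFaces
  rw [h3]
  ext S
  constructor
  · rintro ⟨p, ⟨hp, hpr⟩, rfl⟩
    exact (hp.resolve_left hpr).2
  · intro hS
    obtain ⟨p, hp, rfl⟩ := exists_rangeGaps (hN.1 S hS).1
    refine ⟨p, ⟨Or.inr ⟨hp, hS⟩, ?_⟩, rfl⟩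
    rintro rfl
    exact (hN.1 _ hS).2 rangeGaps_root

end TreeFaces

/-! ## The barycentric subdivision of the associahedron -/

section Barycentric

variable {n : ℕ} {ε : Finset (Fin (n + 1)) → ℝ}

/-- The slack of a convex combination is the same combination of slacks, and these are nonnegative.
-/
theorem tightSet_sum {ι : Type*} {s : Finset ι} {w : ι → ℝ} {b : ι → Fin (n + 1) → ℝ}
    (hw : ∀ p ∈ s, 0 ≤ w p) (hw1 : ∑ p ∈ s, w p = 1) (hb : ∀ p ∈ s, b p ∈ associahedron n ε) :
    ∑ p ∈ s, w p • b p ∈ associahedron n ε ∧ ∀ S, S ∈ tightSet ε (∑ p ∈ s, w p • b p) ↔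
      IsFacet S ∧ ∀ p ∈ s, w p ≠ 0 → S ∈ tightSet ε (b p) := by
  refine ⟨convex_associahedron.sum_mem hw hw1 hb, fun S => and_congr_right fun hS => ?_⟩
  have h1 : ∑ i ∈ S, (∑ p ∈ s, w p • b p) i - faceDepth ε S =
      ∑ p ∈ s, w p * (∑ i ∈ S, b p i - faceDepth ε S) := by
    simp only [mul_sub, Finset.sum_sub_distrib, ← Finset.sum_mul, hw1, one_mul,
      Finset.sum_apply, Pi.smul_apply, smul_eq_mul, Finset.mul_sum]
    rw [Finset.sum_comm]
  rw [← sub_eq_zero, h1, Finset.sum_eq_zero_iff_of_nonneg fun p hp =>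
    mul_nonneg (hw p hp) (sub_nonneg.2 ((mem_associahedron_iff.1 (hb p hp)).2 S hS))]
  refine forall₂_congr fun p _ => ?_
  rw [mul_eq_zero, sub_eq_zero, or_iff_not_imp_left]
  exact imp_congr_right fun _ => ⟨fun h => ⟨hS, h⟩, fun h => h.2⟩

theorem eventually_add_smul_mem_associahedron {y d : Fin (n + 1) → ℝ}
    (hy : y ∈ associahedron n ε) (hd : ∑ i, d i = 0)
    (hdS : ∀ S ∈ tightSet ε y, ∑ i ∈ S, d i = 0) :
    ∀ᶠ s in 𝓝 (0 : ℝ), y + s • d ∈ associahedron n ε := by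
  have hy' := mem_associahedron_iff.1 hy
  have hsum : ∀ (s : ℝ) (S : Finset (Fin (n + 1))),
      ∑ i ∈ S, (y + s • d) i = ∑ i ∈ S, y i + s * ∑ i ∈ S, d i := fun s S => by
    simp [Finset.sum_add_distrib, Finset.mul_sum]
  have : ∀ S, ∀ᶠ s in 𝓝 (0 : ℝ), IsFacet S → faceDepth ε S ≤ ∑ i ∈ S, (y + s • d) i := by
    intro S
    by_cases hS : IsFacet S
    · by_cases hT : ∑ i ∈ S, y i = faceDepth ε S
      · refine Filter.Eventually.of_forall fun s _ => ?_
        rw [hsum, hdS S ⟨hS, hT⟩, mul_zero, add_zero, hT]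
      · have h1 : faceDepth ε S < ∑ i ∈ S, y i + 0 * ∑ i ∈ S, d i := by
          rw [zero_mul, add_zero]
          exact lt_of_le_of_ne (hy'.2 S hS) (Ne.symm hT)
        have hc : ContinuousAt (fun s : ℝ => ∑ i ∈ S, y i + s * ∑ i ∈ S, d i) 0 := by fun_prop
        filter_upwards [hc.eventually (lt_mem_nhds h1)] with s hs _
        rw [hsum]
        exact hs.le
    · exact Filter.Eventually.of_forall fun _ h => absurd h hS
  refine (Filter.eventually_all.2 this).mono fun s hs => mem_associahedron_iff.2 ⟨?_, hs⟩
  rw [hsum, hd, mul_zero, add_zero, hy'.1]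

theorem isCompact_associahedron : IsCompact (associahedron n ε) :=
  (isCompact_stdSimplex ℝ (Fin (n + 1))).of_isClosed_subset isClosed_associahedron fun _ hx => hx.1

/-- The ray from one point of an open face through another one leaves the face at a point of its
boundary. -/
theorem exists_ray_end {x b : Fin (n + 1) → ℝ} (hx : x ∈ associahedron n ε)
    (hb : b ∈ associahedron n ε) (h : tightSet ε b = tightSet ε x) (hne : x ≠ b) :
    ∃ t : ℝ, 0 < t ∧ x + t • (x - b) ∈ associahedron n ε ∧
      tightSet ε x ⊂ tightSet ε (x + t • (x - b)) := by
  have hx' := mem_associahedron_iff.1 hx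
  have hb' := mem_associahedron_iff.1 hb
  have hd0 : ∑ i, (x - b) i = 0 := by simp [hx'.1, hb'.1]
  have hdS : ∀ S ∈ tightSet ε x, ∑ i ∈ S, (x - b) i = 0 := fun S hS => by
    have h1 := hS.2
    have h2 := (h ▸ hS : S ∈ tightSet ε b).2
    simp [h1, h2]
  have hsub : ∀ t : ℝ, tightSet ε x ⊆ tightSet ε (x + t • (x - b)) := fun t S hS => ⟨hS.1, by
    have : ∑ i ∈ S, (x + t • (x - b)) i = ∑ i ∈ S, x i + t * ∑ i ∈ S, (x - b) i := by
      simp only [Pi.add_apply, Pi.smul_apply, smul_eq_mul, Finset.sum_add_distrib, Finset.mul_sum]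
    rw [this, hdS S hS, mul_zero, add_zero, hS.2]⟩
  obtain ⟨i, hi⟩ := Function.ne_iff.1 hne
  have hi' : 0 < |x i - b i| := abs_pos.2 (sub_ne_zero.2 hi)
  set R : Set ℝ := {t | 0 ≤ t ∧ x + t • (x - b) ∈ associahedron n ε} with hR
  have hcl : IsClosed R := isClosed_Ici.inter (isClosed_associahedron.preimage (by fun_prop))
  -- Some coordinate moves along the ray, and all coordinates stay in the unit interval.
  have hbd : BddAbove R := by
    refine ⟨1 / |x i - b i|, fun t ht => ?_⟩
    rw [le_div_iff₀ hi', ← abs_of_nonneg ht.1, ← abs_mul]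
    have h1 := ht.2.1.1 i
    have h2 := hx.1.1 i
    have h3 := (mem_Icc_of_mem_stdSimplex ht.2.1 i).2
    have h4 := (mem_Icc_of_mem_stdSimplex hx.1 i).2
    simp only [Pi.add_apply, Pi.smul_apply, Pi.sub_apply, smul_eq_mul] at h1 h3
    rw [abs_le]
    constructor <;> linarith
  have hmem : sSup R ∈ R := hcl.csSup_mem ⟨0, le_rfl, by simpa using hx⟩ hbd
  -- If no new facet were met at the supremum, the ray could be continued.
  have hss : tightSet ε x ⊂ tightSet ε (x + sSup R • (x - b)) := by
    refine ⟨hsub _, fun hsup => ?_⟩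
    have hev := eventually_add_smul_mem_associahedron hmem.2 hd0 fun S hS => hdS S (hsup hS)
    obtain ⟨s, hs, hs0⟩ := ((hev.filter_mono nhdsWithin_le_nhds).and
      (self_mem_nhdsWithin (s := Ioi (0 : ℝ)))).exists
    have hs0' : 0 < s := hs0
    have : sSup R + s ∈ R := ⟨by linarith [hmem.1], by rwa [add_smul, ← add_assoc]⟩
    linarith [le_csSup hbd this]
  refine ⟨sSup R, lt_of_le_of_ne hmem.1 fun h0 => ?_, hmem.2, hss⟩
  rw [← h0, zero_smul, add_zero] at hss
  exact hss.2 Subset.rfl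

/-- The mean of the vertices is tight precisely for the facets common to all vertices. By
Krein–Milman such a facet contains the whole closed face, in particular a point whose tight set is
`N`. -/
theorem barycenter_mem_faceSet {N : Set (Finset (Fin (n + 1)))} (hN : (faceSet ε N).Nonempty) :
    barycenter (closure (faceSet ε N)) ∈ faceSet ε N := by
  have hK := closure_faceSet hN
  set K := closure (faceSet ε N) with hKdef
  have hKc : IsCompact K := isCompact_associahedron.of_isClosed_subset isClosed_closure fun x hx => by
    rw [hK] at hx
    exact hx.1
  have hKconv : Convex ℝ K := (convex_faceSet N).closure
  have hKne : K.Nonempty := hN.closure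
  have hext : ∀ v ∈ K.extremePoints ℝ, v ∈ associahedron n ε ∧ N ⊆ tightSet ε v := fun v hv => by
    have := extremePoints_subset hv
    rwa [hK] at this
  -- Extreme points have different tight sets: otherwise the ray from one through the other
  -- continues inside the face, and the second is not extreme.
  have hfin : (K.extremePoints ℝ).Finite := by
    refine Finite.of_finite_image (f := tightSet ε) (toFinite _) fun x hx y hy hxy => ?_
    by_contra hne
    obtain ⟨t, ht, hA, hss⟩ := exists_ray_end (hext x hx).1 (hext y hy).1 hxy.symm hne
    have hzK : x + t • (x - y) ∈ K := by
      rw [hK]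
      exact ⟨hA, (hext x hx).2.trans hss.1⟩
    refine hne ((mem_extremePoints.1 hx).2 y (extremePoints_subset hy) _ hzK
      ⟨t / (1 + t), 1 / (1 + t), by positivity, by positivity, by field_simp; ring, ?_⟩).1.symm
    funext i
    simp only [Pi.add_apply, Pi.smul_apply, Pi.sub_apply, smul_eq_mul]
    field_simp
    ring
  have hne := hKc.extremePoints_nonempty hKne
  have hcard : 0 < hfin.toFinset.card := Finset.card_pos.2 (hfin.toFinset_nonempty.2 hne)
  have hbar : barycenter K = ∑ v ∈ hfin.toFinset, (hfin.toFinset.card : ℝ)⁻¹ • v := by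
    rw [barycenter, finsum_mem_eq_finite_toFinset_sum _ hfin, ncard_eq_toFinset_card _ hfin,
      Finset.smul_sum]
  have hcard' : (hfin.toFinset.card : ℝ) ≠ 0 := by positivity
  obtain ⟨h1, h2⟩ := tightSet_sum (ε := ε) (s := hfin.toFinset)
    (w := fun _ => (hfin.toFinset.card : ℝ)⁻¹) (b := fun v => v) (fun _ _ => by positivity)
    (by rw [Finset.sum_const, nsmul_eq_mul, mul_inv_cancel₀ hcard'])
    fun v hv => (hext v (hfin.mem_toFinset.1 hv)).1
  rw [hbar]
  refine ⟨h1, Set.ext fun S => (h2 S).trans ⟨?_, fun hS => ?_⟩⟩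
  · rintro ⟨hS, hall⟩
    obtain ⟨x, hx⟩ := hN
    have hxK : x ∈ K := subset_closure hx
    rw [← closure_convexHull_extremePoints hKc hKconv] at hxK
    have hx2 : ∑ i ∈ S, x i = faceDepth ε S := by
      refine closure_minimal (t := {x : Fin (n + 1) → ℝ | ∑ i ∈ S, x i = faceDepth ε S})
        (convexHull_min (fun v hv => ?_) ?_) ?_ hxK
      · exact (hall v (hfin.mem_toFinset.2 hv) (inv_ne_zero hcard')).2
      · rintro u hu v hv a b - - hab
        rw [mem_ofPred_eq, sum_convexCombination, hu, hv, ← add_mul, hab, one_mul]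
      · exact isClosed_eq (by fun_prop) continuous_const
    rw [← hx.2]
    exact ⟨hS, hx2⟩
  · have hF : IsFacet S := by
      obtain ⟨x, hx⟩ := hN
      rw [← hx.2] at hS
      exact hS.1
    exact ⟨hF, fun v hv _ => (hext v (hfin.mem_toFinset.1 hv)).2 hS⟩

theorem exists_treeIso (hε : IsTruncationDepth ε) :
    ∃ e : PsiO (n + 2) ≃o OpenFace n (associahedron n ε),
      ∀ T, (e T).1 = faceSet ε (treeFaces T) := by
  have hne : ∀ T : PsiO (n + 2), (faceSet ε (treeFaces T)).Nonempty := fun T =>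
    (isNested_treeFaces T).faceSet_nonempty hε
  have hface : ∀ T : PsiO (n + 2), ∃ k, ∃ x ∈ depthStratum n (associahedron n ε) k,
      faceSet ε (treeFaces T) = connectedComponentIn (depthStratum n (associahedron n ε) k) x := by
    intro T
    obtain ⟨x, hx⟩ := hne T
    have hxk := (mem_depthStratum_iff hε).2 ⟨hx.1, rfl⟩
    exact ⟨_, x, hxk, by rw [connectedComponentIn_depthStratum hε hxk, hx.2]⟩
  let f : PsiO (n + 2) → OpenFace n (associahedron n ε) := fun T =>
    ⟨faceSet ε (treeFaces T), hface T⟩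
  have hle : ∀ T T', f T ≤ f T' ↔ T ≤ T' := fun T T' =>
    (faceSet_subset_closure_iff (hne T) (hne T')).trans le_iff_treeFaces_subset.symm
  have hbij : Function.Bijective f := by
    constructor
    · intro T T' h
      have h1 : f T ≤ f T' := by rw [h]; exact (hle T' T').2 le_rfl
      have h2 : f T' ≤ f T := by rw [h]; exact (hle T' T').2 le_rfl
      exact le_antisymm ((hle _ _).1 h1) ((hle _ _).1 h2)
    · rintro ⟨S, k, x, hx, rfl⟩
      obtain ⟨T, hT⟩ := exists_treeFaces_eq (isNested_tightSet hε ((mem_depthStratum_iff hε).1 hx).1)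
      refine ⟨T, Subtype.ext ?_⟩
      change faceSet ε (treeFaces T) = connectedComponentIn _ x
      rw [hT, connectedComponentIn_depthStratum hε hx]
  exact ⟨⟨Equiv.ofBijective f hbij, hle _ _⟩, fun T => rfl⟩

end Barycentric

-- The order complex, peeled and coned at its top element.

section Subdivision

theorem support_sub_single_subset {P : Type*} [DecidableEq P] {f : P → ℝ} {p : P} (hp : f p ≠ 0) (a c : ℝ) :
    (a • (f - Pi.single p c)).support ⊆ f.support := by
  intro q hq hfq
  have h : q ≠ p := by
    rintro rfl
    exact hp hfq
  exact hq (by simp [h, hfq])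

theorem eq_single_of_mem_stdSimplex {P : Type*} [Fintype P] [DecidableEq P] {f : P → ℝ}
    (hf : f ∈ stdSimplex ℝ P) {p : P} (hp : f p = 1) : f = Pi.single p 1 := by
  have h1 := hf.2
  rw [← Finset.add_sum_erase _ _ (Finset.mem_univ p), hp, add_eq_left,
    Finset.sum_eq_zero_iff_of_nonneg fun q _ => hf.1 q] at h1
  funext q
  by_cases h : q = p
  · subst h
    simpa using hp
  · simpa [h] using h1 q (by simp [h])

section Realization

variable {P : Type*} [PartialOrder P]

theorem mem_orderRealization_iff [Fintype P] {f : P → ℝ} : f ∈ orderRealization P ↔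
    f ∈ stdSimplex ℝ P ∧ IsChain (· ≤ ·) f.support := by
  simp only [orderRealization, stdSimplex, mem_ofPred_eq, finsum_eq_sum_of_fintype]
  exact ⟨fun h => ⟨⟨h.1, h.2.2.2⟩, h.2.2.1⟩, fun h => ⟨h.1.1, toFinite _, h.2, h.1.2⟩⟩

/-- Being supported on a chain is a closed condition: the product of coordinates at incomparable
elements is zero. -/
theorem isCompact_orderRealization [Fintype P] : IsCompact (orderRealization P) := by
  refine (isCompact_stdSimplex ℝ P).of_isClosed_subset ?_
    fun f hf => (mem_orderRealization_iff.1 hf).1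
  have : orderRealization P = stdSimplex ℝ P ∩
      ⋂ p, ⋂ q, ⋂ (_ : ¬ (p ≤ q ∨ q ≤ p)), {f | f p * f q = 0} := by
    ext f
    simp only [mem_orderRealization_iff, mem_inter_iff, mem_iInter, mem_ofPred_eq, mul_eq_zero]
    refine and_congr_right fun _ => ⟨fun h p q hpq => ?_, fun h p hp q hq _ => ?_⟩
    · by_contra hcon
      rw [not_or] at hcon
      exact hpq (h.total hcon.1 hcon.2)
    · by_contra hcon
      exact (h p q hcon).elim hp hq
  rw [this]
  exact (isClosed_stdSimplex ℝ P).inter (isClosed_iInter fun p => isClosed_iInter fun q =>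
    isClosed_iInter fun _ => isClosed_eq (by fun_prop) continuous_const)

theorem exists_top_of_mem_orderRealization {f : P → ℝ} (hf : f ∈ orderRealization P) :
    ∃ p ∈ f.support, ∀ q ∈ f.support, q ≤ p := by
  have hne : f.support.Nonempty := by
    rw [Function.support_nonempty_iff]
    rintro rfl
    simpa using hf.2.2.2
  obtain ⟨p, hp⟩ := hf.2.1.exists_maximal hne
  exact ⟨p, hp.1, fun q hq => (hf.2.2.1.total hq hp.1).elim id fun h => hp.2 hq h⟩

/-- Some weight at `p` is removed and the rest is rescaled to total 1; this lowers the support in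
the proof of injectivity. -/
theorem peel_mem_orderRealization [Fintype P] [DecidableEq P] {f : P → ℝ}
    (hf : f ∈ orderRealization P) {p : P} (hp : f p ≠ 0) {c : ℝ} (hc : c ≤ f p) (hc1 : c < 1) :
    (1 - c)⁻¹ • (f - Pi.single p c) ∈ orderRealization P := by
  rw [mem_orderRealization_iff] at hf ⊢
  have h1 : 0 < 1 - c := sub_pos.2 hc1
  refine ⟨⟨fun q => mul_nonneg (inv_nonneg.2 h1.le) ?_, ?_⟩,
    hf.2.mono (support_sub_single_subset hp _ _)⟩
  · by_cases h : q = p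
    · subst h
      simpa using hc
    · simpa [h] using hf.1.1 q
  · simp only [Pi.smul_apply, Pi.sub_apply, smul_eq_mul, ← Finset.mul_sum, Finset.sum_sub_distrib,
      hf.1.2, Finset.sum_pi_single', Finset.mem_univ, if_true]
    rw [inv_mul_cancel₀ h1.ne']

/-- Weight is added at an element above the support; this builds preimages in the proof of
surjectivity. -/
theorem cone_mem_orderRealization [Fintype P] [DecidableEq P] {f : P → ℝ}
    (hf : f ∈ orderRealization P) {p : P} (hp : ∀ q ∈ f.support, q ≤ p) {c : ℝ} (hc : 0 ≤ c) :
    (1 + c)⁻¹ • (f + Pi.single p c) ∈ orderRealization P := by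
  rw [mem_orderRealization_iff] at hf ⊢
  have h1 : 0 < 1 + c := by linarith
  have h2 : 0 ≤ (Pi.single p c : P → ℝ) := Pi.single_nonneg.2 hc
  refine ⟨⟨fun q => mul_nonneg (inv_nonneg.2 h1.le) (add_nonneg (hf.1.1 q) (h2 q)), ?_⟩,
    (hf.2.insert fun q hq _ => Or.inr (hp q hq) : IsChain (· ≤ ·) (insert p f.support)).mono ?_⟩
  · simp only [Pi.smul_apply, Pi.add_apply, smul_eq_mul, ← Finset.mul_sum, Finset.sum_add_distrib,
      hf.1.2]
    rw [Fintype.sum_pi_single', inv_mul_cancel₀ h1.ne']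
  · intro q hq
    by_contra hcon
    rw [mem_insert_iff, not_or, Function.notMem_support] at hcon
    exact hq (by simp [hcon.1, hcon.2])

theorem single_mem_orderRealization [Fintype P] [DecidableEq P] (p : P) :
    Pi.single p 1 ∈ orderRealization P :=
  mem_orderRealization_iff.2 ⟨single_mem_stdSimplex ℝ p,
    (Set.subsingleton_singleton.isChain (r := (· ≤ ·))).mono (Pi.support_single_subset (i := p))⟩

end Realization

-- Affine maps from the order complex onto the associahedron.

section Order
variable {n : ℕ} {ε : Finset (Fin (n + 1)) → ℝ} {P : Type*} [PartialOrder P]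
  {τ : P → Set (Finset (Fin (n + 1)))} {b : P → Fin (n + 1) → ℝ} [Fintype P]

/-- Smaller elements of the chain lie in more facets, so the facets common to the whole support are
those of its top element. -/
theorem tightSet_linearCombination (hτ : ∀ p q, p ≤ q ↔ τ q ⊆ τ p)
    (hb : ∀ p, b p ∈ faceSet ε (τ p)) {f : P → ℝ} (hf : f ∈ orderRealization P) {p : P}
    (hp : p ∈ f.support) (hmax : ∀ q ∈ f.support, q ≤ p) :
    Fintype.linearCombination ℝ b f ∈ faceSet ε (τ p) := by
  have hf' := (mem_orderRealization_iff.1 hf).1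
  obtain ⟨h1, h2⟩ := tightSet_sum (ε := ε) (fun q _ => hf'.1 q) hf'.2 fun q _ => (hb q).1
  rw [Fintype.linearCombination_apply]
  refine ⟨h1, Set.ext fun S => (h2 S).trans ⟨fun h => ?_, fun hS => ?_⟩⟩
  · rw [← (hb p).2]
    exact h.2 p (Finset.mem_univ p) hp
  · refine ⟨?_, fun q _ hq => ?_⟩
    · rw [← (hb p).2] at hS
      exact hS.1
    · rw [(hb q).2]
      exact (hτ q p).1 (hmax q hq) hS

/-- Equal images have equal tight sets, so the two supports have the same top. Removing the smaller
of the two top weights from both sides and rescaling keeps the images equal and shrinks the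
supports. -/
theorem injOn_linearCombination (hτ : ∀ p q, p ≤ q ↔ τ q ⊆ τ p)
    (hb : ∀ p, b p ∈ faceSet ε (τ p)) :
    InjOn (Fintype.linearCombination ℝ b) (orderRealization P) := by
  classical
  have key : ∀ N : ℕ, ∀ f ∈ orderRealization P, ∀ g ∈ orderRealization P,
      Fintype.linearCombination ℝ b f = Fintype.linearCombination ℝ b g →
      f.support.ncard + g.support.ncard = N → f = g := by
    intro N
    induction N using Nat.strong_induction_on with
    | _ N ih =>
    intro f hf g hg hfg hN
    obtain ⟨p, hp, hpmax⟩ := exists_top_of_mem_orderRealization hf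
    obtain ⟨q, hq, hqmax⟩ := exists_top_of_mem_orderRealization hg
    have hpq : τ p = τ q := by
      rw [← (tightSet_linearCombination hτ hb hf hp hpmax).2, hfg,
        (tightSet_linearCombination hτ hb hg hq hqmax).2]
    obtain rfl : p = q := le_antisymm ((hτ _ _).2 hpq.superset) ((hτ _ _).2 hpq.subset)
    clear hpq hpmax hqmax
    wlog hle : f p ≤ g p generalizing f g
    · exact (this g hg f hf hfg.symm (by omega) hq hp (not_le.1 hle).le).symm
    have hf' := (mem_orderRealization_iff.1 hf).1
    have hg' := (mem_orderRealization_iff.1 hg).1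
    -- Rescaling divides by `1 - f p`, so weight 1 at the top is treated apart.
    rcases (mem_Icc_of_mem_stdSimplex hf' p).2.eq_or_lt with h1 | h1
    · rw [eq_single_of_mem_stdSimplex hf' h1, eq_single_of_mem_stdSimplex hg'
        (le_antisymm (mem_Icc_of_mem_stdSimplex hg' p).2 (h1 ▸ hle))]
    have h2 : (1 - f p)⁻¹ ≠ 0 := inv_ne_zero (sub_pos.2 h1).ne'
    have hlt : ((1 - f p)⁻¹ • (f - Pi.single p (f p))).support.ncard < f.support.ncard :=
      ncard_lt_ncard ⟨support_sub_single_subset hp _ _, fun h => h hp (by simp)⟩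
    have hle' := ncard_le_ncard (support_sub_single_subset hq (1 - f p)⁻¹ (f p))
    have := ih _ (by omega) _ (peel_mem_orderRealization hf hp le_rfl h1)
      _ (peel_mem_orderRealization hg hq hle h1) (by simp only [map_smul, map_sub, hfg]) rfl
    exact sub_left_injective (smul_right_injective _ h2 this)
  exact fun f hf g hg h => key _ f hf g hg h rfl

/-- The ray from `b p` through `x` ends at a point with more tight facets. By induction that point
comes from a chain, all of whose elements are below `p`, and coning with `p` gives `x`. -/
theorem surjOn_linearCombination (hτ : ∀ p q, p ≤ q ↔ τ q ⊆ τ p)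
    (hb : ∀ p, b p ∈ faceSet ε (τ p)) (hex : ∀ x ∈ associahedron n ε, ∃ p, τ p = tightSet ε x) :
    SurjOn (Fintype.linearCombination ℝ b) (orderRealization P) (associahedron n ε) := by
  classical
  have key : ∀ N : ℕ, ∀ x ∈ associahedron n ε, (tightSet ε x)ᶜ.ncard = N →
      ∃ f ∈ orderRealization P, Fintype.linearCombination ℝ b f = x := by
    intro N
    induction N using Nat.strong_induction_on with
    | _ N ih =>
    intro x hx hN
    obtain ⟨p, hp⟩ := hex x hx
    by_cases hne : x = b p
    · refine ⟨Pi.single p 1, single_mem_orderRealization p, ?_⟩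
      rw [Fintype.linearCombination_apply_single, one_smul, hne]
    obtain ⟨t, ht, hA, hss⟩ := exists_ray_end hx (hb p).1 ((hb p).2.trans hp) hne
    obtain ⟨g, hg, hgx⟩ := ih _ (by
      rw [← hN]; exact ncard_lt_ncard (compl_lt_compl_iff_lt.2 hss)) _ hA rfl
    refine ⟨_, cone_mem_orderRealization hg (p := p) (fun q hq => ?_) ht.le, ?_⟩
    · obtain ⟨r, hr, hrmax⟩ := exists_top_of_mem_orderRealization hg
      have h1 := (tightSet_linearCombination hτ hb hg hr hrmax).2
      refine (hrmax q hq).trans ((hτ r p).2 ?_)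
      rw [← h1, hgx, hp]
      exact hss.1
    · rw [map_smul, map_add, hgx, Fintype.linearCombination_apply_single]
      funext i
      simp only [Pi.add_apply, Pi.smul_apply, Pi.sub_apply, smul_eq_mul]
      field_simp
      ring
  exact fun x hx => key _ x hx rfl

/-- The map is the restriction of a linear one, so it suffices that the linear map is injective; a
linear left inverse is then a smooth inverse. A kernel vector has coordinate sum zero, so a small
multiple of it moves the center of the simplex within the simplex without changing the image,
contradicting injectivity there unless it is zero. -/
theorem isDiffeoOn_simplex (hτ : ∀ p q, p ≤ q ↔ τ q ⊆ τ p) (hb : ∀ p, b p ∈ faceSet ε (τ p))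
    {c : Finset P} (hc : IsChain (· ≤ ·) (c : Set P)) :
    IsDiffeoOn (fun t : c → ℝ => Fintype.linearCombination ℝ b (extendByZero c t))
      (stdSimplex ℝ c)
      ((fun t : c → ℝ => Fintype.linearCombination ℝ b (extendByZero c t)) '' stdSimplex ℝ c) := by
  classical
  have heq : ∀ t : c → ℝ, Fintype.linearCombination ℝ b (extendByZero c t) =
      Fintype.linearCombination ℝ (fun p : c => b p) t := by
    intro t
    rw [Fintype.linearCombination_apply, Fintype.linearCombination_apply,
      ← Finset.sum_subset (Finset.subset_univ c) fun p _ hp => ?_, ← Finset.sum_coe_sort]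
    · exact Finset.sum_congr rfl fun i _ => by rw [extendByZero_coe]
    · rw [Function.notMem_support.1 fun h => hp (support_extendByZero_subset c t h), zero_smul]
  set L := Fintype.linearCombination ℝ (fun p : c => b p) with hL
  simp only [heq]
  have hsum : ∀ t, ∑ i, L t i = ∑ p, t p := fun t => by
    simp only [hL, Fintype.linearCombination_apply, Finset.sum_apply, Pi.smul_apply, smul_eq_mul]
    rw [Finset.sum_comm]
    simp only [← Finset.mul_sum, (mem_associahedron_iff.1 (hb _).1).1, mul_one]
  have hinj : Function.Injective L := by
    rw [← LinearMap.ker_eq_bot, LinearMap.ker_eq_bot']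
    intro v hv
    rcases isEmpty_or_nonempty c with hemp | hne
    · exact Subsingleton.elim _ _
    have hv0 : ∑ p, v p = 0 := by rw [← hsum, hv]; simp
    have hcard : (0 : ℝ) < Fintype.card c := Nat.cast_pos.2 Fintype.card_pos
    set u : ℝ := (Fintype.card c : ℝ)⁻¹ with hu
    have hu0 : 0 < u := inv_pos.2 hcard
    -- The center has all coordinates `u`; the bound on `s` keeps each change at most `u`.
    have hmem : ∀ s : ℝ, |s| ≤ u / (1 + ‖v‖) → (fun p => u + s * v p) ∈ stdSimplex ℝ c := by
      intro s hs
      refine ⟨fun p => ?_, ?_⟩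
      · have h1 : |s * v p| ≤ u := by
          rw [abs_mul]
          calc |s| * |v p| ≤ u / (1 + ‖v‖) * (1 + ‖v‖) := by
                gcongr
                linarith [norm_le_pi_norm v p, Real.norm_eq_abs (v p)]
            _ = u := div_mul_cancel₀ _ (by positivity)
        linarith [neg_abs_le (s * v p)]
      · rw [Finset.sum_add_distrib, ← Finset.mul_sum, hv0, mul_zero, add_zero, Finset.sum_const,
          Finset.card_univ, nsmul_eq_mul, hu, mul_inv_cancel₀ hcard.ne']
    have hs0 : 0 < u / (1 + ‖v‖) := by positivity
    have h0 := hmem 0 (by rw [abs_zero]; exact hs0.le)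
    have h1 := hmem _ (abs_of_pos hs0).le
    have h2 := injOn_linearCombination hτ hb (extendByZero_mem_orderRealization hc h1)
      (extendByZero_mem_orderRealization hc h0) (by
        rw [heq, heq, ← sub_eq_zero, ← map_sub]
        have : ((fun p => u + u / (1 + ‖v‖) * v p) - fun p => u + 0 * v p) =
            (u / (1 + ‖v‖)) • v := by
          funext p
          simp
        rw [this, map_smul, hv, smul_zero])
    funext p
    have h3 := congrFun h2 p
    rw [extendByZero_coe, extendByZero_coe] at h3
    have h4 : u / (1 + ‖v‖) * v p = 0 := by linarith
    exact (mul_eq_zero.1 h4).resolve_left hs0.ne'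
  obtain ⟨g, hg⟩ := L.exists_leftInverse_of_injective (LinearMap.ker_eq_bot.2 hinj)
  have hgL : ∀ t, g (L t) = t := fun t => LinearMap.congr_fun hg t
  refine ⟨mapsTo_image _ _, ?_, g, ?_, ?_, fun t _ => hgL t, ?_⟩
  · exact L.toContinuousLinearMap.contDiff.isSmoothOnSet _
  · rintro _ ⟨t, ht, rfl⟩
    rwa [hgL]
  · exact g.toContinuousLinearMap.contDiff.isSmoothOnSet _
  · rintro _ ⟨t, ht, rfl⟩
    exact congrArg L (hgL t)

end Order

theorem finite_psiO {n : ℕ} : Finite (PsiO (n + 2)) :=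
  Finite.of_injective (treeFaces : PsiO (n + 2) → _) fun _ _ h =>
    le_antisymm (le_iff_treeFaces_subset.2 h.superset) (le_iff_treeFaces_subset.2 h.subset)

/-- The barycentric map of the associahedron is a barycentric subdivision. -/
theorem isBarycentricSubdivision_associahedron {n : ℕ} {ε : Finset (Fin (n + 1)) → ℝ}
    (hε : IsTruncationDepth ε) {e : PsiO (n + 2) ≃o OpenFace n (associahedron n ε)}
    (he : ∀ T, (e T).1 = faceSet ε (treeFaces T)) :
    IsBarycentricSubdivision e (barycentricMap e) := by
  classical
  have := finite_psiO (n := n)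
  have := Fintype.ofFinite (PsiO (n + 2))
  have hb : ∀ T, barycenter (closure (e T).1) ∈ faceSet ε (treeFaces T) := fun T => by
    rw [he]
    exact barycenter_mem_faceSet ((isNested_treeFaces T).faceSet_nonempty hε)
  have hτ : ∀ T T' : PsiO (n + 2), T ≤ T' ↔ treeFaces T' ⊆ treeFaces T := fun _ _ =>
    le_iff_treeFaces_subset
  have hmap : barycentricMap e =
      Fintype.linearCombination ℝ fun T => barycenter (closure (e T).1) := by
    funext f
    rw [barycentricMap, finsum_eq_sum_of_fintype, Fintype.linearCombination_apply]
  have hmem : ∀ f ∈ orderRealization (PsiO (n + 2)), ∀ T ∈ f.support,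
      (∀ T' ∈ f.support, T' ≤ T) → barycentricMap e f ∈ faceSet ε (treeFaces T) := by
    intro f hf T hT hmax
    rw [hmap]
    exact tightSet_linearCombination hτ hb hf hT hmax
  have hmaps : MapsTo (barycentricMap e) (orderRealization (PsiO (n + 2))) (associahedron n ε) := by
    intro f hf
    obtain ⟨T, hT, hmax⟩ := exists_top_of_mem_orderRealization hf
    exact (hmem f hf T hT hmax).1
  have hcont : Continuous (barycentricMap e) := by
    rw [hmap]
    exact LinearMap.continuous_of_finiteDimensional _
  refine ⟨hmaps, hcont.continuousOn, ?_, ?_, ?_⟩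
  · refine exists_continuousOn_inverse isCompact_orderRealization hcont.continuousOn ?_ ?_
    · rw [hmap]
      exact injOn_linearCombination hτ hb
    · refine hmaps.image_subset.antisymm ?_
      rw [hmap]
      exact surjOn_linearCombination hτ hb fun x hx =>
        exists_treeFaces_eq (isNested_tightSet hε hx)
  · intro c hc
    rw [hmap]
    exact isDiffeoOn_simplex hτ hb hc
  · intro f hf T hT hmax
    rw [he]
    exact hmem f hf T hT hmax

end Subdivision

theorem mainTheorem6 (n : ℕ) (ε : Finset (Fin (n + 1)) → ℝ) (hε : IsTruncationDepth ε) :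
    IsManifoldWithCorners n (associahedron n ε) ∧
    IsManifoldWithCorners n (confTildeCompactOrdered (n + 2)) ∧
    IsManifoldWithCorners n (confIntervalCompactOrdered n) ∧
    ∃ φ ψ,
      IsDiffeoOn φ (associahedron n ε) (confTildeCompactOrdered (n + 2)) ∧
      IsDiffeoOn ψ (associahedron n ε) (confIntervalCompactOrdered n) ∧
      ∃ (e : PsiO (n + 2) ≃o OpenFace n (associahedron n ε))
        (e' : PsiO (n + 2) ≃o OpenFace n (confTildeCompactOrdered (n + 2)))
        (e'' : PsiO (n + 2) ≃o OpenFace n (confIntervalCompactOrdered n)),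
        IsBarycentricSubdivision e (barycentricMap e) ∧
        IsBarycentricSubdivision e' (φ ∘ barycentricMap e) ∧
        IsBarycentricSubdivision e'' (ψ ∘ barycentricMap e) := by
  have hA := isManifoldWithCorners_associahedron hε
  obtain ⟨g, hg, -⟩ := (isDiffeoOn_minkowskiMap hε).exists_symm
  have hφ := isDiffeoOn_confOfRatios.comp hg
  have hψ := isDiffeoOn_intervalOfRatios.comp hg
  obtain ⟨e, he⟩ := exists_treeIso hε
  obtain ⟨e₁, he₁⟩ := hφ.exists_faceIso n
  obtain ⟨e₂, he₂⟩ := hψ.exists_faceIso n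
  have hB := isBarycentricSubdivision_associahedron hε he
  exact ⟨hA, hA.transport hφ, hA.transport hψ, _, _, hφ, hψ, e, e.trans e₁, e.trans e₂, hB,
    hB.transport hφ he₁, hB.transport hψ he₂⟩
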